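/- **Setting.** Let $m\ge 0$, $\mathcal E_a<\mathcal E_b$, $C_E,M_0\in\mathbb R$. Consider the discretized Anderson–Holstein system with semiclassical parameter $\varepsilon>0$ and $N\ge1$ metal orbitals on $\mathbb R^m$, $$\mathrm i\varepsilon\partial_tu_0=-\tfrac{\varepsilon^2}{2}\Delta u_0+U_0u_0+\varepsilon\sum_{k=1}^N hV(\mathcal E_k,x)u_k,\qquad \mathrm i\varepsilon\partial_tu_k=-\tfrac{\varepsilon^2}{2}\Delta u_k+(U_1+\mathcal E_k)u_k+\varepsilon\overline V(\mathcal E_k,x)u_0,$$ where $h=(\mathcal E_b-\mathcal E_a)/N$, $\mathcal E_k=\mathcal E_a+(k-\frac12)h$, with initial data $u_k(0)=0$ for $1\le k\le N$ and $$u_0(0,x)=u_{0,\rm in}(x)=\Big(\prod_{j=1}^m a_j\Big)^{1/4}(\pi\varepsilon)^{-m/4}e^{\frac{\mathrm i}{\varepsilon}\tilde p\cdot(x-\tilde q)}e^{-\sum_j\frac{a_j}{2\varepsilon}(x_j-\tilde q_j)^2},\qquad a_j>0,\ \tilde p,\tilde q\in\mathbb R^m.$$ Assume $U_0,U_1\in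 C^\infty(\mathbb R^m;\mathbb R)$ with $|\partial_\alpha U_k|\le C_E$ on $\mathbb R^m$ for all $|\alpha|=2$, and, for all $\mathcal E\in[\mathcal E_a,\mathcal E_b]$, that $V(\mathcal E,\cdot)$ is measurable with $|V(\mathcal E,\cdot)|\le M_0$. **Hop histories.** A history with $\nu\ge0$ hops consists of times $0<t_1<\dots<t_\nu$ and orbitals $\kappa=(k_1,\dots,k_{\lceil\nu/2\rceil})\in\{1,\dots,N\}^{\lceil\nu/2\rceil}$: starting on surface $0$, the hop at $t_{2j-1}$ leads from $0$ to $k_j$ and the hop at $t_{2j}$ leads from $k_j$ to $0$. Let $l(s)$ be the surface occupied at time $s$, and $\widetilde U(s,\cdot)=U_0$ if $l(s)=0$, $\widetilde U(s,\cdot)=U_1+\mathcal E_k$ if $l(s)=k\ge1$. Along a history, and for $z_0=(q,p)\in\mathbb R^{2m}$, let $Q,P,S,A$ be continuous in $s\ge0$, start at $s=0$ from $q$, $p$, $0$ and $$A_0(z_0)=2^{m/2}\int_{\mathbb R^m}u_{0,\rm in}(y)e^{\frac{\mathrm i}\varepsilon(-p\cdot(y-q)+\frac{\mathrm i}2|y-q|^2)}\,\mathrm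 dy,$$ and satisfy between the hops $$\dot Q=P,\quad \dot P=-\nabla\widetilde U(s,Q),\quad \dot S=\tfrac12|P|^2-\widetilde U(s,Q),\quad \dot A=\tfrac12A\,\mathrm{tr}\big(Z^{-1}(\partial_zP-\mathrm i\,\partial_zQ\,\nabla^2\widetilde U(s,Q))\big),$$ where $\partial_z=\partial_q-\mathrm i\partial_p$, $(\partial_zF)_{jk}=\partial_{z_j}F_k$, $Z=\partial_z(Q+\mathrm iP)$. Put $\Theta=S+P\cdot(x-Q)+\frac{\mathrm i}2|x-Q|^2$. Let $\tau_i$ be the hopping coefficient of the $i$-th hop: $-\mathrm i\overline V(\mathcal E_k,Q(t_i))$ for a hop from $0$ to $k$, and $-\mathrm iV(\mathcal E_k,Q(t_i))$ for a hop from $k$ to $0$. The hop rates at position $q$ are $h|V(\mathcal E_k,q)|$ from $0$ to $k$, $|V(\mathcal E_k,q)|$ from $k$ to $0$, and $0$ otherwise; let $\lambda_l(q)$ be the total rate out of surface $l$, and $L=\int_0^t\lambda_{l(s)}(Q(s))\,\mathrm ds$. **Frozen Gaussian representation.** $\mathbf U_{\rm FG}(t,x)\in\mathbb C^{N+1}$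 has as its component on surface $l$ the sum over all $\nu\ge0$ and all $\kappa$ for which the history ends on $l$ of $$\frac1{(2\pi\varepsilon)^{3m/2}}\int_{\mathbb R^{2m}}\int_{0<t_1<\dots<t_\nu<t}h^{\lfloor\nu/2\rfloor}\Big(\prod_{i=1}^\nu\tau_i\Big)A(t)\,e^{\frac{\mathrm i}\varepsilon\Theta(t,x)}\,\mathrm dt_1\cdots\mathrm dt_\nu\,\mathrm dz_0 .$$ **Sampling.** The stochastic trajectory $\widetilde z_t$ has initial point $z_0$ with density $\pi=|A_0|/\int|A_0|$, and given $z_0$ the history on $[0,t]$ is that of the jump process with the above rates, that is, on each $(\nu,\kappa)$ it has density $e^{-L}\prod_{i=1}^\nu r_i$ on $\{0<t_1<\dots<t_\nu<t\}$, with $r_i$ the rate of the $i$-th hop at $Q(t_i)$. Let $$W(t,x;\widetilde z_t)=\frac{1}{(2\pi\varepsilon)^{3m/2}\,\pi(z_0)}\,A(t)\,e^{\frac{\mathrm i}\varepsilon\Theta(t,x)}\,\Gamma,\qquad \Gamma=e^{L}\prod_{i=1}^\nu\frac{\tau_i}{|\tau_i|},$$ and let $\Lambda(t,x;\widetilde z_t)\in\mathbb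 C^{N+1}$ have as its only possibly nonzero component the one on the surface occupied at time $t$, equal to $W$ if that surface is $0$ and to $W/h$ otherwise. With $R_N=\mathrm{diag}(1,h,\dots,h)$ and $M\ge1$ independent copies $\widetilde z_t^{(1)},\dots,\widetilde z_t^{(M)}$ of $\widetilde z_t$, put $$\mathrm{Err}_M(t,N)=\Big(\mathbb E\,\Big\|R_N\Big(\frac1M\sum_{j=1}^M\Lambda(t,\cdot;\widetilde z_t^{(j)})-\mathbf U_{\rm FG}(t,\cdot)\Big)\Big\|_{L^2(\mathbb R^m,\mathbb C^{N+1})}^2\Big)^{1/2}.$$ **Theorem.** There is a function $K$, which depends only on $m,\mathcal E_a,\mathcal E_b,C_E,M_0$ (in particular neither on $\varepsilon$ nor on $N$), such that for all $\varepsilon,a,\tilde p,\tilde q,U_0,U_1,V,N$ as above, all $M\ge1$ and all $t\ge0$, the objects above are well defined (the dynamics has a solution along every history with hop times in $(0,t)$, the law of $\widetilde z_t$ is a probability measure, the integrals and the series that define $\mathbf U_{\rm FG}(t,x)$ converge absolutely, the error is a measurable function of the samples) and $$\mathrm{Err}_M(t,N)\le\frac1{\sqrt M}\,K(t)\prod_{j=1}^m\Big(\frac{1+a_j}{\sqrt{a_j}}\Big)^{1/2}.$$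 -/

import Mathlib

open MeasureTheory

noncomputable section

namespace FGS

/-- Position space `ℝᵐ`. -/
abbrev Pos (m : ℕ) : Type := EuclideanSpace ℝ (Fin m)

/-- Phase space `ℝ²ᵐ`, a point is `z = (q, p)`. -/
abbrev Phase (m : ℕ) : Type := Pos m × Pos m

/-- Parameters of the Anderson-Holstein system with Gaussian initial datum: the semiclassical
parameter `ε`, the metal band `[Ea, Eb]`, the potentials `U₀`, `U₁`, the coupling `V (energy) x`,
and the widths `a`, centre `qt` and momentum `pt` of the initial wave packet. -/
structure Data (m : ℕ) where
  ε : ℝ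
  Ea : ℝ
  Eb : ℝ
  U₀ : Pos m → ℝ
  U₁ : Pos m → ℝ
  V : ℝ → Pos m → ℂ
  a : Fin m → ℝ
  qt : Pos m
  pt : Pos m

/-- The Hessian matrix `∇²U (q)`. -/
def hessian {m : ℕ} (U : Pos m → ℝ) (q : Pos m) : Matrix (Fin m) (Fin m) ℝ :=
  Matrix.of fun j k =>
    iteratedFDeriv ℝ 2 U q ![EuclideanSpace.single j 1, EuclideanSpace.single k 1]

/-- `∂_z F` at `z`, where `∂_z = ∂_q - i ∂_p`; its `(j, k)` entry is `∂_{z_j} F_k`. -/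
def dz {m : ℕ} (F : Phase m → Pos m) (z : Phase m) : Matrix (Fin m) (Fin m) ℂ :=
  Matrix.of fun j k =>
    ((fderiv ℝ F z (EuclideanSpace.single j 1, 0) k : ℝ) : ℂ)
      - Complex.I * ((fderiv ℝ F z (0, EuclideanSpace.single j 1) k : ℝ) : ℂ)

/-! ### Hop histories

A surface is `none` (the molecule orbital, index `0`) or `some k` (the `k`-th metal orbital). A
history with `ν` hops is given by the hop times `T 0 < T 1 < ⋯ < T (ν - 1)` and by the metal
orbitals `κ 0, κ 1, …, κ (⌈ν/2⌉ - 1)` in the order in which they are visited. Even-numbered hops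
(counting from `0`) lead from the molecule to a metal orbital, odd-numbered ones lead back. -/

/-- The surface after the first `i` hops. -/
def stateAfter {N ν : ℕ} (κ : Fin ((ν + 1) / 2) → Fin N) (i : ℕ) : Option (Fin N) :=
  if hi : i % 2 = 1 ∧ i / 2 < (ν + 1) / 2 then some (κ ⟨i / 2, hi.2⟩) else none

/-- The surface that is occupied at time `s`. -/
def surfaceAt {N ν : ℕ} (κ : Fin ((ν + 1) / 2) → Fin N) (T : Fin ν → ℝ) (s : ℝ) :
    Option (Fin N) :=
  stateAfter κ (Finset.univ.filter fun i => T i ≤ s).card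

/-- The hop-time sequences `0 < t₁ < ⋯ < t_ν < t`. -/
def hopTimes (ν : ℕ) (t : ℝ) : Set (Fin ν → ℝ) :=
  {T | StrictMono T ∧ ∀ i, T i ∈ Set.Ioo 0 t}

/-- Hop histories with any number of hops: `⟨ν, (κ, T)⟩`. -/
abbrev History (N : ℕ) : Type := Σ ν : ℕ, (Fin ((ν + 1) / 2) → Fin N) × (Fin ν → ℝ)

/-- What one run of the stochastic trajectory up to time `t` consists of: the initial phase space
point together with the hop history. -/
abbrev Path (m N : ℕ) : Type := Phase m × History N

/-- The functions `Q, P, S, A` of time and of the initial phase space point. -/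
structure Trajectory (m : ℕ) where
  Q : ℝ → Phase m → Pos m
  P : ℝ → Phase m → Pos m
  S : ℝ → Phase m → ℝ
  A : ℝ → Phase m → ℂ

instance (m : ℕ) : Nonempty (Trajectory m) :=
  ⟨⟨fun _ _ => 0, fun _ _ => 0, fun _ _ => 0, fun _ _ => 0⟩⟩

/-- `Z = ∂_z (Q + i P)` at time `s`. -/
def Trajectory.Z {m : ℕ} (X : Trajectory m) (s : ℝ) (z : Phase m) : Matrix (Fin m) (Fin m) ℂ :=
  dz (X.Q s) z + Complex.I • dz (X.P s) z

namespace Data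

variable {m : ℕ} (D : Data m)

/-- The spacing `h = (Eb - Ea) / N` of the discretized band. -/
def h (N : ℕ) : ℝ := (D.Eb - D.Ea) / N

/-- The energy of the `k`-th metal orbital, at the midpoint of the `k`-th cell (orbitals
are counted from `0`). -/
def level (N : ℕ) (k : Fin N) : ℝ := D.Ea + ((k : ℝ) + 1 / 2) * D.h N

/-- The potential of a surface. -/
def potential (N : ℕ) : Option (Fin N) → Pos m → ℝ
  | none, q => D.U₀ q
  | some k, q => D.U₁ q + D.level N k

/-- The hopping coefficient `τ` of a hop from one surface to another at the position `q`. -/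
def hopCoeff (N : ℕ) : Option (Fin N) → Option (Fin N) → Pos m → ℂ
  | none, some k, q => -Complex.I * (starRingEnd ℂ) (D.V (D.level N k) q)
  | some k, none, q => -Complex.I * D.V (D.level N k) q
  | _, _, _ => 0

/-- The off-diagonal entries `λ_{l l'}(q)` of the matrix of transition rates. -/
def hopRate (N : ℕ) : Option (Fin N) → Option (Fin N) → Pos m → ℝ
  | none, some k, q => D.h N * ‖D.V (D.level N k) q‖
  | some k, none, q => ‖D.V (D.level N k) q‖
  | _, _, _ => 0

/-- The total rate `-λ_{l l}(q)` at which the surface `l` is left. -/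
def exitRate (N : ℕ) (l : Option (Fin N)) (q : Pos m) : ℝ := ∑ l', D.hopRate N l l' q

/-- The Gaussian initial datum `u_{0,in}`. -/
def initialWave (x : Pos m) : ℂ :=
  (((∏ j, D.a j) ^ (1 / 4 : ℝ) * (Real.pi * D.ε) ^ (-(m : ℝ) / 4) : ℝ) : ℂ)
    * Complex.exp (Complex.I / D.ε * (inner ℝ D.pt (x - D.qt) : ℝ))
    * Complex.exp (-((∑ j, D.a j / (2 * D.ε) * (x j - D.qt j) ^ 2 : ℝ) : ℂ))

/-- The initial amplitude `A₀⁽⁰⁾(0, q, p)`. -/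
def initialAmp (z : Phase m) : ℂ :=
  (((2 : ℝ) ^ ((m : ℝ) / 2) : ℝ) : ℂ) * ∫ y : Pos m, D.initialWave y
    * Complex.exp (Complex.I / D.ε *
        (-((inner ℝ z.2 (y - z.1) : ℝ) : ℂ) + Complex.I / 2 * ((‖y - z.1‖ ^ 2 : ℝ) : ℂ)))

/-- The density `π` that the initial phase space point is sampled from. -/
def initialDensity (z : Phase m) : ℝ := ‖D.initialAmp z‖ / ∫ z' : Phase m, ‖D.initialAmp z'‖

/-- `X` solves the frozen Gaussian dynamics along the hop history `(κ, T)`: with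
`Ũ(s, ·)` the potential of the surface occupied at time `s`, the functions are continuous on
`[0, ∞)`, start from `(q, p, 0, A₀⁽⁰⁾(0, q, p))`, and satisfy the differential equations between
the hops. -/
structure Solves {N ν : ℕ} (κ : Fin ((ν + 1) / 2) → Fin N) (T : Fin ν → ℝ)
    (X : Trajectory m) : Prop where
  Q_zero : ∀ z, X.Q 0 z = z.1
  P_zero : ∀ z, X.P 0 z = z.2
  S_zero : ∀ z, X.S 0 z = 0
  A_zero : ∀ z, X.A 0 z = D.initialAmp z
  Q_cont : ∀ z, ContinuousOn (fun s => X.Q s z) (Set.Ici 0)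
  P_cont : ∀ z, ContinuousOn (fun s => X.P s z) (Set.Ici 0)
  S_cont : ∀ z, ContinuousOn (fun s => X.S s z) (Set.Ici 0)
  A_cont : ∀ z, ContinuousOn (fun s => X.A s z) (Set.Ici 0)
  Q_deriv : ∀ z, ∀ s, 0 < s → s ∉ Set.range T →
    HasDerivAt (fun r => X.Q r z) (X.P s z) s
  P_deriv : ∀ z, ∀ s, 0 < s → s ∉ Set.range T →
    HasDerivAt (fun r => X.P r z) (-gradient (D.potential N (surfaceAt κ T s)) (X.Q s z)) s
  S_deriv : ∀ z, ∀ s, 0 < s → s ∉ Set.range T →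
    HasDerivAt (fun r => X.S r z)
      (1 / 2 * ‖X.P s z‖ ^ 2 - D.potential N (surfaceAt κ T s) (X.Q s z)) s
  A_deriv : ∀ z, ∀ s, 0 < s → s ∉ Set.range T →
    HasDerivAt (fun r => X.A r z)
      (1 / 2 * X.A s z * ((X.Z s z)⁻¹ * (dz (X.P s) z - Complex.I • (dz (X.Q s) z *
        (hessian (D.potential N (surfaceAt κ T s)) (X.Q s z)).map Complex.ofReal))).trace) s

/-- The solution of the frozen Gaussian dynamics along a hop history. -/
def traj {N ν : ℕ} (κ : Fin ((ν + 1) / 2) → Fin N) (T : Fin ν → ℝ) : Trajectory m :=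
  Classical.epsilon (D.Solves κ T)

/-- The phase function `Θ` at time `t`. -/
def phaseFn {N ν : ℕ} (κ : Fin ((ν + 1) / 2) → Fin N) (T : Fin ν → ℝ) (t : ℝ) (z : Phase m)
    (x : Pos m) : ℂ :=
  let X := D.traj κ T
  (X.S t z : ℂ) + ((inner ℝ (X.P t z) (x - X.Q t z) : ℝ) : ℂ)
    + Complex.I / 2 * ((‖x - X.Q t z‖ ^ 2 : ℝ) : ℂ)

/-- The hopping coefficient of the `i`-th hop of the history. -/
def tau {N ν : ℕ} (κ : Fin ((ν + 1) / 2) → Fin N) (T : Fin ν → ℝ) (z : Phase m) (i : Fin ν) : ℂ :=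
  D.hopCoeff N (stateAfter κ i) (stateAfter κ (i + 1)) ((D.traj κ T).Q (T i) z)

/-- The exit rate integrated along the trajectory over `[0, t]`, that is, the sum over the
hop-free intervals of the integrals of the exit rate of the surface occupied there. -/
def cumulatedRate {N ν : ℕ} (κ : Fin ((ν + 1) / 2) → Fin N) (T : Fin ν → ℝ) (t : ℝ)
    (z : Phase m) : ℝ :=
  ∫ s in (0 : ℝ)..t, D.exitRate N (surfaceAt κ T s) ((D.traj κ T).Q s z)

/-- The density of the event that the jump process started from `z` on the molecule orbital
has in `[0, t]` exactly the hops `(κ, T)`: the rates of these hops times the probability of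
no other hop. -/
def hopDensity {N ν : ℕ} (κ : Fin ((ν + 1) / 2) → Fin N) (T : Fin ν → ℝ) (t : ℝ)
    (z : Phase m) : ℝ :=
  Real.exp (-D.cumulatedRate κ T t z) *
    ∏ i : Fin ν, D.hopRate N (stateAfter κ i) (stateAfter κ (i + 1)) ((D.traj κ T).Q (T i) z)

/-- The law on `[0, t]` of the stochastic trajectory: the initial point has density `π`, and given
it, the hop history has the density `hopDensity` on each sheet `(ν, κ)`. -/
def pathLaw (N : ℕ) (t : ℝ) : Measure (Path m N) :=
  Measure.sum fun i : Σ ν : ℕ, (Fin ((ν + 1) / 2) → Fin N) =>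
    (((volume : Measure (Phase m)).prod (volume.restrict (hopTimes i.1 t))).withDensity fun w =>
      ENNReal.ofReal (D.initialDensity w.1 * D.hopDensity i.2 w.2 t w.1)).map
        fun w => (w.1, (⟨i.1, (i.2, w.2)⟩ : History N))

/-- The factor `Γ`. -/
def weight {N ν : ℕ} (κ : Fin ((ν + 1) / 2) → Fin N) (T : Fin ν → ℝ) (t : ℝ) (z : Phase m) : ℂ :=
  (Real.exp (D.cumulatedRate κ T t z) : ℂ) * ∏ i : Fin ν, D.tau κ T z i / (‖D.tau κ T z i‖ : ℂ)

/-- The scalar wave packet `W(t, x; z̃_t)`. -/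
def packet {N : ℕ} (t : ℝ) (ω : Path m N) (x : Pos m) : ℂ :=
  let κ := ω.2.2.1
  let T := ω.2.2.2
  (((2 * Real.pi * D.ε) ^ (-(3 * (m : ℝ) / 2)) / D.initialDensity ω.1 : ℝ) : ℂ)
    * (D.traj κ T).A t ω.1 * Complex.exp (Complex.I / D.ε * D.phaseFn κ T t ω.1 x)
    * D.weight κ T t ω.1

/-- The component `Λ_l(t, x; z̃_t)`, for the surface `l`, of the vector-valued wave packet. -/
def packetVec {N : ℕ} (t : ℝ) (ω : Path m N) (l : Option (Fin N)) (x : Pos m) : ℂ :=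
  if stateAfter ω.2.2.1 ω.2.1 = l then
    (match l with
      | none => 1
      | some _ => 1 / (D.h N : ℂ)) * D.packet t ω x
  else 0

/-- The integrand of the contribution `u^(ν)` of the sheet `(ν, κ)` to the integral representation,
at `w = (z₀, T)`. -/
def termIntegrand {N ν : ℕ} (κ : Fin ((ν + 1) / 2) → Fin N) (t : ℝ) (x : Pos m)
    (w : Phase m × (Fin ν → ℝ)) : ℂ :=
  (D.h N : ℂ) ^ (ν / 2) * (∏ i : Fin ν, D.tau κ w.2 w.1 i)
    * (D.traj κ w.2).A t w.1 * Complex.exp (Complex.I / D.ε * D.phaseFn κ w.2 t w.1 x)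

/-- The contribution `u^(ν)` of the sheet `(ν, κ)` to the integral representation. -/
def term {N ν : ℕ} (κ : Fin ((ν + 1) / 2) → Fin N) (t : ℝ) (x : Pos m) : ℂ :=
  (((2 * Real.pi * D.ε) ^ (-(3 * (m : ℝ) / 2)) : ℝ) : ℂ) *
    ∫ w : Phase m × (Fin ν → ℝ), D.termIntegrand κ t x w
      ∂((volume : Measure (Phase m)).prod (volume.restrict (hopTimes ν t)))

/-- The sum of all contributions with `ν` hops that end on the surface `l`. -/
def termSum (N : ℕ) (t : ℝ) (l : Option (Fin N)) (x : Pos m) (ν : ℕ) : ℂ :=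
  ∑ κ : Fin ((ν + 1) / 2) → Fin N, if stateAfter κ ν = l then D.term κ t x else 0

/-- The component on the surface `l` of the frozen Gaussian (surface hopping) representation
`U_FG`. -/
def UFG (N : ℕ) (t : ℝ) (l : Option (Fin N)) (x : Pos m) : ℂ := ∑' ν, D.termSum N t l x ν

/-- The diagonal `(1, h, …, h)` of the weight matrix `R_N`. -/
def diagR (N : ℕ) : Option (Fin N) → ℝ
  | none => 1
  | some _ => D.h N

/-- The weighted `L²(ℝᵐ, ℂᴺ⁺¹)` error of the average of the `M` sampled wave packets. -/
def sampleError {N M : ℕ} (t : ℝ) (ω : Fin M → Path m N) : ENNReal :=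
  eLpNorm (fun x : Pos m => (WithLp.toLp 2 fun l : Option (Fin N) =>
    (D.diagR N l : ℂ) * ((1 / (M : ℂ)) * (∑ j, D.packetVec t (ω j) l x) - D.UFG N t l x) :
      EuclideanSpace ℂ (Option (Fin N)))) 2 volume

/-- The mean square error `Err_M(t, N)` over `M` independent samples. -/
def Err (M : ℕ) (t : ℝ) (N : ℕ) : ENNReal :=
  (∫⁻ ω : Fin M → Path m N, D.sampleError t ω ^ 2
    ∂(Measure.pi fun _ : Fin M => D.pathLaw N t)) ^ (1 / 2 : ℝ)

/-- The objects that enter `Err_M(t, N)` are what they are meant to be: the frozen Gaussian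
dynamics has a solution along every hop history, the law of the trajectory is a probability
measure, the integrals and the series defining `U_FG` converge absolutely, and the error is a
measurable function of the samples. -/
structure WellDefined (M : ℕ) (t : ℝ) (N : ℕ) : Prop where
  solves : ∀ (ν : ℕ) (κ : Fin ((ν + 1) / 2) → Fin N), ∀ T ∈ hopTimes ν t,
    D.Solves κ T (D.traj κ T)
  prob : IsProbabilityMeasure (D.pathLaw N t)
  integrable : ∀ (ν : ℕ) (κ : Fin ((ν + 1) / 2) → Fin N) (x : Pos m),
    Integrable (D.termIntegrand κ t x)
      ((volume : Measure (Phase m)).prod (volume.restrict (hopTimes ν t)))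
  summable : ∀ (l : Option (Fin N)) (x : Pos m), Summable (D.termSum N t l x)
  measurable : AEMeasurable (fun ω : Fin M → Path m N => D.sampleError t ω)
    (Measure.pi fun _ : Fin M => D.pathLaw N t)

end Data

end FGS

end

noncomputable section

namespace FGS

open Set Filter Topology NNReal

/-! ### Carathéodory differential equations with a measurable parameter -/

/-! The average of `M` independent copies of an unbiased estimator has mean square error at most the
second moment of one copy divided by `M`. Two facts are therefore needed: `Λ` is unbiased for `U_FG`
at every `x`, and the squared `L²` norm of `R_N Λ` is bounded on every path by a constant free of
`ε` and `N`. Tonelli's theorem connects them: the variance is taken at fixed `x`, the Gaussian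
integral at a fixed path.

Unbiasedness is a cancellation on each sheet `(ν, κ)` (`density_mul_packetVec`). In the product of
path density and packet, `π` and `e^L` disappear and every hop contributes its rate times `τ/|τ|`,
which is `h τ` when the molecule is left and `τ` otherwise. This leaves `h` to the power `⌈ν/2⌉`,
and the factor `1/h` on metal surfaces lowers it to `⌊ν/2⌋`. Summing over the sheets gives `UFG_eq`,
and summability follows because the packet is integrable against the law of the paths.

For the bound, `R_N` undoes the factor `1/h`, so only `|W|` matters (`sum_enorm_packetVec`). Its
phase has modulus `exp(-|x-Q|²/(2ε))`. The weight is at most `e^L`, and the exit rates are bounded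
uniformly in `N` because `N h` is the band width (`exitRate_le`). The quotient `|A|/π` is at most
`∫|A₀|` times the growth of the amplitude. That growth is controlled because the flow is symplectic:
`Z Z*` is the sum of two positive semidefinite matrices and twice the identity, so `Z⁻¹` is bounded
(`norm_inv_zMatrix_le`), while Gronwall's inequality bounds the Jacobian. Finally `∫|A₀|` is an
explicit Gaussian integral (`integral_norm_initialAmp`), whose powers of `ε` cancel against the
prefactor and the `L²` norm of the Gaussian in `x`.

The rest is well-posedness. The force jumps at the hops, so the equations are solved in integral
form, measurably in the initial point and the hop times, and the flow is differentiated in the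
initial point because `Z` contains these derivatives. Uniqueness transfers measurability to the
trajectory selected by `Classical.epsilon`. It also shows that a trajectory does not anticipate
later hops, so that the last hop can be integrated out; the probabilities of at least `ν` hops then
telescope and tend to zero (`tsum_probEq`). -/

theorem intervalIntegrable_of_norm_le {E : Type*} [NormedAddCommGroup E] {g : ℝ → E} {s K : ℝ}
    (hs : 0 ≤ s) (hg : AEStronglyMeasurable g volume) (hK : ∀ r ∈ Icc 0 s, ‖g r‖ ≤ K) :
    IntervalIntegrable g volume 0 s := by
  rw [intervalIntegrable_iff_integrableOn_Ioc_of_le hs]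
  refine Measure.integrableOn_of_bounded (M := K) (by simp) hg ?_
  filter_upwards [ae_restrict_mem measurableSet_Ioc] with r hr using hK r ⟨hr.1.le, hr.2⟩

theorem integral_exp_mul_le {c s : ℝ} (hc : 0 < c) (hs : 0 ≤ s) :
    ∫ r in Ioc 0 s, Real.exp (c * r) ≤ Real.exp (c * s) / c := by
  rw [← intervalIntegral.integral_of_le hs, intervalIntegral.integral_comp_mul_left _ hc.ne',
    integral_exp]
  simp only [mul_zero, Real.exp_zero, smul_eq_mul]
  rw [inv_mul_eq_div]
  gcongr
  linarith

/-- Integration against the weight `e^{cr}` gains a factor `1/c`. A large `c` thus makes the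
integral operator of a Lipschitz equation a contraction on time intervals of any length. -/
theorem norm_integral_Ioc_le_exp {E : Type*} [NormedAddCommGroup E] [NormedSpace ℝ E]
    {g : ℝ → E} {K c s : ℝ} (hK : 0 ≤ K) (hc : 0 < c)
    (hg : ∀ r ∈ Ioc 0 s, ‖g r‖ ≤ K * Real.exp (c * r)) :
    ‖∫ r in Ioc 0 s, g r‖ ≤ K / c * Real.exp (c * s) := by
  rcases le_or_gt s 0 with hs | hs
  · rw [Ioc_eq_empty (by simpa using hs)]
    simp only [Measure.restrict_empty, integral_zero_measure, norm_zero]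
    positivity
  · calc ‖∫ r in Ioc 0 s, g r‖ ≤ ∫ r in Ioc 0 s, K * Real.exp (c * r) := by
          refine norm_integral_le_of_norm_le ?_ ?_
          · exact (Continuous.integrableOn_Ioc (by fun_prop))
          · filter_upwards [ae_restrict_mem measurableSet_Ioc] with r hr using hg r hr
      _ = K * ∫ r in Ioc 0 s, Real.exp (c * r) := integral_const_mul _ _
      _ ≤ K * (Real.exp (c * s) / c) := by gcongr; exact integral_exp_mul_le hc hs.le
      _ = _ := by ring

/-- The integral form of Gronwall's inequality, with a non-optimal constant. -/
theorem le_exp_of_le_add_integral {u : ℝ → ℝ} {A C t : ℝ} (hA : 0 ≤ A) (hC : 0 ≤ C)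
    (ht : 0 ≤ t) (hu : ContinuousOn u (Icc 0 t))
    (h : ∀ s ∈ Icc 0 t, u s ≤ A + C * ∫ r in (0 : ℝ)..s, u r) :
    ∀ s ∈ Icc 0 t, u s ≤ 2 * A * Real.exp ((2 * C + 1) * s) := by
  -- This choice gives `C / c ≤ 1/2`, so at the maximum point of `e^{-cs} u(s)` the integral term
  -- accounts for at most half of the maximum; the other half is at most `A`. The summand `1` keeps
  -- `c` positive if `C = 0`.
  set c := 2 * C + 1 with hc
  have hc0 : 0 < c := by positivity
  obtain ⟨s₀, hs₀, hmax⟩ := isCompact_Icc.exists_isMaxOn (nonempty_Icc.2 ht)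
    (f := fun s => Real.exp (-(c * s)) * u s) (by fun_prop)
  set σ := Real.exp (-(c * s₀)) * u s₀ with hσ
  have hle : ∀ s ∈ Icc 0 t, u s ≤ σ * Real.exp (c * s) := by
    intro s hs
    have h1 : Real.exp (-(c * s)) * u s ≤ σ := hmax hs
    have h2 : u s = (Real.exp (-(c * s)) * u s) * Real.exp (c * s) := by
      rw [mul_right_comm, ← Real.exp_add]; simp
    rw [h2]; gcongr
  have key : σ ≤ 2 * A := by
    by_contra! hcon
    have hσ0 : 0 < σ := by linarith
    have h1 : ∫ r in (0 : ℝ)..s₀, u r ≤ σ * (Real.exp (c * s₀) / c) := by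
      calc ∫ r in (0 : ℝ)..s₀, u r ≤ ∫ r in (0 : ℝ)..s₀, σ * Real.exp (c * r) := by
            refine intervalIntegral.integral_mono_on hs₀.1 ?_ ?_ ?_
            · refine ContinuousOn.intervalIntegrable ?_
              rw [uIcc_of_le hs₀.1]
              exact hu.mono (Icc_subset_Icc_right hs₀.2)
            · exact Continuous.intervalIntegrable (by fun_prop) _ _
            · intro x hx; exact hle x ⟨hx.1, hx.2.trans hs₀.2⟩
        _ = σ * ∫ r in (0 : ℝ)..s₀, Real.exp (c * r) := intervalIntegral.integral_const_mul _ _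
        _ ≤ _ := by
            gcongr
            rw [intervalIntegral.integral_of_le hs₀.1]
            exact integral_exp_mul_le hc0 hs₀.1
    have h2 := h s₀ hs₀
    have h3 : u s₀ ≤ A + C * (σ * (Real.exp (c * s₀) / c)) := h2.trans (by gcongr)
    have h4 : C / c ≤ 1 / 2 := by rw [div_le_iff₀ hc0]; linarith
    have h5 : C * (σ * (Real.exp (c * s₀) / c)) ≤ σ / 2 * Real.exp (c * s₀) := by
      calc C * (σ * (Real.exp (c * s₀) / c)) = (C / c) * (σ * Real.exp (c * s₀)) := by ring
        _ ≤ 1 / 2 * (σ * Real.exp (c * s₀)) := by gcongr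
        _ = _ := by ring
    have h6 : σ = Real.exp (-(c * s₀)) * u s₀ := hσ
    have h7 : Real.exp (-(c * s₀)) * u s₀ ≤ A + σ / 2 := by
      calc Real.exp (-(c * s₀)) * u s₀
          ≤ Real.exp (-(c * s₀)) * (A + σ / 2 * Real.exp (c * s₀)) := by gcongr; linarith
        _ = Real.exp (-(c * s₀)) * A
            + σ / 2 * (Real.exp (-(c * s₀)) * Real.exp (c * s₀)) := by ring
        _ = Real.exp (-(c * s₀)) * A + σ / 2 := by rw [← Real.exp_add]; simp
        _ ≤ 1 * A + σ / 2 := by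
            gcongr
            rw [Real.exp_le_one_iff]
            have := hs₀.1
            simp only [Left.neg_nonpos_iff]; positivity
        _ = _ := by ring
    linarith
  intro s hs
  exact (hle s hs).trans (by gcongr)

/-- A continuous function whose derivative vanishes off a countable set is constant. -/
theorem eq_of_hasDerivAt_zero_off_countable {E : Type*} [NormedAddCommGroup E] [NormedSpace ℝ E]
    [CompleteSpace E] {f : ℝ → E} {t : ℝ} (ht : 0 ≤ t) {s : Set ℝ} (hs : s.Countable)
    (hf : ContinuousOn f (Icc 0 t)) (hd : ∀ x, 0 < x → x < t → x ∉ s → HasDerivAt f 0 x) :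
    f t = f 0 := by
  have := integral_eq_of_hasDerivAt_off_countable_of_le f (fun _ => 0) ht hs hf
    (fun x hx => hd x hx.1.1 hx.1.2 hx.2) (by simp)
  simp only [intervalIntegral.integral_zero] at this
  exact (sub_eq_zero.1 this.symm)

/-! ### Integrals over `Ioc 0 s` as functions of `s` and of a parameter. -/

section IntegralIoc

variable {E : Type*} [NormedAddCommGroup E] [NormedSpace ℝ E]

/-- The moving endpoint is absorbed into an indicator, which leaves a parameter integral over a
fixed domain. -/
theorem measurable_integral_Ioc {α : Type*} [MeasurableSpace α] [MeasurableSpace E]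
    [BorelSpace E] [SecondCountableTopology E] {g : α → ℝ → E}
    (hg : Measurable fun w : α × ℝ => g w.1 w.2) :
    Measurable fun w : α × ℝ => ∫ r in Ioc 0 w.2, g w.1 r := by
  have h1 : ∀ w : α × ℝ, ∫ r in Ioc 0 w.2, g w.1 r
      = ∫ r, {v : (α × ℝ) × ℝ | v.2 ∈ Ioc 0 v.1.2}.indicator (fun v => g v.1.1 v.2) (w, r) := by
    intro w
    rw [← integral_indicator measurableSet_Ioc]
    rfl
  simp_rw [h1]
  refine StronglyMeasurable.measurable ?_
  refine StronglyMeasurable.integral_prod_right (f := fun (w : α × ℝ) (r : ℝ) => _) ?_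
  refine Measurable.stronglyMeasurable (Measurable.indicator ?_ ?_)
  · exact hg.comp ((measurable_fst.comp measurable_fst).prodMk measurable_snd)
  · exact (measurableSet_lt measurable_const measurable_snd).inter
      (measurableSet_le measurable_snd (measurable_snd.comp measurable_fst))

/-- `Ioc 0 s` is empty for negative `s`, so this is the primitive of `g` cut off to positive times.
Solutions written with such integrals are defined on the whole line and constant before time `0`. -/
theorem continuous_integral_Ioc {g : ℝ → E} (hg : ∀ s, IntegrableOn g (Ioc 0 s) volume) :
    Continuous fun s => ∫ r in Ioc 0 s, g r := by
  have h1 : (fun s => ∫ r in Ioc 0 s, g r) = fun s =>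
      ∫ r in (0 : ℝ)..s, (Ioi (0 : ℝ)).indicator g r := by
    funext s
    rcases le_or_gt 0 s with hs | hs
    · rw [intervalIntegral.integral_of_le hs]
      refine setIntegral_congr_fun measurableSet_Ioc fun r hr => ?_
      rw [indicator_of_mem (show r ∈ Ioi (0 : ℝ) from hr.1)]
    · rw [intervalIntegral.integral_of_ge hs.le, Ioc_eq_empty (by simpa using hs.le)]
      rw [setIntegral_congr_fun measurableSet_Ioc (g := fun _ => 0) fun r hr => ?_]
      · simp
      · simp only
        rw [indicator_of_notMem (by simpa using hr.2)]
  rw [h1]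
  refine intervalIntegral.continuous_primitive ?_ 0
  intro u v
  refine (intervalIntegrable_iff.2 ?_)
  rw [IntegrableOn, integrable_indicator_iff measurableSet_Ioi, IntegrableOn,
    Measure.restrict_restrict measurableSet_Ioi]
  refine (hg (max u v)).mono_set ?_
  intro r hr
  exact ⟨hr.1, hr.2.2⟩

theorem hasDerivAt_integral_Ioc [CompleteSpace E] {g : ℝ → E} {s : ℝ} (hs : 0 < s)
    (hg : IntegrableOn g (Ioc 0 s) volume) (hm : AEStronglyMeasurable g volume)
    (hc : ContinuousAt g s) : HasDerivAt (fun s => ∫ r in Ioc 0 s, g r) (g s) s := by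
  have h1 := intervalIntegral.integral_hasDerivAt_right
    ((intervalIntegrable_iff_integrableOn_Ioc_of_le hs.le).2 hg)
    ⟨univ, univ_mem, by simpa using hm⟩ hc
  refine h1.congr_of_eventuallyEq ?_
  filter_upwards [lt_mem_nhds hs] with u hu
  rw [intervalIntegral.integral_of_le hu.le]

end IntegralIoc

/-! ### Picard iteration for equations that are only measurable in time and in a parameter. -/

section Picard

variable {α E : Type*} [MeasurableSpace α] [NormedAddCommGroup E] [MeasurableSpace E]

/-- The hypotheses of the Carathéodory existence theorem, uniform Lipschitz version. -/
structure IsCaratheodory (f : α → ℝ → E → E) (C : ℝ≥0) (B : α → ℝ) : Prop where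
  meas : Measurable fun w : (α × ℝ) × E => f w.1.1 w.1.2 w.2
  lip : ∀ a r, LipschitzWith C (f a r)
  bound : ∀ a r, ‖f a r 0‖ ≤ B a

/-- Picard iteration. -/
def picardIter [NormedSpace ℝ E] (f : α → ℝ → E → E) (x₀ : α → E) : ℕ → α → ℝ → E
  | 0 => fun a _ => x₀ a
  | n + 1 => fun a s => x₀ a + ∫ r in Ioc 0 s, f a r (picardIter f x₀ n a r)

variable {f : α → ℝ → E → E} {C : ℝ≥0} {B : α → ℝ} {x₀ : α → E}

theorem IsCaratheodory.norm_le (hf : IsCaratheodory f C B) (a : α) (r : ℝ) (x : E) :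
    ‖f a r x‖ ≤ B a + C * ‖x‖ := by
  have h1 := (hf.lip a r).norm_sub_le x 0
  have h2 := hf.bound a r
  have h3 : ‖f a r x‖ ≤ ‖f a r 0‖ + ‖f a r x - f a r 0‖ := norm_le_norm_add_norm_sub' _ _
  rw [sub_zero] at h1
  linarith

theorem IsCaratheodory.bound_nonneg (hf : IsCaratheodory f C B) (a : α) : 0 ≤ B a :=
  (norm_nonneg _).trans (hf.bound a 0)

variable [BorelSpace E] [SecondCountableTopology E]

theorem aestronglyMeasurable_caratheodory (hf : IsCaratheodory f C B) (a : α) {y : ℝ → E}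
    (hy : Measurable y) : AEStronglyMeasurable (fun r => f a r (y r)) volume :=
  (hf.meas.comp ((measurable_const.prodMk measurable_id).prodMk hy)).aestronglyMeasurable

theorem integrableOn_caratheodory (hf : IsCaratheodory f C B) (a : α) {y : ℝ → E}
    (hy : Measurable y) {s K : ℝ} (hK : ∀ r ∈ Ioc 0 s, ‖y r‖ ≤ K) :
    IntegrableOn (fun r => f a r (y r)) (Ioc 0 s) volume := by
  refine Measure.integrableOn_of_bounded (M := B a + C * K) (by simp)
    (aestronglyMeasurable_caratheodory hf a hy) ?_
  filter_upwards [ae_restrict_mem measurableSet_Ioc] with r hr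
  exact (hf.norm_le a r _).trans (by gcongr; exact hK r hr)

variable [NormedSpace ℝ E]

theorem measurable_picardIter (hf : IsCaratheodory f C B) (hx : Measurable x₀) (n : ℕ) :
    Measurable fun w : α × ℝ => picardIter f x₀ n w.1 w.2 := by
  induction n with
  | zero => exact hx.comp measurable_fst
  | succ n ih =>
    refine (hx.comp measurable_fst).add ?_
    exact measurable_integral_Ioc (g := fun a r => f a r (picardIter f x₀ n a r))
      (hf.meas.comp (measurable_id.prodMk ih))

/-- In the norm weighted by `e^{-cs}` with `c = 2C + 1`, one Picard step contracts by `C / c ≤ 1/2`.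
The increments halve, and the distance from the start stays below twice the bound for the first
increment. Both bounds go through one induction because the first makes the integrands integrable.
-/
theorem norm_picardIter_sub_le (hf : IsCaratheodory f C B) (hx : Measurable x₀) (n : ℕ) (a : α)
    (s : ℝ) :
    ‖picardIter f x₀ n a s - x₀ a‖ ≤
        2 * (B a + C * ‖x₀ a‖) * Real.exp ((2 * C + 1) * s) ∧
    ‖picardIter f x₀ (n + 1) a s - picardIter f x₀ n a s‖ ≤
      (B a + C * ‖x₀ a‖) * Real.exp ((2 * C + 1) * s) * (1 / 2) ^ n := by
  set c : ℝ := 2 * C + 1 with hc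
  have hc0 : 0 < c := by positivity
  have hc1 : 1 ≤ c := by rw [hc]; linarith [C.coe_nonneg]
  have hB := hf.bound_nonneg a
  set K : ℝ := B a + C * ‖x₀ a‖ with hK
  have hK0 : 0 ≤ K := by positivity
  have base : ∀ s, ‖picardIter f x₀ 1 a s - picardIter f x₀ 0 a s‖ ≤ K * Real.exp (c * s) := by
    intro s
    simp only [picardIter, add_sub_cancel_left]
    refine (norm_integral_Ioc_le_exp hK0 hc0 (K := K) ?_).trans ?_
    · intro r hr
      refine (hf.norm_le a r _).trans (le_mul_of_one_le_right hK0 ?_)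
      rw [Real.one_le_exp_iff]
      have := hr.1.le
      positivity
    · gcongr
      exact div_le_self hK0 hc1
  -- The factor `1 - (1/2)^n` is the partial geometric sum; with the bare constant `2K` the
  -- induction would not close.
  have main : ∀ n, (∀ s, ‖picardIter f x₀ n a s - x₀ a‖ ≤
        2 * K * Real.exp (c * s) * (1 - (1 / 2) ^ n)) ∧
      ∀ s, ‖picardIter f x₀ (n + 1) a s - picardIter f x₀ n a s‖ ≤
        K * Real.exp (c * s) * (1 / 2) ^ n := by
    intro n
    induction n with
    | zero => exact ⟨fun s => by simp [picardIter], fun s => by simpa using base s⟩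
    | succ n ih =>
      have h1 : ∀ s, ‖picardIter f x₀ (n + 1) a s - x₀ a‖ ≤
          2 * K * Real.exp (c * s) * (1 - (1 / 2) ^ (n + 1)) := by
        intro s
        calc _ ≤ ‖picardIter f x₀ (n + 1) a s - picardIter f x₀ n a s‖
            + ‖picardIter f x₀ n a s - x₀ a‖ := norm_sub_le_norm_sub_add_norm_sub _ _ _
          _ ≤ K * Real.exp (c * s) * (1 / 2) ^ n
              + 2 * K * Real.exp (c * s) * (1 - (1 / 2) ^ n) := add_le_add (ih.2 s) (ih.1 s)
          _ = _ := by ring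
      have hbd : ∀ n, (∀ s, ‖picardIter f x₀ n a s - x₀ a‖ ≤
          2 * K * Real.exp (c * s) * (1 - (1 / 2) ^ n)) → ∀ s,
          IntegrableOn (fun r => f a r (picardIter f x₀ n a r)) (Ioc 0 s) volume := by
        intro n hn s
        refine integrableOn_caratheodory hf a
          ((measurable_picardIter hf hx n).comp measurable_prodMk_left)
          (K := ‖x₀ a‖ + 2 * K * Real.exp (c * s) * 1) ?_
        intro r hr
        have h2 : ‖picardIter f x₀ n a r‖ ≤ ‖x₀ a‖ + ‖picardIter f x₀ n a r - x₀ a‖ :=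
          norm_le_norm_add_norm_sub' _ _
        have h3 : (0 : ℝ) ≤ (1 / 2) ^ n := by positivity
        refine h2.trans (add_le_add le_rfl ((hn r).trans ?_))
        have h4 : (1 : ℝ) - (1 / 2) ^ n ≤ 1 := by linarith
        have h5 := hr.2
        have h6 : (0 : ℝ) ≤ 1 - (1 / 2) ^ n :=
          sub_nonneg.2 (pow_le_one₀ (by norm_num) (by norm_num))
        gcongr
      refine ⟨h1, fun s => ?_⟩
      have h2 : picardIter f x₀ (n + 1 + 1) a s - picardIter f x₀ (n + 1) a s
          = ∫ r in Ioc 0 s, (f a r (picardIter f x₀ (n + 1) a r) -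
              f a r (picardIter f x₀ n a r)) := by
        rw [integral_sub (hbd _ h1 s) (hbd _ ih.1 s)]
        simp [picardIter]
      rw [h2]
      refine (norm_integral_Ioc_le_exp (K := C * K * (1 / 2) ^ n) (by positivity) hc0 ?_).trans ?_
      · intro r hr
        refine ((hf.lip a r).norm_sub_le _ _).trans ?_
        calc (C : ℝ) * ‖picardIter f x₀ (n + 1) a r - picardIter f x₀ n a r‖
            ≤ C * (K * Real.exp (c * r) * (1 / 2) ^ n) := by gcongr; exact ih.2 r
          _ = _ := by ring
      · have h4 : (C : ℝ) / c ≤ 1 / 2 := by rw [div_le_iff₀ hc0]; linarith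
        calc C * K * (1 / 2) ^ n / c * Real.exp (c * s)
            = (C / c) * (K * (1 / 2) ^ n * Real.exp (c * s)) := by ring
          _ ≤ 1 / 2 * (K * (1 / 2) ^ n * Real.exp (c * s)) := by gcongr
          _ = _ := by ring
  refine ⟨((main n).1 s).trans ?_, (main n).2 s⟩
  refine mul_le_of_le_one_right (by positivity) ?_
  have : (0 : ℝ) ≤ (1 / 2) ^ n := by positivity
  linarith

variable [CompleteSpace E]

/-- Existence for Carathéodory equations, measurably in the parameter. -/
theorem exists_caratheodory_solution (hf : IsCaratheodory f C B) (hx : Measurable x₀) :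
    ∃ Y : α → ℝ → E, (Measurable fun w : α × ℝ => Y w.1 w.2) ∧ (∀ a, Continuous (Y a)) ∧
      (∀ a s, Y a s = x₀ a + ∫ r in Ioc 0 s, f a r (Y a r)) := by
  set Kf : α → ℝ → ℝ := fun a s => (B a + C * ‖x₀ a‖) * Real.exp ((2 * C + 1) * s) with hKf
  have hK0 : ∀ a s, 0 ≤ Kf a s := fun a s => by
    have hB := hf.bound_nonneg a
    simp only [hKf]; positivity
  have hdist : ∀ a s n, dist (picardIter f x₀ n a s) (picardIter f x₀ (n + 1) a s) ≤
      Kf a s * (1 / 2) ^ n := fun a s n => by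
    rw [dist_comm, dist_eq_norm]; exact (norm_picardIter_sub_le hf hx n a s).2
  have hlim : ∀ a s, ∃ y, Tendsto (fun n => picardIter f x₀ n a s) atTop (𝓝 y) := fun a s =>
    cauchySeq_tendsto_of_complete
      (cauchySeq_of_le_geometric (1 / 2) (Kf a s) (by norm_num) (hdist a s))
  choose Y hY using hlim
  have hYm : Measurable fun w : α × ℝ => Y w.1 w.2 :=
    measurable_of_tendsto_metrizable (measurable_picardIter hf hx)
      (tendsto_pi_nhds.2 fun w => hY w.1 w.2)
  have hYb : ∀ a s, ‖Y a s - x₀ a‖ ≤ 2 * Kf a s := fun a s => by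
    refine le_of_tendsto ((hY a s).sub_const _).norm (Eventually.of_forall fun n => ?_)
    have := (norm_picardIter_sub_le hf hx n a s).1
    simp only [hKf]; linarith
  have hYbd : ∀ a s, ∀ r ∈ Ioc 0 s, ‖Y a r‖ ≤ ‖x₀ a‖ + 2 * Kf a s := fun a s r hr => by
    have h2 : ‖Y a r‖ ≤ ‖x₀ a‖ + ‖Y a r - x₀ a‖ := norm_le_norm_add_norm_sub' _ _
    refine h2.trans (add_le_add le_rfl ((hYb a r).trans ?_))
    have hB := hf.bound_nonneg a
    have := hr.2
    simp only [hKf]; gcongr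
  have hYma : ∀ a, Measurable (Y a) := fun a => hYm.comp measurable_prodMk_left
  have hint : ∀ a s, IntegrableOn (fun r => f a r (Y a r)) (Ioc 0 s) volume := fun a s =>
    integrableOn_caratheodory hf a (hYma a) (hYbd a s)
  have heq : ∀ a s, Y a s = x₀ a + ∫ r in Ioc 0 s, f a r (Y a r) := by
    intro a s
    -- The integral equation is the limit of the recursion. The geometric bound at the endpoint `s`
    -- dominates the integrands, and the Lipschitz property gives their pointwise convergence.
    refine tendsto_nhds_unique ((tendsto_add_atTop_iff_nat 1).2 (hY a s)) ?_
    simp only [picardIter]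
    refine Tendsto.const_add _ ?_
    refine tendsto_integral_of_dominated_convergence
      (fun _ => B a + C * (‖x₀ a‖ + 2 * Kf a s)) ?_ ?_ ?_ ?_
    · intro n
      exact (aestronglyMeasurable_caratheodory hf a
        ((measurable_picardIter hf hx n).comp measurable_prodMk_left)).restrict
    · exact integrable_const _
    · intro n
      filter_upwards [ae_restrict_mem measurableSet_Ioc] with r hr
      refine (hf.norm_le a r _).trans ?_
      have h2 : ‖picardIter f x₀ n a r‖ ≤ ‖x₀ a‖ + ‖picardIter f x₀ n a r - x₀ a‖ :=
        norm_le_norm_add_norm_sub' _ _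
      have h3 : Kf a r ≤ Kf a s := by
        have hB := hf.bound_nonneg a
        have := hr.2
        simp only [hKf]; gcongr
      have h4 := (norm_picardIter_sub_le hf hx n a r).1
      gcongr
      refine h2.trans (add_le_add le_rfl (h4.trans ?_))
      simp only [hKf] at h3 ⊢
      linarith
    · filter_upwards with r
      exact ((hf.lip a r).continuous.tendsto _).comp (hY a r)
  refine ⟨Y, hYm, fun a => ?_, heq⟩
  rw [show Y a = fun s => x₀ a + ∫ r in Ioc 0 s, f a r (Y a r) from funext (heq a)]
  exact continuous_const.add (continuous_integral_Ioc (hint a))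

end Picard

end FGS
end

noncomputable section

namespace FGS

open Set Filter Topology NNReal

/-! ### Dependence of solutions on the initial point. -/

section Differentiability

variable {E : Type*} [NormedAddCommGroup E] [NormedSpace ℝ E]

/-- Uniqueness and continuous dependence for solutions of integral equations. -/
theorem norm_sub_le_of_integral_eq {F : ℝ → E → E} {C : ℝ≥0} (hF : ∀ r, LipschitzWith C (F r))
    {y₁ y₂ : ℝ → E} {x₁ x₂ : E} {t : ℝ} (ht : 0 ≤ t) (hc₁ : ContinuousOn y₁ (Icc 0 t))
    (hc₂ : ContinuousOn y₂ (Icc 0 t))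
    (hi₁ : IntervalIntegrable (fun r => F r (y₁ r)) volume 0 t)
    (hi₂ : IntervalIntegrable (fun r => F r (y₂ r)) volume 0 t)
    (h₁ : ∀ s ∈ Icc 0 t, y₁ s = x₁ + ∫ r in (0 : ℝ)..s, F r (y₁ r))
    (h₂ : ∀ s ∈ Icc 0 t, y₂ s = x₂ + ∫ r in (0 : ℝ)..s, F r (y₂ r)) :
    ∀ s ∈ Icc 0 t, ‖y₁ s - y₂ s‖ ≤ 2 * ‖x₁ - x₂‖ * Real.exp ((2 * C + 1) * s) := by
  refine le_exp_of_le_add_integral (norm_nonneg _) C.coe_nonneg ht (by fun_prop) ?_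
  intro s hs
  have hsub : uIcc 0 s ⊆ uIcc 0 t := by
    rw [uIcc_of_le hs.1, uIcc_of_le ht]; exact Icc_subset_Icc_right hs.2
  rw [h₁ s hs, h₂ s hs, add_sub_add_comm,
    ← intervalIntegral.integral_sub (hi₁.mono_set hsub) (hi₂.mono_set hsub)]
  refine (norm_add_le _ _).trans (add_le_add le_rfl ?_)
  rw [← intervalIntegral.integral_const_mul]
  refine intervalIntegral.norm_integral_le_of_norm_le hs.1 (ae_of_all _ fun r _ => ?_) ?_
  · exact (hF r).norm_sub_le _ _
  · refine ContinuousOn.intervalIntegrable ?_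
    rw [uIcc_of_le hs.1]
    exact (continuousOn_const.mul (hc₁.sub hc₂).norm).mono (Icc_subset_Icc_right hs.2)

/-- Differentiability in the initial point of solutions of a Carathéodory equation. -/
theorem hasFDerivAt_of_integral_eq [MeasurableSpace E] [BorelSpace E]
    [SecondCountableTopology E] [SecondCountableTopology (E →L[ℝ] E)] [CompleteSpace E]
    {F : ℝ → E → E} {DF : ℝ → E → E →L[ℝ] E} {C : ℝ≥0} {K : ℝ}
    (hF : ∀ r, LipschitzWith C (F r)) (hD : ∀ r x, HasFDerivAt (F r) (DF r x) x)
    (hFm : Measurable fun w : ℝ × E => F w.1 w.2) (hDm : Measurable fun w : ℝ × E => DF w.1 w.2)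
    (hF0 : ∀ r, ‖F r 0‖ ≤ K)
    {Y : E → ℝ → E} (hYc : ∀ x, Continuous (Y x))
    (hY : ∀ x, ∀ s, 0 ≤ s → Y x s = x + ∫ r in (0 : ℝ)..s, F r (Y x r))
    {x : E} {J : ℝ → E →L[ℝ] E} (hJc : Continuous J)
    (hJ : ∀ s, 0 ≤ s → J s = ContinuousLinearMap.id ℝ E +
      ∫ r in (0 : ℝ)..s, (DF r (Y x r)).comp (J r)) {t : ℝ} (ht : 0 ≤ t) :
    HasFDerivAt (fun x => Y x t) (J t) x := by
  have hDb : ∀ r x, ‖DF r x‖ ≤ C := fun r x => (hD r x).le_of_lipschitz (hF r)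
  have hFYm : ∀ x, Measurable fun r => F r (Y x r) := fun x =>
    hFm.comp (measurable_id.prodMk (hYc x).measurable)
  have hDYm : ∀ x, StronglyMeasurable fun r => DF r (Y x r) := fun x =>
    (hDm.comp (measurable_id.prodMk (hYc x).measurable)).stronglyMeasurable
  have hFi : ∀ x, ∀ s, 0 ≤ s → IntervalIntegrable (fun r => F r (Y x r)) volume 0 s := by
    intro x s hs
    obtain ⟨R, hR⟩ := (isCompact_Icc (a := (0 : ℝ)) (b := s)).exists_bound_of_continuousOn
      (hYc x).continuousOn
    refine intervalIntegrable_of_norm_le (K := K + C * R) hs (hFYm x).aestronglyMeasurable ?_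
    intro r hr
    have h1 := (hF r).norm_sub_le (Y x r) 0
    have h3 : ‖F r (Y x r)‖ ≤ ‖F r 0‖ + ‖F r (Y x r) - F r 0‖ := norm_le_norm_add_norm_sub' _ _
    rw [sub_zero] at h1
    have h4 := hF0 r
    have h5 : (C : ℝ) * ‖Y x r‖ ≤ C * R := by gcongr; exact hR r hr
    linarith
  have hJi : ∀ s, 0 ≤ s →
      IntervalIntegrable (fun r => (DF r (Y x r)).comp (J r)) volume 0 s := by
    intro s hs
    obtain ⟨R, hR⟩ := (isCompact_Icc (a := (0 : ℝ)) (b := s)).exists_bound_of_continuousOn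
      hJc.continuousOn
    refine intervalIntegrable_of_norm_le (K := C * R) hs ?_ ?_
    · exact (ContinuousLinearMap.compL ℝ E E E).aestronglyMeasurable_comp₂
        (hDYm x).aestronglyMeasurable hJc.aestronglyMeasurable
    · intro r hr
      refine (ContinuousLinearMap.opNorm_comp_le _ _).trans ?_
      gcongr
      · exact hDb r _
      · exact hR r hr
  -- the remainder of the first-order expansion of `F` along the two solutions
  set R : E → ℝ → E := fun x' r =>
    F r (Y x' r) - F r (Y x r) - DF r (Y x r) (Y x' r - Y x r) with hR
  have hRm : ∀ x', AEStronglyMeasurable (R x') volume := by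
    intro x'
    refine ((hFYm x').sub (hFYm x)).aestronglyMeasurable.sub ?_
    exact (ContinuousLinearMap.apply ℝ E).flip.aestronglyMeasurable_comp₂
      (hDYm x).aestronglyMeasurable ((hYc x').sub (hYc x)).aestronglyMeasurable
  set κ : ℝ := Real.exp ((2 * C + 1) * t) with hκ
  have hYd : ∀ x', ∀ r ∈ Icc 0 t, ‖Y x' r - Y x r‖ ≤ 2 * ‖x' - x‖ * κ := by
    intro x' r hr
    refine (norm_sub_le_of_integral_eq hF ht (hYc x').continuousOn (hYc x).continuousOn (hFi x' t ht) (hFi x t ht)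
      (fun s hs => hY x' s hs.1) (fun s hs => hY x s hs.1) r hr).trans ?_
    have := hr.2
    rw [hκ]
    gcongr
  have hRb : ∀ x', ∀ r ∈ Icc 0 t, ‖R x' r‖ ≤ 2 * C * (2 * ‖x' - x‖ * κ) := by
    intro x' r hr
    have h1 := (hF r).norm_sub_le (Y x' r) (Y x r)
    have h2 := (DF r (Y x r)).le_of_opNorm_le (hDb r _) (Y x' r - Y x r)
    have h3 := hYd x' r hr
    calc ‖R x' r‖ ≤ ‖F r (Y x' r) - F r (Y x r)‖ + ‖DF r (Y x r) (Y x' r - Y x r)‖ :=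
          norm_sub_le _ _
      _ ≤ 2 * C * ‖Y x' r - Y x r‖ := by linarith
      _ ≤ _ := by gcongr
  have hRi : ∀ x', IntervalIntegrable (R x') volume 0 t := fun x' =>
    intervalIntegrable_of_norm_le ht (hRm x') (hRb x')
  -- The defect of the linearization solves the variational equation with source `R x'` and zero
  -- initial value, so Gronwall's inequality bounds it by the integral of the source.
  have key : ∀ x', ‖Y x' t - Y x t - J t (x' - x)‖ ≤
      2 * (∫ r in (0 : ℝ)..t, ‖R x' r‖) * κ := by
    intro x'
    refine le_exp_of_le_add_integral (u := fun s => ‖Y x' s - Y x s - J s (x' - x)‖) ?_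
      C.coe_nonneg ht ?_ ?_ t ⟨ht, le_rfl⟩
    · exact intervalIntegral.integral_nonneg ht fun _ _ => norm_nonneg _
    · have h1 := hYc x'
      have h2 := hYc x
      fun_prop
    · intro s hs
      have hsub : uIcc 0 s ⊆ uIcc 0 t := by
        rw [uIcc_of_le hs.1, uIcc_of_le ht]; exact Icc_subset_Icc_right hs.2
      have hd : Continuous fun r => Y x' r - Y x r - J r (x' - x) := by
        have h1 := hYc x'
        have h2 := hYc x
        fun_prop
      have hDd : IntervalIntegrable (fun r => DF r (Y x r) (Y x' r - Y x r - J r (x' - x)))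
          volume 0 s := by
        obtain ⟨B, hB⟩ := (isCompact_Icc (a := (0 : ℝ)) (b := s)).exists_bound_of_continuousOn
          hd.continuousOn
        refine intervalIntegrable_of_norm_le (K := C * B) hs.1 ?_ ?_
        · exact (ContinuousLinearMap.apply ℝ E).flip.aestronglyMeasurable_comp₂
            (hDYm x).aestronglyMeasurable hd.aestronglyMeasurable
        · intro r hr
          refine ((DF r (Y x r)).le_of_opNorm_le (hDb r _) _).trans ?_
          gcongr
          exact hB r hr
      have e1 : Y x' s - Y x s - J s (x' - x) =
          (∫ r in (0 : ℝ)..s, R x' r) +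
            ∫ r in (0 : ℝ)..s, DF r (Y x r) (Y x' r - Y x r - J r (x' - x)) := by
        rw [← intervalIntegral.integral_add ((hRi x').mono_set hsub) hDd]
        have e2 : ∀ r, R x' r + DF r (Y x r) (Y x' r - Y x r - J r (x' - x)) =
            F r (Y x' r) - F r (Y x r) - ((DF r (Y x r)).comp (J r)) (x' - x) := by
          intro r
          simp only [hR, map_sub, ContinuousLinearMap.comp_apply]
          abel
        simp_rw [e2]
        rw [intervalIntegral.integral_sub ((hFi x' s hs.1).sub (hFi x s hs.1)),
          intervalIntegral.integral_sub (hFi x' s hs.1) (hFi x s hs.1),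
          ← ContinuousLinearMap.intervalIntegral_apply (hJi s hs.1), hY x' s hs.1, hY x s hs.1,
          hJ s hs.1]
        · simp only [add_apply, ContinuousLinearMap.id_apply]
          abel
        · exact ⟨(ContinuousLinearMap.apply ℝ E (x' - x)).integrable_comp (hJi s hs.1).1,
            (ContinuousLinearMap.apply ℝ E (x' - x)).integrable_comp (hJi s hs.1).2⟩
      rw [e1]
      refine (norm_add_le _ _).trans (add_le_add ?_ ?_)
      · refine (intervalIntegral.norm_integral_le_integral_norm hs.1).trans ?_
        exact intervalIntegral.integral_mono_interval le_rfl hs.1 hs.2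
          (ae_of_all _ fun _ => norm_nonneg _) (hRi x').norm
      · rw [← intervalIntegral.integral_const_mul]
        refine intervalIntegral.norm_integral_le_of_norm_le hs.1 (ae_of_all _ fun r _ => ?_) ?_
        · exact (DF r (Y x r)).le_of_opNorm_le (hDb r _) _
        · exact (Continuous.intervalIntegrable (by fun_prop) _ _)
  rw [hasFDerivAt_iff_tendsto]
  -- After division by `‖x' - x‖` the remainder tends to `0` for each fixed `r`, because `F r` is
  -- differentiable, and it is bounded by the Lipschitz estimate. Dominated convergence replaces
  -- uniformity in `r`.
  have hlim : Tendsto (fun x' => ∫ r in Ioc 0 t, ‖x' - x‖⁻¹ * ‖R x' r‖) (𝓝 x)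
      (𝓝 (∫ _ in Ioc 0 t, (0 : ℝ))) := by
    refine tendsto_integral_filter_of_dominated_convergence (fun _ => 2 * C * (2 * κ)) ?_ ?_ ?_ ?_
    · exact Eventually.of_forall fun x' => ((hRm x').norm.const_mul _).restrict
    · refine Eventually.of_forall fun x' => ?_
      filter_upwards [ae_restrict_mem measurableSet_Ioc] with r hr
      rw [norm_mul, norm_inv, norm_norm, norm_norm]
      rcases eq_or_ne ‖x' - x‖ 0 with h0 | h0
      · rw [h0]; simp only [inv_zero, zero_mul]; positivity
      · rw [inv_mul_le_iff₀ (lt_of_le_of_ne (norm_nonneg _) (Ne.symm h0))]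
        refine (hRb x' r ⟨hr.1.le, hr.2⟩).trans (le_of_eq (by ring))
    · exact integrable_const _
    · filter_upwards [ae_restrict_mem measurableSet_Ioc] with r hr
      have hr' : r ∈ Icc 0 t := ⟨hr.1.le, hr.2⟩
      have h1 : (fun y => F r y - F r (Y x r) - DF r (Y x r) (y - Y x r)) =o[𝓝 (Y x r)]
          fun y => y - Y x r := (hD r (Y x r)).isLittleO
      have h2 : (fun x' => Y x' r - Y x r) =O[𝓝 x] fun x' => x' - x := by
        refine Asymptotics.IsBigO.of_bound (2 * κ) (Eventually.of_forall fun x' => ?_)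
        exact (hYd x' r hr').trans (le_of_eq (by ring))
      have h3 : Tendsto (fun x' => Y x' r) (𝓝 x) (𝓝 (Y x r)) := by
        rw [tendsto_iff_norm_sub_tendsto_zero]
        have h4 : Tendsto (fun x' : E => 2 * ‖x' - x‖ * κ) (𝓝 x) (𝓝 0) := by
          have : Continuous fun x' : E => 2 * ‖x' - x‖ * κ := by fun_prop
          simpa using this.tendsto x
        exact squeeze_zero (fun _ => norm_nonneg _) (fun x' => hYd x' r hr') h4
      have h5 : (fun x' => R x' r) =o[𝓝 x] fun x' => x' - x :=
        (h1.comp_tendsto h3).trans_isBigO h2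
      have h6 := h5.norm_norm.tendsto_div_nhds_zero
      refine h6.congr fun x' => ?_
      rw [div_eq_inv_mul]
  have hlim2 : Tendsto (fun x' => 2 * (∫ r in Ioc 0 t, ‖x' - x‖⁻¹ * ‖R x' r‖) * κ) (𝓝 x)
      (𝓝 0) := by
    have := (hlim.const_mul 2).mul_const κ
    simpa using this
  refine squeeze_zero (fun _ => by positivity) (fun x' => ?_) hlim2
  rw [integral_const_mul, ← intervalIntegral.integral_of_le ht]
  calc ‖x' - x‖⁻¹ * ‖Y x' t - Y x t - J t (x' - x)‖
      ≤ ‖x' - x‖⁻¹ * (2 * (∫ r in (0 : ℝ)..t, ‖R x' r‖) * κ) := by gcongr; exact key x'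
    _ = _ := by ring

end Differentiability

end FGS
end

noncomputable section

namespace FGS

open Set Filter Topology NNReal ContDiff

/-! ### The Hamiltonian vector field of a potential with bounded Hessian -/

section Hamiltonian

variable {m : ℕ}

theorem gradient_apply (U : Pos m → ℝ) (q : Pos m) (k : Fin m) :
    gradient U q k = fderiv ℝ U q (EuclideanSpace.single k 1) := by
  rw [← inner_gradient_left, EuclideanSpace.inner_single_right]
  simp

theorem contDiff_gradient {U : Pos m → ℝ} (hU : ContDiff ℝ ∞ U) : ContDiff ℝ ∞ (gradient U) := by
  rw [contDiff_euclidean]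
  intro k
  simp_rw [gradient_apply]
  exact (hU.fderiv_right (m := ∞) (by simp)).clm_apply contDiff_const

theorem differentiable_gradient {U : Pos m → ℝ} (hU : ContDiff ℝ ∞ U) :
    Differentiable ℝ (gradient U) := (contDiff_gradient hU).differentiable (by simp)

theorem hessian_apply (U : Pos m → ℝ) (q : Pos m) (j k : Fin m) :
    hessian U q j k = fderiv ℝ (fderiv ℝ U) q (EuclideanSpace.single j 1)
      (EuclideanSpace.single k 1) := by
  simp [hessian, iteratedFDeriv_two_apply]

theorem hessian_symm {U : Pos m → ℝ} (hU : ContDiff ℝ ∞ U) (q : Pos m) (j k : Fin m) :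
    hessian U q j k = hessian U q k j := by
  rw [hessian_apply, hessian_apply]
  exact ((contDiff_infty.1 hU 2).contDiffAt.isSymmSndFDerivAt (by simp)) _ _

theorem sum_apply_smul_single (v : Pos m) :
    ∑ j, v j • EuclideanSpace.single j (1 : ℝ) = v := by
  ext k
  simp [Pi.single_apply]

/-- The `k`-th coordinate of the gradient is differentiated in two ways, as a coordinate of a vector
field and as a partial derivative of `U`. This turns entrywise Hessian bounds into bounds for the
force. -/
theorem fderiv_gradient_apply {U : Pos m → ℝ} (hU : ContDiff ℝ ∞ U) (q v : Pos m) (k : Fin m) :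
    fderiv ℝ (gradient U) q v k = ∑ j, v j * hessian U q j k := by
  have h1 : HasFDerivAt (fun q => gradient U q k)
      ((EuclideanSpace.proj k : Pos m →L[ℝ] ℝ).comp (fderiv ℝ (gradient U) q)) q :=
    (EuclideanSpace.proj k : Pos m →L[ℝ] ℝ).hasFDerivAt.comp q
      (differentiable_gradient hU q).hasFDerivAt
  have h2 : HasFDerivAt (fun q => gradient U q k)
      ((ContinuousLinearMap.apply ℝ ℝ (EuclideanSpace.single k (1 : ℝ))).comp
        (fderiv ℝ (fderiv ℝ U) q)) q := by
    simp_rw [gradient_apply]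
    exact (ContinuousLinearMap.apply ℝ ℝ (EuclideanSpace.single k (1 : ℝ))).hasFDerivAt.comp q
      (((hU.fderiv_right (m := ∞) (by simp)).differentiable (by simp)) q).hasFDerivAt
  have h3 := congrArg (fun L => L v) (h1.unique h2)
  simp only [ContinuousLinearMap.comp_apply, PiLp.proj_apply, ContinuousLinearMap.apply_apply] at h3
  rw [h3]
  conv_lhs => rw [← sum_apply_smul_single v]
  simp [hessian_apply]

theorem norm_le_sum_abs (v : Pos m) : ‖v‖ ≤ ∑ j, |v j| := by
  conv_lhs => rw [← sum_apply_smul_single v]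
  refine (norm_sum_le _ _).trans (Finset.sum_le_sum fun j _ => ?_)
  rw [norm_smul]; simp

theorem abs_apply_le_norm (v : Pos m) (j : Fin m) : |v j| ≤ ‖v‖ := by
  simpa using PiLp.norm_apply_le v j

/-- Each of the `m²` entries is bounded separately. The absolute value of `CE` matters for `m = 0`,
where the hypothesis is vacuous and `CE` may be negative. -/
theorem norm_fderiv_gradient_le {U : Pos m → ℝ} (hU : ContDiff ℝ ∞ U) {CE : ℝ}
    (hC : ∀ q j k, |hessian U q j k| ≤ CE) (q : Pos m) :
    ‖fderiv ℝ (gradient U) q‖ ≤ m ^ 2 * |CE| := by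
  refine ContinuousLinearMap.opNorm_le_bound _ (by positivity) fun v => ?_
  refine (norm_le_sum_abs _).trans ?_
  calc ∑ k, |fderiv ℝ (gradient U) q v k| ≤ ∑ _k : Fin m, ∑ _j : Fin m, ‖v‖ * |CE| := by
        refine Finset.sum_le_sum fun k _ => ?_
        rw [fderiv_gradient_apply hU]
        refine (Finset.abs_sum_le_sum_abs _ _).trans (Finset.sum_le_sum fun j _ => ?_)
        rw [abs_mul]
        exact mul_le_mul (abs_apply_le_norm v j) ((hC q j k).trans (le_abs_self _))
          (abs_nonneg _) (norm_nonneg _)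
    _ = m ^ 2 * |CE| * ‖v‖ := by simp; ring

/-- The vector field of Hamilton's equations for `½ |p|² + U q`. -/
def hamField (U : Pos m → ℝ) (w : Phase m) : Phase m := (w.2, -gradient U w.1)

/-- The derivative of `hamField`. -/
def hamDeriv (U : Pos m → ℝ) (w : Phase m) : Phase m →L[ℝ] Phase m :=
  (ContinuousLinearMap.snd ℝ (Pos m) (Pos m)).prod
    (-((fderiv ℝ (gradient U) w.1).comp (ContinuousLinearMap.fst ℝ (Pos m) (Pos m))))

theorem hasFDerivAt_hamField {U : Pos m → ℝ} (hU : ContDiff ℝ ∞ U) (w : Phase m) :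
    HasFDerivAt (hamField U) (hamDeriv U w) w :=
  hasFDerivAt_snd.prodMk
    (((differentiable_gradient hU w.1).hasFDerivAt.comp w hasFDerivAt_fst).neg)

theorem continuous_hamField {U : Pos m → ℝ} (hU : ContDiff ℝ ∞ U) : Continuous (hamField U) :=
  continuous_snd.prodMk ((contDiff_gradient hU).continuous.comp continuous_fst).neg

theorem continuous_hamDeriv {U : Pos m → ℝ} (hU : ContDiff ℝ ∞ U) : Continuous (hamDeriv U) := by
  have h1 : hamDeriv U = fderiv ℝ (hamField U) :=
    funext fun w => (hasFDerivAt_hamField hU w).fderiv.symm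
  rw [h1]
  refine ContDiff.continuous_fderiv (n := ∞) ?_ (by simp)
  exact contDiff_snd.prodMk ((contDiff_gradient hU).comp contDiff_fst).neg

/-- A Lipschitz constant for the Hamiltonian vector fields. -/
def lipConst (m : ℕ) (CE : ℝ) : ℝ≥0 := ⟨1 + m ^ 2 * |CE|, by positivity⟩

/-- Since the Hessian bound is global, so is the Lipschitz constant. Hence solutions exist for all
times, with constants that depend on `m` and `CE` only. -/
theorem lipschitzWith_hamField {U : Pos m → ℝ} (hU : ContDiff ℝ ∞ U) {CE : ℝ}
    (hC : ∀ q j k, |hessian U q j k| ≤ CE) : LipschitzWith (lipConst m CE) (hamField U) := by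
  refine lipschitzWith_of_nnnorm_fderiv_le (𝕜 := ℝ)
    (fun w => (hasFDerivAt_hamField hU w).differentiableAt) fun w => ?_
  rw [(hasFDerivAt_hamField hU w).fderiv, ← NNReal.coe_le_coe, coe_nnnorm]
  rw [hamDeriv, ContinuousLinearMap.opNorm_prod, Prod.norm_def]
  have h1 := ContinuousLinearMap.norm_snd_le (𝕜 := ℝ) (E := Pos m) (F := Pos m)
  have h2 := norm_fderiv_gradient_le hU hC w.1
  have h3 : (0 : ℝ) ≤ m ^ 2 * |CE| := by positivity
  change _ ≤ 1 + (m : ℝ) ^ 2 * |CE|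
  refine max_le (by simp only; linarith) ?_
  simp only [norm_neg]
  refine (ContinuousLinearMap.opNorm_comp_le _ _).trans ?_
  have h4 := ContinuousLinearMap.norm_fst_le (𝕜 := ℝ) (E := Pos m) (F := Pos m)
  calc ‖fderiv ℝ (gradient U) w.1‖ * ‖ContinuousLinearMap.fst ℝ (Pos m) (Pos m)‖
      ≤ (m ^ 2 * |CE|) * 1 := by gcongr
    _ ≤ _ := by linarith

/-- The symplectic form on phase space. -/
def sympForm (u v : Phase m) : ℝ := ∑ k, (u.2 k * v.1 k - u.1 k * v.2 k)

/-- Symmetry of the Hessian makes the linearized field infinitesimally symplectic. The Jacobian of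
the flow therefore preserves the symplectic form, across hops as well, since it is continuous there.
-/
theorem sympForm_hamDeriv {U : Pos m → ℝ} (hU : ContDiff ℝ ∞ U) (w u v : Phase m) :
    sympForm (hamDeriv U w u) v + sympForm u (hamDeriv U w v) = 0 := by
  simp only [sympForm, hamDeriv, ContinuousLinearMap.prod_apply, ContinuousLinearMap.coe_snd',
    neg_apply, ContinuousLinearMap.comp_apply, ContinuousLinearMap.coe_fst',
    PiLp.neg_apply, fderiv_gradient_apply hU]
  rw [← Finset.sum_add_distrib]
  have h1 : ∀ k, (-(∑ j, u.1 j * hessian U w.1 j k) * v.1 k - u.2 k * v.2 k +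
      (u.2 k * v.2 k - u.1 k * -∑ j, v.1 j * hessian U w.1 j k)) =
      (∑ j, u.1 k * v.1 j * hessian U w.1 j k) - ∑ j, u.1 j * v.1 k * hessian U w.1 j k := by
    intro k
    have e1 : (∑ j, u.1 k * v.1 j * hessian U w.1 j k) =
        u.1 k * ∑ j, v.1 j * hessian U w.1 j k := by
      rw [Finset.mul_sum]; exact Finset.sum_congr rfl fun j _ => by ring
    have e2 : (∑ j, u.1 j * v.1 k * hessian U w.1 j k) =
        (∑ j, u.1 j * hessian U w.1 j k) * v.1 k := by
      rw [Finset.sum_mul]; exact Finset.sum_congr rfl fun j _ => by ring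
    rw [e1, e2]; ring
  rw [Finset.sum_congr rfl fun k _ => h1 k, Finset.sum_sub_distrib, sub_eq_zero, Finset.sum_comm]
  refine Finset.sum_congr rfl fun j _ => Finset.sum_congr rfl fun k _ => ?_
  rw [hessian_symm hU]

end Hamiltonian

/-! ### The complex matrices of a linear map of phase space -/

section Matrices

variable {m : ℕ}

/-- `∂_z` of the position component of a linear map. -/
def posMatrix (L : Phase m →L[ℝ] Phase m) : Matrix (Fin m) (Fin m) ℂ :=
  Matrix.of fun j k => (((L (EuclideanSpace.single j 1, 0)).1 k : ℝ) : ℂ)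
    - Complex.I * (((L (0, EuclideanSpace.single j 1)).1 k : ℝ) : ℂ)

/-- `∂_z` of the momentum component of a linear map. -/
def momMatrix (L : Phase m →L[ℝ] Phase m) : Matrix (Fin m) (Fin m) ℂ :=
  Matrix.of fun j k => (((L (EuclideanSpace.single j 1, 0)).2 k : ℝ) : ℂ)
    - Complex.I * (((L (0, EuclideanSpace.single j 1)).2 k : ℝ) : ℂ)

/-- `∂_z (Q + i P)` of a linear map. -/
def zMatrix (L : Phase m →L[ℝ] Phase m) : Matrix (Fin m) (Fin m) ℂ :=
  posMatrix L + Complex.I • momMatrix L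

/-- The four real relations on pairs of unit vectors combine into one complex relation:
position–position and momentum–momentum pairs contribute zero, and the two mixed kinds contribute
the multiple of the identity. -/
theorem symplectic_matrix_identity {L : Phase m →L[ℝ] Phase m}
    (hL : ∀ u v, sympForm (L u) (L v) = sympForm u v) :
    momMatrix L * (posMatrix L).conjTranspose - posMatrix L * (momMatrix L).conjTranspose =
      (-2 * Complex.I) • (1 : Matrix (Fin m) (Fin m) ℂ) := by
  ext j l
  have h1 := hL (EuclideanSpace.single j 1, 0) (EuclideanSpace.single l 1, 0)
  have h2 := hL (EuclideanSpace.single j 1, 0) (0, EuclideanSpace.single l 1)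
  have h3 := hL (0, EuclideanSpace.single j 1) (EuclideanSpace.single l 1, 0)
  have h4 := hL (0, EuclideanSpace.single j 1) (0, EuclideanSpace.single l 1)
  have e1 : sympForm ((EuclideanSpace.single j 1, 0) : Phase m)
      (EuclideanSpace.single l 1, 0) = 0 := by simp [sympForm]
  have e4 : sympForm ((0, EuclideanSpace.single j 1) : Phase m)
      (0, EuclideanSpace.single l 1) = 0 := by simp [sympForm]
  have e2 : sympForm ((EuclideanSpace.single j 1, 0) : Phase m)
      (0, EuclideanSpace.single l 1) = -if j = l then 1 else 0 := by
    simp [sympForm, eq_comm]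
  have e3 : sympForm ((0, EuclideanSpace.single j 1) : Phase m)
      (EuclideanSpace.single l 1, 0) = if j = l then 1 else 0 := by
    simp [sympForm, eq_comm]
  rw [e1] at h1
  rw [e2] at h2
  rw [e3] at h3
  rw [e4] at h4
  have key : (momMatrix L * (posMatrix L).conjTranspose -
      posMatrix L * (momMatrix L).conjTranspose) j l =
      ((sympForm (L (EuclideanSpace.single j 1, 0)) (L (EuclideanSpace.single l 1, 0)) : ℝ) : ℂ)
      + ((sympForm (L (0, EuclideanSpace.single j 1)) (L (0, EuclideanSpace.single l 1)) : ℝ) : ℂ)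
      + Complex.I * (((sympForm (L (EuclideanSpace.single j 1, 0))
          (L (0, EuclideanSpace.single l 1)) : ℝ) : ℂ)
      - ((sympForm (L (0, EuclideanSpace.single j 1))
          (L (EuclideanSpace.single l 1, 0)) : ℝ) : ℂ)) := by
    simp only [Matrix.sub_apply, Matrix.mul_apply, Matrix.conjTranspose_apply, posMatrix,
      momMatrix, Matrix.of_apply, sympForm, Complex.ofReal_sum, star_sub, star_mul',
      Complex.star_def, Complex.conj_I, Complex.conj_ofReal, Complex.ofReal_sub,
      Complex.ofReal_mul]
    rw [← Finset.sum_sub_distrib, ← Finset.sum_add_distrib, ← Finset.sum_sub_distrib,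
      Finset.mul_sum, ← Finset.sum_add_distrib]
    refine Finset.sum_congr rfl fun k _ => ?_
    ring_nf
    simp only [Complex.I_sq]
    ring
  rw [key, h1, h2, h3, h4]
  by_cases hjl : j = l
  · subst hjl; simp; ring
  · simp [hjl]

/-- The cross terms in the expansion are `i` times the left side of `symplectic_matrix_identity`,
hence twice the identity. -/
theorem zMatrix_mul_conjTranspose {L : Phase m →L[ℝ] Phase m}
    (hL : ∀ u v, sympForm (L u) (L v) = sympForm u v) :
    zMatrix L * (zMatrix L).conjTranspose =
      posMatrix L * (posMatrix L).conjTranspose + momMatrix L * (momMatrix L).conjTranspose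
        + (2 : ℂ) • (1 : Matrix (Fin m) (Fin m) ℂ) := by
  have h := symplectic_matrix_identity hL
  have h2 : Complex.I • (momMatrix L * (posMatrix L).conjTranspose -
      posMatrix L * (momMatrix L).conjTranspose) = (2 : ℂ) • (1 : Matrix (Fin m) (Fin m) ℂ) := by
    rw [h, smul_smul]
    congr 1
    linear_combination (-2) * Complex.I_mul_I
  rw [← h2, zMatrix]
  simp only [Matrix.conjTranspose_add, Matrix.conjTranspose_smul, add_mul, mul_add,
    Matrix.smul_mul, smul_sub, Complex.star_def, Complex.conj_I, neg_smul]
  have : -Complex.I * Complex.I = 1 := by rw [neg_mul, Complex.I_mul_I, neg_neg]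
  simp [smul_smul]
  abel

-- A positive semidefinite matrix plus twice the identity is positive definite, so `Z Z*` is
-- invertible, and hence `Z` is.
open scoped ComplexOrder in
theorem isUnit_det_zMatrix {L : Phase m →L[ℝ] Phase m}
    (hL : ∀ u v, sympForm (L u) (L v) = sympForm u v) : IsUnit (zMatrix L).det := by
  have h1 : (zMatrix L * (zMatrix L).conjTranspose).PosDef := by
    rw [zMatrix_mul_conjTranspose hL]
    refine Matrix.PosDef.posSemidef_add ?_ ?_
    · exact (Matrix.posSemidef_self_mul_conjTranspose _).add
        (Matrix.posSemidef_self_mul_conjTranspose _)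
    · exact Matrix.PosDef.one.smul (by norm_num)
  have h2 := (Matrix.isUnit_iff_isUnit_det _).1 h1.isUnit
  rw [Matrix.det_mul] at h2
  exact isUnit_of_mul_isUnit_left h2

/-- Conjugating the formula for `Z Z*` by `W = Z⁻¹` writes the identity as two positive semidefinite
matrices plus `2 W W*`. Its diagonal entries bound the rows of `W`, whatever `L` is. This keeps the
amplitude equation from degenerating. -/
theorem norm_inv_zMatrix_le {L : Phase m →L[ℝ] Phase m}
    (hL : ∀ u v, sympForm (L u) (L v) = sympForm u v) (i j : Fin m) :
    ‖(zMatrix L)⁻¹ i j‖ ≤ 1 := by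
  set W := (zMatrix L)⁻¹ with hW
  have h0 : W * zMatrix L = 1 := Matrix.nonsing_inv_mul _ (isUnit_det_zMatrix hL)
  have h1 : W * (zMatrix L * (zMatrix L).conjTranspose) * W.conjTranspose = 1 := by
    calc W * (zMatrix L * (zMatrix L).conjTranspose) * W.conjTranspose
        = (W * zMatrix L) * (W * zMatrix L).conjTranspose := by
          rw [Matrix.conjTranspose_mul]; simp only [Matrix.mul_assoc]
      _ = 1 := by rw [h0]; simp
  rw [zMatrix_mul_conjTranspose hL] at h1
  have h2 : (W * posMatrix L) * (W * posMatrix L).conjTranspose +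
      (W * momMatrix L) * (W * momMatrix L).conjTranspose + (2 : ℂ) • (W * W.conjTranspose) = 1 := by
    rw [← h1]
    simp only [Matrix.conjTranspose_mul, Matrix.mul_add, Matrix.add_mul, Matrix.mul_assoc,
      Matrix.mul_smul, Matrix.smul_mul, Matrix.mul_one]
  have diag : ∀ X : Matrix (Fin m) (Fin m) ℂ,
      (X * X.conjTranspose) i i = ((∑ k, ‖X i k‖ ^ 2 : ℝ) : ℂ) := by
    intro X
    rw [Matrix.mul_apply, Complex.ofReal_sum]
    refine Finset.sum_congr rfl fun k _ => ?_
    rw [Matrix.conjTranspose_apply, Complex.star_def, Complex.mul_conj, Complex.normSq_eq_norm_sq]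
  have h3 := congrFun (congrFun h2 i) i
  rw [Matrix.add_apply, Matrix.add_apply, Matrix.smul_apply, diag, diag, diag, Matrix.one_apply_eq,
    smul_eq_mul] at h3
  have h4 : (∑ k, ‖(W * posMatrix L) i k‖ ^ 2) + (∑ k, ‖(W * momMatrix L) i k‖ ^ 2)
      + 2 * ∑ k, ‖W i k‖ ^ 2 = 1 := by exact_mod_cast h3
  have p1 : (0 : ℝ) ≤ ∑ k, ‖(W * posMatrix L) i k‖ ^ 2 := by positivity
  have p2 : (0 : ℝ) ≤ ∑ k, ‖(W * momMatrix L) i k‖ ^ 2 := by positivity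
  have p3 : ‖W i j‖ ^ 2 ≤ ∑ k, ‖W i k‖ ^ 2 :=
    Finset.single_le_sum (f := fun k => ‖W i k‖ ^ 2) (fun _ _ => by positivity)
      (Finset.mem_univ j)
  nlinarith [norm_nonneg (W i j)]

theorem norm_ofReal_sub_I_mul_le (a b K : ℝ) (ha : |a| ≤ K) (hb : |b| ≤ K) :
    ‖((a : ℝ) : ℂ) - Complex.I * ((b : ℝ) : ℂ)‖ ≤ 2 * K := by
  refine (norm_sub_le _ _).trans ?_
  rw [norm_mul, Complex.norm_I, one_mul, Complex.norm_real, Complex.norm_real,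
    Real.norm_eq_abs, Real.norm_eq_abs]
  linarith

theorem norm_posMatrix_le (L : Phase m →L[ℝ] Phase m) (j k : Fin m) :
    ‖posMatrix L j k‖ ≤ 2 * ‖L‖ := by
  refine norm_ofReal_sub_I_mul_le _ _ _ ?_ ?_ <;>
  · refine (abs_apply_le_norm _ _).trans ((norm_fst_le _).trans ?_)
    refine (L.le_opNorm _).trans ?_
    simp [Prod.norm_def]

theorem norm_momMatrix_le (L : Phase m →L[ℝ] Phase m) (j k : Fin m) :
    ‖momMatrix L j k‖ ≤ 2 * ‖L‖ := by
  refine norm_ofReal_sub_I_mul_le _ _ _ ?_ ?_ <;>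
  · refine (abs_apply_le_norm _ _).trans ((norm_snd_le _).trans ?_)
    refine (L.le_opNorm _).trans ?_
    simp [Prod.norm_def]

theorem continuous_posMatrix : Continuous (posMatrix (m := m)) :=
  continuous_matrix fun j k => by
    simp only [posMatrix, Matrix.of_apply]
    fun_prop

theorem continuous_momMatrix : Continuous (momMatrix (m := m)) :=
  continuous_matrix fun j k => by
    simp only [momMatrix, Matrix.of_apply]
    fun_prop

theorem continuous_zMatrix : Continuous (zMatrix (m := m)) :=
  continuous_posMatrix.add ((continuous_const_smul Complex.I).comp continuous_momMatrix)

/-- The logarithmic derivative of the amplitude, as a function of the Jacobian `L` of the flow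
and of the Hessian `H` of the potential. -/
def ampRate (L : Phase m →L[ℝ] Phase m) (H : Matrix (Fin m) (Fin m) ℝ) : ℂ :=
  1 / 2 * ((zMatrix L)⁻¹ * (momMatrix L - Complex.I • (posMatrix L * H.map Complex.ofReal))).trace

/-- The trace has `m²` terms, each with a factor of modulus at most `1` from the inverse; the
prefactor `1/2` absorbs the `2` of the entry bounds. -/
theorem norm_ampRate_le {L : Phase m →L[ℝ] Phase m}
    (hL : ∀ u v, sympForm (L u) (L v) = sympForm u v) {H : Matrix (Fin m) (Fin m) ℝ} {CE : ℝ}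
    (hH : ∀ j k, |H j k| ≤ CE) :
    ‖ampRate L H‖ ≤ m ^ 2 * (‖L‖ * (1 + m * |CE|)) := by
  rw [ampRate, norm_mul, Matrix.trace]
  simp only [Matrix.diag_apply, Matrix.mul_apply]
  have h2 : ∀ i k, ‖(momMatrix L - Complex.I • (posMatrix L * H.map Complex.ofReal)) i k‖ ≤
      2 * ‖L‖ * (1 + m * |CE|) := by
    intro i k
    rw [Matrix.sub_apply, Matrix.smul_apply, Matrix.mul_apply]
    refine (norm_sub_le _ _).trans ?_
    rw [smul_eq_mul, norm_mul, Complex.norm_I, one_mul]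
    have h3 : ‖∑ j, posMatrix L i j * (H.map Complex.ofReal) j k‖ ≤
        ∑ _j : Fin m, 2 * ‖L‖ * |CE| := by
      refine (norm_sum_le _ _).trans (Finset.sum_le_sum fun j _ => ?_)
      rw [norm_mul, Matrix.map_apply, Complex.norm_real]
      gcongr
      · exact norm_posMatrix_le L i j
      · exact (hH j k).trans (le_abs_self _)
    simp only [Finset.sum_const, Finset.card_univ, Fintype.card_fin, nsmul_eq_mul] at h3
    have h4 := norm_momMatrix_le L i k
    linarith
  have h5 : ‖∑ i, ∑ k, (zMatrix L)⁻¹ i k *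
      (momMatrix L - Complex.I • (posMatrix L * H.map Complex.ofReal)) k i‖ ≤
      ∑ _i : Fin m, ∑ _k : Fin m, 1 * (2 * ‖L‖ * (1 + m * |CE|)) := by
    refine (norm_sum_le _ _).trans (Finset.sum_le_sum fun i _ => ?_)
    refine (norm_sum_le _ _).trans (Finset.sum_le_sum fun k _ => ?_)
    rw [norm_mul]
    gcongr
    · exact norm_inv_zMatrix_le hL i k
    · exact h2 k i
  simp only [Finset.sum_const, Finset.card_univ, Fintype.card_fin, nsmul_eq_mul] at h5
  have h6 : ‖(1 / 2 : ℂ)‖ = 1 / 2 := by norm_num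
  rw [h6]
  linarith

/-- With the adjugate, all factors are polynomial in `L` and `H` except one scalar inverse.
Measurability then holds without restriction, and continuity wherever the determinant does not
vanish. -/
theorem ampRate_eq (L : Phase m →L[ℝ] Phase m) (H : Matrix (Fin m) (Fin m) ℝ) :
    ampRate L H = 1 / 2 * ((zMatrix L).det⁻¹ * ((zMatrix L).adjugate *
      (momMatrix L - Complex.I • (posMatrix L * H.map Complex.ofReal))).trace) := by
  rw [ampRate, Matrix.inv_def, Ring.inverse_eq_inv', Matrix.smul_mul, Matrix.trace_smul,
    smul_eq_mul]

theorem measurable_ampRate : Measurable fun w : (Phase m →L[ℝ] Phase m) × (Fin m → Fin m → ℝ) =>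
    ampRate w.1 (Matrix.of w.2) := by
  simp_rw [ampRate_eq]
  have hz : Continuous fun w : (Phase m →L[ℝ] Phase m) × (Fin m → Fin m → ℝ) => zMatrix w.1 :=
    continuous_zMatrix.comp continuous_fst
  have hH : Continuous fun w : (Phase m →L[ℝ] Phase m) × (Fin m → Fin m → ℝ) =>
      (Matrix.of w.2).map Complex.ofReal := continuous_matrix fun j k => by
    simp only [Matrix.map_apply, Matrix.of_apply]
    fun_prop
  refine Measurable.const_mul (Measurable.mul hz.matrix_det.measurable.inv ?_) _
  refine Continuous.measurable (Continuous.matrix_trace (hz.matrix_adjugate.matrix_mul ?_))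
  exact (continuous_momMatrix.comp continuous_fst).sub
    ((continuous_const_smul Complex.I).comp
      ((continuous_posMatrix.comp continuous_fst).matrix_mul hH))

theorem continuousAt_ampRate {J : ℝ → Phase m →L[ℝ] Phase m} {H : ℝ → Matrix (Fin m) (Fin m) ℝ}
    {s : ℝ} (hJ : ContinuousAt J s) (hH : ContinuousAt H s)
    (hL : ∀ u v, sympForm (J s u) (J s v) = sympForm u v) :
    ContinuousAt (fun r => ampRate (J r) (H r)) s := by
  simp_rw [ampRate_eq]
  have hz : ContinuousAt (fun r => zMatrix (J r)) s := continuous_zMatrix.continuousAt.comp hJ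
  have hd : ContinuousAt (fun r => (zMatrix (J r)).det) s :=
    (continuous_id.matrix_det.continuousAt).comp hz
  have ha : ContinuousAt (fun r => (zMatrix (J r)).adjugate) s :=
    (continuous_id.matrix_adjugate.continuousAt).comp hz
  have hHc : ContinuousAt (fun r => (H r).map Complex.ofReal) s :=
    (continuous_id.matrix_map Complex.continuous_ofReal).continuousAt.comp hH
  have hp : ContinuousAt (fun r => posMatrix (J r)) s := continuous_posMatrix.continuousAt.comp hJ
  have hm : ContinuousAt (fun r => momMatrix (J r)) s := continuous_momMatrix.continuousAt.comp hJ
  refine continuousAt_const.mul ((hd.inv₀ (isUnit_det_zMatrix hL).ne_zero).mul ?_)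
  refine (continuous_id.matrix_trace.continuousAt).comp (ha.mul (hm.sub ?_))
  exact (continuous_const_smul Complex.I).continuousAt.comp (hp.mul hHc)

end Matrices

end FGS
end

noncomputable section

namespace FGS

open Set Filter Topology NNReal ContDiff

/-! ### Hop counts -/

section HopCount

variable {ν : ℕ}

/-- The number of hops up to time `s`. -/
def hopCount (T : Fin ν → ℝ) (s : ℝ) : ℕ := (Finset.univ.filter fun i => T i ≤ s).card

theorem surfaceAt_eq {N : ℕ} (κ : Fin ((ν + 1) / 2) → Fin N) (T : Fin ν → ℝ) (s : ℝ) :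
    surfaceAt κ T s = stateAfter κ (hopCount T s) := rfl

theorem measurable_hopCount : Measurable fun w : (Fin ν → ℝ) × ℝ => hopCount w.1 w.2 := by
  simp_rw [hopCount, Finset.card_filter]
  refine Finset.measurable_sum _ fun i _ => Measurable.ite ?_ measurable_const measurable_const
  exact measurableSet_le ((measurable_pi_apply i).comp measurable_fst) measurable_snd

theorem eventually_hopCount_eq {T : Fin ν → ℝ} {s : ℝ} (hs : s ∉ range T) :
    ∀ᶠ r in 𝓝 s, hopCount T r = hopCount T s := by
  have h1 : ∀ i, ∀ᶠ r in 𝓝 s, (T i ≤ r ↔ T i ≤ s) := by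
    intro i
    rcases lt_or_gt_of_ne (fun h => hs ⟨i, h⟩ : T i ≠ s) with h | h
    · filter_upwards [lt_mem_nhds h] with r hr
      exact ⟨fun _ => h.le, fun _ => le_of_lt hr⟩
    · filter_upwards [gt_mem_nhds h] with r hr
      exact ⟨fun h' => absurd h' (not_le.2 hr), fun h' => absurd h' (not_le.2 h)⟩
  filter_upwards [eventually_all.2 h1] with r hr
  simp only [hopCount, hr]

/-- The coefficients see the time and the hop times only through an integer, so countably many
measurable maps are glued along measurable level sets. -/
theorem measurable_comp_hopCount {Ω X β : Type*} [MeasurableSpace Ω] [MeasurableSpace X]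
    [MeasurableSpace β] {G : ℕ → X → β} (hG : ∀ n, Measurable (G n)) {T : Ω → Fin ν → ℝ}
    (hT : Measurable T) {s : Ω → ℝ} (hs : Measurable s) {x : Ω → X} (hx : Measurable x) :
    Measurable fun a => G (hopCount (T a) (s a)) (x a) := by
  have h1 : Measurable fun w : ℕ × X => G w.1 w.2 := measurable_from_prod_countable_right hG
  exact h1.comp ((measurable_hopCount.comp (hT.prodMk hs)).prodMk hx)

/-- Away from the hop times the hop count is locally constant; this provides genuine derivatives
between the hops. -/
theorem continuousAt_comp_hopCount {X β : Type*} [TopologicalSpace X] [TopologicalSpace β]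
    {G : ℕ → X → β} (hG : ∀ n, Continuous (G n)) {T : Fin ν → ℝ} {s : ℝ} (hs : s ∉ range T)
    {y : ℝ → X} (hy : ContinuousAt y s) : ContinuousAt (fun r => G (hopCount T r) (y r)) s := by
  have h1 : ContinuousAt (fun r => G (hopCount T s) (y r)) s := (hG _).continuousAt.comp hy
  refine h1.congr ?_
  filter_upwards [eventually_hopCount_eq hs] with r hr
  rw [hr]

theorem exists_bound_of_finite {ι X β : Type*} [Finite ι] [TopologicalSpace X]
    [SeminormedAddCommGroup β] {G : ι → X → β} (hG : ∀ l, Continuous (G l)) {y : ℝ → X} {s : ℝ}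
    (hy : ContinuousOn y (Icc 0 s)) : ∃ K, ∀ l, ∀ r ∈ Icc 0 s, ‖G l (y r)‖ ≤ K := by
  have h1 : ∀ l, ∃ K, ∀ r ∈ Icc 0 s, ‖G l (y r)‖ ≤ K := fun l =>
    isCompact_Icc.exists_bound_of_continuousOn ((hG l).comp_continuousOn hy)
  choose K hK using h1
  obtain ⟨B, hB⟩ := Set.finite_range K |>.bddAbove
  exact ⟨B, fun l r hr => (hK l r hr).trans (hB ⟨l, rfl⟩)⟩

end HopCount

/-- The standing assumptions on the data. -/
structure Data.Admissible {m : ℕ} (D : Data m) (CE M₀ : ℝ) : Prop where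
  energy_lt : D.Ea < D.Eb
  ε_pos : 0 < D.ε
  a_pos : ∀ j, 0 < D.a j
  smooth₀ : ContDiff ℝ ∞ D.U₀
  smooth₁ : ContDiff ℝ ∞ D.U₁
  hess₀ : ∀ q j k, |hessian D.U₀ q j k| ≤ CE
  hess₁ : ∀ q j k, |hessian D.U₁ q j k| ≤ CE
  meas_V : ∀ e ∈ Icc D.Ea D.Eb, Measurable (D.V e)
  bound_V : ∀ e ∈ Icc D.Ea D.Eb, ∀ x, ‖D.V e x‖ ≤ M₀

/-! ### Existence of the frozen Gaussian dynamics -/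

section Existence

variable {m N ν : ℕ} {D : Data m} {CE M₀ : ℝ}

theorem Data.Admissible.contDiff_potential (hD : D.Admissible CE M₀) (l : Option (Fin N)) :
    ContDiff ℝ ∞ (D.potential N l) := by
  cases l with
  | none => exact hD.smooth₀
  | some k => exact hD.smooth₁.add contDiff_const

theorem Data.Admissible.abs_hessian_potential_le (hD : D.Admissible CE M₀) (l : Option (Fin N))
    (q : Pos m) (j k : Fin m) : |hessian (D.potential N l) q j k| ≤ CE := by
  cases l with
  | none => exact hD.hess₀ q j k
  | some i =>
    have h1 : hessian (D.potential N (some i)) q j k = hessian D.U₁ q j k := by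
      rw [hessian_apply, hessian_apply]
      congr 3
      funext x
      exact fderiv_add_const _
    rw [h1]
    exact hD.hess₁ q j k

theorem dz_fst {Y : Phase m → Phase m} {L : Phase m →L[ℝ] Phase m} {z : Phase m}
    (h : HasFDerivAt Y L z) : dz (fun z => (Y z).1) z = posMatrix L := by
  ext j k
  simp only [dz, posMatrix, Matrix.of_apply, h.fst.fderiv, ContinuousLinearMap.comp_apply,
    ContinuousLinearMap.coe_fst']

theorem dz_snd {Y : Phase m → Phase m} {L : Phase m →L[ℝ] Phase m} {z : Phase m}
    (h : HasFDerivAt Y L z) : dz (fun z => (Y z).2) z = momMatrix L := by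
  ext j k
  simp only [dz, momMatrix, Matrix.of_apply, h.snd.fderiv, ContinuousLinearMap.comp_apply,
    ContinuousLinearMap.coe_snd']

theorem Data.measurable_initialAmp (D : Data m) : Measurable D.initialAmp := by
  refine Measurable.const_mul ?_ _
  refine (StronglyMeasurable.integral_prod_right (f := fun (z : Phase m) (y : Pos m) => _)
    ?_).measurable
  refine Continuous.stronglyMeasurable ?_
  simp only [Function.uncurry_def, Data.initialWave]
  fun_prop

/-- The entries of the Hessian matrix. -/
def hessianArray (U : Pos m → ℝ) (q : Pos m) : Fin m → Fin m → ℝ := fun j k => hessian U q j k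

theorem of_hessianArray (U : Pos m → ℝ) (q : Pos m) :
    Matrix.of (hessianArray U q) = hessian U q := rfl

theorem continuous_hessianArray {U : Pos m → ℝ} (hU : ContDiff ℝ ∞ U) :
    Continuous (hessianArray U) := by
  refine continuous_pi fun j => continuous_pi fun k => ?_
  simp_rw [hessianArray, hessian_apply]
  have h1 : Continuous (fderiv ℝ (fderiv ℝ U)) :=
    (hU.fderiv_right (m := ∞) (by simp)).continuous_fderiv (by simp)
  fun_prop

/-- The flow along a hop history and its derivative. -/
theorem exists_hopFlow (hD : D.Admissible CE M₀) (κ : Fin ((ν + 1) / 2) → Fin N) :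
    ∃ (Y : Phase m × (Fin ν → ℝ) → ℝ → Phase m)
      (J : Phase m × (Fin ν → ℝ) → ℝ → Phase m →L[ℝ] Phase m),
      (Measurable fun w : (Phase m × (Fin ν → ℝ)) × ℝ => Y w.1 w.2) ∧
      (Measurable fun w : (Phase m × (Fin ν → ℝ)) × ℝ => J w.1 w.2) ∧
      (∀ a, Continuous (Y a)) ∧ (∀ a, Continuous (J a)) ∧
      (∀ a, Y a 0 = a.1) ∧
      (∀ a s, 0 < s → s ∉ range a.2 → HasDerivAt (Y a)
        (hamField (D.potential N (surfaceAt κ a.2 s)) (Y a s)) s) ∧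
      (∀ z T s, 0 ≤ s → HasFDerivAt (fun z => Y (z, T) s) (J (z, T) s) z) ∧
      (∀ a s, 0 ≤ s → ∀ u v, sympForm (J a s u) (J a s v) = sympForm u v) ∧
      (∀ a s, 0 ≤ s → ‖J a s‖ ≤ 2 * Real.exp ((2 * lipConst m CE + 1) * s)) := by
  have hUs := fun l : Option (Fin N) => hD.contDiff_potential l
  have hUh := fun l : Option (Fin N) => hD.abs_hessian_potential_le l
  set G : ℕ → Phase m → Phase m := fun n => hamField (D.potential N (stateAfter κ n)) with hG
  set DG : ℕ → Phase m → Phase m →L[ℝ] Phase m :=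
    fun n => hamDeriv (D.potential N (stateAfter κ n)) with hDG
  have hGc : ∀ n, Continuous (G n) := fun n => continuous_hamField (hUs _)
  have hDGc : ∀ n, Continuous (DG n) := fun n => continuous_hamDeriv (hUs _)
  have hGlip : ∀ n, LipschitzWith (lipConst m CE) (G n) := fun n =>
    lipschitzWith_hamField (hUs _) (hUh _)
  have hGd : ∀ n w, HasFDerivAt (G n) (DG n w) w := fun n w => hasFDerivAt_hamField (hUs _) w
  have hDGb : ∀ n w, ‖DG n w‖ ≤ lipConst m CE := fun n w => (hGd n w).le_of_lipschitz (hGlip n)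
  -- The degenerate interval `{0}` and the constant curve at the origin give one bound for the
  -- finitely many fields at the origin.
  obtain ⟨B, hB⟩ := exists_bound_of_finite (s := 0)
    (fun l : Option (Fin N) => continuous_hamField (hUs l))
    (y := fun _ => (0 : Phase m)) continuousOn_const
  have hG0 : ∀ n, ‖G n 0‖ ≤ B := fun n => hB _ 0 (by simp)
  have hcar : IsCaratheodory
      (fun (a : Phase m × (Fin ν → ℝ)) r (x : Phase m) => G (hopCount a.2 r) x)
      (lipConst m CE) (fun _ => B) :=
    ⟨measurable_comp_hopCount (fun n => (hGc n).measurable)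
      (measurable_snd.comp (measurable_fst.comp measurable_fst))
      (measurable_snd.comp measurable_fst) measurable_snd, fun a r => hGlip _, fun a r => hG0 _⟩
  obtain ⟨Y, hYm, hYc, hY⟩ := exists_caratheodory_solution hcar measurable_fst
  have hYma : ∀ a, Measurable (Y a) := fun a => (hYc a).measurable
  -- The variational equation along the flow is linear, with Lipschitz constant the norm of its
  -- coefficient; the coefficient is measurable because `Y` is jointly measurable.
  have hcarJ : IsCaratheodory
      (fun (a : Phase m × (Fin ν → ℝ)) r (L : Phase m →L[ℝ] Phase m) =>
        (DG (hopCount a.2 r) (Y a r)).comp L)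
      (lipConst m CE) (fun _ => 0) := by
    refine ⟨?_, fun a r => ?_, fun a r => by simp⟩
    · have h1 : Measurable fun w : ((Phase m × (Fin ν → ℝ)) × ℝ) × (Phase m →L[ℝ] Phase m) =>
          DG (hopCount w.1.1.2 w.1.2) (Y w.1.1 w.1.2) :=
        measurable_comp_hopCount (fun n => (hDGc n).measurable)
          (measurable_snd.comp (measurable_fst.comp measurable_fst))
          (measurable_snd.comp measurable_fst) (hYm.comp measurable_fst)
      have h2 : Continuous fun w : (Phase m →L[ℝ] Phase m) × (Phase m →L[ℝ] Phase m) =>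
          w.1.comp w.2 := by fun_prop
      exact h2.measurable.comp (h1.prodMk measurable_snd)
    · refine LipschitzWith.of_dist_le_mul fun L L' => ?_
      rw [dist_eq_norm, dist_eq_norm, ← ContinuousLinearMap.comp_sub]
      refine (ContinuousLinearMap.opNorm_comp_le _ _).trans ?_
      gcongr
      exact hDGb _ _
  obtain ⟨J, hJm, hJc, hJ⟩ := exists_caratheodory_solution hcarJ
    (x₀ := fun _ => ContinuousLinearMap.id ℝ (Phase m)) measurable_const
  have hYbd : ∀ a s, ∃ K, ∀ r ∈ Ioc 0 s, ‖Y a r‖ ≤ K := fun a s => by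
    obtain ⟨K, hK⟩ := (isCompact_Icc (a := (0 : ℝ)) (b := s)).exists_bound_of_continuousOn
      (hYc a).continuousOn
    exact ⟨K, fun r hr => hK r ⟨hr.1.le, hr.2⟩⟩
  have hJbd : ∀ a s, ∃ K, ∀ r ∈ Ioc 0 s, ‖J a r‖ ≤ K := fun a s => by
    obtain ⟨K, hK⟩ := (isCompact_Icc (a := (0 : ℝ)) (b := s)).exists_bound_of_continuousOn
      (hJc a).continuousOn
    exact ⟨K, fun r hr => hK r ⟨hr.1.le, hr.2⟩⟩
  have hYi : ∀ a s, IntegrableOn (fun r => G (hopCount a.2 r) (Y a r)) (Ioc 0 s) volume :=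
    fun a s => integrableOn_caratheodory hcar a (hYma a) (hYbd a s).choose_spec
  have hJi : ∀ a s, IntegrableOn (fun r => (DG (hopCount a.2 r) (Y a r)).comp (J a r))
      (Ioc 0 s) volume :=
    fun a s => integrableOn_caratheodory hcarJ a (hJc a).measurable (hJbd a s).choose_spec
  have hYd : ∀ a s, 0 < s → s ∉ range a.2 → HasDerivAt (Y a) (G (hopCount a.2 s) (Y a s)) s := by
    intro a s hs hsT
    have h1 := hasDerivAt_integral_Ioc hs (hYi a s)
      (aestronglyMeasurable_caratheodory hcar a (hYma a))
      (continuousAt_comp_hopCount hGc hsT (hYc a).continuousAt)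
    exact (h1.const_add a.1).congr_of_eventuallyEq (Eventually.of_forall fun r => hY a r)
  have hJd : ∀ a s, 0 < s → s ∉ range a.2 →
      HasDerivAt (J a) ((DG (hopCount a.2 s) (Y a s)).comp (J a s)) s := by
    intro a s hs hsT
    have h1 := hasDerivAt_integral_Ioc hs (hJi a s)
      (aestronglyMeasurable_caratheodory hcarJ a (hJc a).measurable)
      ((continuousAt_comp_hopCount hDGc hsT (hYc a).continuousAt).clm_comp (hJc a).continuousAt)
    have h2 := h1.const_add (ContinuousLinearMap.id ℝ (Phase m))
    refine h2.congr_of_eventuallyEq (Eventually.of_forall fun r => ?_)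
    exact hJ a r
  refine ⟨Y, J, hYm, hJm, hYc, hJc, ?_, hYd, ?_, ?_, ?_⟩
  · intro a
    rw [hY a 0]; simp
  · intro z T s hs
    refine hasFDerivAt_of_integral_eq (F := fun r => G (hopCount T r))
      (DF := fun r => DG (hopCount T r)) (C := lipConst m CE) (K := B)
      (Y := fun z => Y (z, T)) (J := J (z, T)) (fun r => hGlip _) (fun r x => hGd _ x) ?_ ?_
      (fun r => hG0 _) (fun x => hYc _) ?_ (hJc _) ?_ hs
    · exact measurable_comp_hopCount (fun n => (hGc n).measurable) measurable_const
        measurable_fst measurable_snd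
    · exact measurable_comp_hopCount (fun n => (hDGc n).measurable) measurable_const
        measurable_fst measurable_snd
    · intro x s hs
      rw [intervalIntegral.integral_of_le hs]
      exact hY (x, T) s
    · intro s hs
      rw [intervalIntegral.integral_of_le hs]
      exact hJ (z, T) s
  -- The form of two columns of `J` is continuous, and its derivative vanishes off the hop times by
  -- `sympForm_hamDeriv`, so it keeps its initial value.
  · intro a s hs u v
    have hc : ∀ u k, Continuous fun r => (J a r u).1 k := fun u k => by
      have := hJc a
      fun_prop
    have hc2 : ∀ u k, Continuous fun r => (J a r u).2 k := fun u k => by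
      have := hJc a
      fun_prop
    have h1 := eq_of_hasDerivAt_zero_off_countable (f := fun r => sympForm (J a r u) (J a r v))
      hs (Set.countable_range a.2) ?_ ?_
    · rw [h1, hJ a 0]
      simp
    · refine Continuous.continuousOn ?_
      simp only [sympForm]
      refine continuous_finsetSum _ fun k _ => ?_
      exact ((hc2 u k).mul (hc v k)).sub ((hc u k).mul (hc2 v k))
    · intro r hr0 _ hrT
      have hd : ∀ u, HasDerivAt (fun r => J a r u) (DG (hopCount a.2 r) (Y a r) (J a r u)) r :=
        fun u => by
          have := (hJd a r hr0 hrT).clm_apply (hasDerivAt_const r u)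
          simpa using this
      have hd1 : ∀ u k, HasDerivAt (fun r => (J a r u).1 k)
          ((DG (hopCount a.2 r) (Y a r) (J a r u)).1 k) r := fun u k =>
        ((EuclideanSpace.proj k : Pos m →L[ℝ] ℝ).comp
          (ContinuousLinearMap.fst ℝ (Pos m) (Pos m))).hasFDerivAt.comp_hasDerivAt r (hd u)
      have hd2 : ∀ u k, HasDerivAt (fun r => (J a r u).2 k)
          ((DG (hopCount a.2 r) (Y a r) (J a r u)).2 k) r := fun u k =>
        ((EuclideanSpace.proj k : Pos m →L[ℝ] ℝ).comp
          (ContinuousLinearMap.snd ℝ (Pos m) (Pos m))).hasFDerivAt.comp_hasDerivAt r (hd u)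
      have h2 := HasDerivAt.fun_sum (u := Finset.univ) fun k (_ : k ∈ Finset.univ) =>
        ((hd2 u k).mul (hd1 v k)).sub ((hd1 u k).mul (hd2 v k))
      refine h2.congr_deriv ?_
      rw [← sympForm_hamDeriv (hUs (stateAfter κ (hopCount a.2 r))) (Y a r) (J a r u) (J a r v)]
      simp only [sympForm]
      rw [← Finset.sum_add_distrib]
      refine Finset.sum_congr rfl fun k _ => ?_
      simp only [hDG]
      ring
  -- Gronwall's inequality compares `J` with the zero solution of the same linear equation.
  · intro a s hs
    have h1 := norm_sub_le_of_integral_eq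
      (F := fun r L => (DG (hopCount a.2 r) (Y a r)).comp L) (fun r => hcarJ.lip a r)
      (y₁ := J a) (y₂ := fun _ => 0) (x₁ := ContinuousLinearMap.id ℝ (Phase m)) (x₂ := 0) hs
      (hJc a).continuousOn continuousOn_const
      ((intervalIntegrable_iff_integrableOn_Ioc_of_le hs).2 (hJi a s)) (by simp)
      (fun r hr => by rw [intervalIntegral.integral_of_le hr.1]; exact hJ a r)
      (fun r hr => by simp) s ⟨hs, le_rfl⟩
    simp only [sub_zero] at h1
    refine h1.trans ?_
    have h2 := ContinuousLinearMap.norm_id_le (𝕜 := ℝ) (E := Phase m)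
    gcongr
    linarith

end Existence

end FGS
end

noncomputable section

namespace FGS

open Set Filter Topology NNReal

/-! ### Construction, uniqueness and measurability of the frozen Gaussian trajectories. -/

section Trajectories

variable {m N ν : ℕ} {D : Data m} {CE M₀ : ℝ}

/-- The logarithmic derivative of the amplitude along a trajectory. -/
def Data.logDerivAmp (D : Data m) (κ : Fin ((ν + 1) / 2) → Fin N) (T : Fin ν → ℝ)
    (X : Trajectory m) (s : ℝ) (z : Phase m) : ℂ :=
  1 / 2 * ((X.Z s z)⁻¹ * (dz (X.P s) z - Complex.I • (dz (X.Q s) z *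
    (hessian (D.potential N (surfaceAt κ T s)) (X.Q s z)).map Complex.ofReal))).trace

/-- A bound for the growth of the amplitude. -/
def ampBound (m : ℕ) (CE s : ℝ) : ℝ :=
  Real.exp (m ^ 2 * (2 * Real.exp ((2 * lipConst m CE + 1) * s) * (1 + m * |CE|)) * s)

/-- Solutions of the frozen Gaussian dynamics exist along every hop history, depend measurably on
the initial point and the hop times, and their amplitudes are bounded relative to the initial
amplitude. -/
theorem exists_trajectory (hD : D.Admissible CE M₀) (κ : Fin ((ν + 1) / 2) → Fin N) :
    ∃ X : (Fin ν → ℝ) → Trajectory m, (∀ T, D.Solves κ T (X T)) ∧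
      (Measurable fun w : (Phase m × (Fin ν → ℝ)) × ℝ => (X w.1.2).Q w.2 w.1.1) ∧
      (Measurable fun w : (Phase m × (Fin ν → ℝ)) × ℝ => (X w.1.2).P w.2 w.1.1) ∧
      (Measurable fun w : (Phase m × (Fin ν → ℝ)) × ℝ => (X w.1.2).S w.2 w.1.1) ∧
      (Measurable fun w : (Phase m × (Fin ν → ℝ)) × ℝ => (X w.1.2).A w.2 w.1.1) ∧
      (∀ T z s, 0 ≤ s → ‖(X T).A s z‖ ≤ ‖D.initialAmp z‖ * ampBound m CE s) ∧
      (∀ T z t, 0 ≤ t → ∃ (c : ℝ → ℂ) (K : ℝ), Measurable c ∧ (∀ r ∈ Icc 0 t, ‖c r‖ ≤ K) ∧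
        ∀ s, 0 ≤ s → c s = D.logDerivAmp κ T (X T) s z) := by
  obtain ⟨Y, J, hYm, hJm, hYc, hJc, hY0, hYd, hYJ, hsymp, hJb⟩ := exists_hopFlow hD κ
  have hUs := fun l : Option (Fin N) => hD.contDiff_potential l
  -- By the differentiability of the flow, the derivatives in the amplitude equation are the blocks
  -- of `J`. The equation is thus scalar and linear with known coefficient `c`, and an exponential
  -- solves it.
  set c : Phase m × (Fin ν → ℝ) → ℝ → ℂ := fun a s =>
    ampRate (J a s) (hessian (D.potential N (surfaceAt κ a.2 s)) (Y a s).1) with hc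
  clear_value c
  have hcm : Measurable fun w : (Phase m × (Fin ν → ℝ)) × ℝ => c w.1 w.2 := by
    have h1 : Measurable fun w : (Phase m × (Fin ν → ℝ)) × ℝ =>
        hessianArray (D.potential N (stateAfter κ (hopCount w.1.2 w.2))) (Y w.1 w.2).1 :=
      measurable_comp_hopCount
        (G := fun n => hessianArray (D.potential N (stateAfter κ n)))
        (fun n => (continuous_hessianArray (hUs _)).measurable)
        (measurable_snd.comp measurable_fst) measurable_snd (measurable_fst.comp hYm)
    have h2 := measurable_ampRate.comp (hJm.prodMk h1)
    simp only [Function.comp_def, of_hessianArray] at h2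
    rw [hc]
    exact h2
  have hcb : ∀ a s, 0 ≤ s → ∀ r ∈ Icc 0 s,
      ‖c a r‖ ≤ m ^ 2 * (2 * Real.exp ((2 * lipConst m CE + 1) * s) * (1 + m * |CE|)) := by
    intro a s hs r hr
    simp only [hc]
    refine (norm_ampRate_le (hsymp a r hr.1) (hD.abs_hessian_potential_le _ _)).trans ?_
    have h1 : ‖J a r‖ ≤ 2 * Real.exp ((2 * lipConst m CE + 1) * s) :=
      (hJb a r hr.1).trans (by have := hr.2; gcongr)
    gcongr
  have hcma : ∀ a, Measurable (c a) := fun a =>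
    hcm.comp (measurable_prodMk_left (x := a))
  have hci : ∀ a s, IntegrableOn (c a) (Ioc 0 s) volume := by
    intro a s
    rcases le_or_gt s 0 with hs | hs
    · rw [Ioc_eq_empty (by simpa using hs)]; simp
    · exact (intervalIntegrable_iff_integrableOn_Ioc_of_le hs.le).1
        (intervalIntegrable_of_norm_le hs.le (hcma a).aestronglyMeasurable (hcb a s hs.le))
  set ℓ : Phase m × (Fin ν → ℝ) → ℝ → ℝ := fun a s =>
    1 / 2 * ‖(Y a s).2‖ ^ 2 - D.potential N (surfaceAt κ a.2 s) (Y a s).1 with hℓ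
  clear_value ℓ
  have hℓG : ∀ l : Option (Fin N), Continuous fun w : Phase m =>
      1 / 2 * ‖w.2‖ ^ 2 - D.potential N l w.1 := fun l => by
    have := (hUs l).continuous
    fun_prop
  have hℓm : Measurable fun w : (Phase m × (Fin ν → ℝ)) × ℝ => ℓ w.1 w.2 := by
    rw [hℓ]
    exact measurable_comp_hopCount
      (G := fun n (w : Phase m) => 1 / 2 * ‖w.2‖ ^ 2 - D.potential N (stateAfter κ n) w.1)
      (fun n => (hℓG _).measurable) (measurable_snd.comp measurable_fst) measurable_snd hYm
  have hℓma : ∀ a, Measurable (ℓ a) := fun a =>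
    hℓm.comp (measurable_prodMk_left (x := a))
  have hℓi : ∀ a s, IntegrableOn (ℓ a) (Ioc 0 s) volume := by
    intro a s
    rcases le_or_gt s 0 with hs | hs
    · rw [Ioc_eq_empty (by simpa using hs)]; simp
    · obtain ⟨K, hK⟩ := exists_bound_of_finite hℓG (s := s) (hYc a).continuousOn
      exact (intervalIntegrable_iff_integrableOn_Ioc_of_le hs.le).1
        (intervalIntegrable_of_norm_le hs.le (hℓma a).aestronglyMeasurable
          (fun r hr => by simp only [hℓ]; exact hK (surfaceAt κ a.2 r) r hr))
  have hcd : ∀ a s, 0 < s → s ∉ range a.2 → ContinuousAt (c a) s := by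
    intro a s hs hsT
    rw [hc]
    refine continuousAt_ampRate (hJc a).continuousAt ?_ (hsymp a s hs.le)
    exact continuousAt_comp_hopCount
      (G := fun n => hessianArray (D.potential N (stateAfter κ n)))
      (fun n => continuous_hessianArray (hUs _)) hsT (continuous_fst.comp (hYc a)).continuousAt
  have hℓd : ∀ a s, s ∉ range a.2 → ContinuousAt (ℓ a) s := by
    intro a s hsT
    rw [hℓ]
    exact continuousAt_comp_hopCount
      (G := fun n (w : Phase m) => 1 / 2 * ‖w.2‖ ^ 2 - D.potential N (stateAfter κ n) w.1)
      (fun n => hℓG _) hsT (hYc a).continuousAt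
  set X : (Fin ν → ℝ) → Trajectory m := fun T =>
    { Q := fun s z => (Y (z, T) s).1
      P := fun s z => (Y (z, T) s).2
      S := fun s z => ∫ r in Ioc 0 s, ℓ (z, T) r
      A := fun s z => D.initialAmp z * Complex.exp (∫ r in Ioc 0 s, c (z, T) r) } with hX
  have hlog : ∀ T z s, 0 ≤ s → c (z, T) s = D.logDerivAmp κ T (X T) s z := by
    intro T z s hs
    have h1 : dz ((X T).Q s) z = posMatrix (J (z, T) s) := dz_fst (hYJ z T s hs)
    have h2 : dz ((X T).P s) z = momMatrix (J (z, T) s) := dz_snd (hYJ z T s hs)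
    simp only [Data.logDerivAmp, Trajectory.Z, h1, h2, hc]
    rfl
  have hAc : ∀ T z, Continuous fun s => (X T).A s z := fun T z =>
    continuous_const.mul (Complex.continuous_exp.comp (continuous_integral_Ioc (hci (z, T))))
  refine ⟨X, fun T => ?_, measurable_fst.comp hYm, measurable_snd.comp hYm, ?_, ?_, ?_, ?_⟩
  · refine ⟨fun z => by simp [hX, hY0], fun z => by simp [hX, hY0], fun z => by simp [hX],
      fun z => by simp [hX], fun z => (continuous_fst.comp (hYc _)).continuousOn,
      fun z => (continuous_snd.comp (hYc _)).continuousOn,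
      fun z => (continuous_integral_Ioc (hℓi _)).continuousOn,
      fun z => (hAc T z).continuousOn, ?_, ?_, ?_, ?_⟩
    · intro z s hs hsT
      exact (hYd (z, T) s hs hsT).fst
    · intro z s hs hsT
      exact (hYd (z, T) s hs hsT).snd
    · intro z s hs hsT
      exact hasDerivAt_integral_Ioc hs (hℓi (z, T) s) (hℓma (z, T)).aestronglyMeasurable
        (hℓd (z, T) s hsT) |>.congr_deriv (by simp only [hℓ, hX])
    · intro z s hs hsT
      have h1 := (hasDerivAt_integral_Ioc hs (hci (z, T) s) (hcma (z, T)).aestronglyMeasurable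
        (hcd (z, T) s hs hsT)).cexp.const_mul (D.initialAmp z)
      refine h1.congr_deriv ?_
      rw [hlog T z s hs.le, Data.logDerivAmp]
      simp only [hX]
      ring
  · exact (measurable_integral_Ioc hℓm).comp
      (((measurable_fst.comp measurable_fst).prodMk (measurable_snd.comp measurable_fst)).prodMk
        measurable_snd)
  · refine Measurable.mul (D.measurable_initialAmp.comp (measurable_fst.comp measurable_fst)) ?_
    exact Complex.measurable_exp.comp ((measurable_integral_Ioc hcm).comp
      (((measurable_fst.comp measurable_fst).prodMk (measurable_snd.comp measurable_fst)).prodMk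
        measurable_snd))
  · intro T z s hs
    simp only [hX, norm_mul, Complex.norm_exp]
    gcongr
    -- The modulus of an exponential is the exponential of the real part, which is at most the
    -- modulus of the integral, hence at most `s` times the bound for `c`.
    rw [ampBound, Real.exp_le_exp]
    refine (Complex.re_le_norm _).trans ?_
    refine (norm_setIntegral_le_of_norm_le_const (by simp) fun r hr =>
      hcb (z, T) s hs r ⟨hr.1.le, hr.2⟩).trans ?_
    simp [hs]
  · intro T z t ht
    exact ⟨c (z, T), _, hcma _, hcb (z, T) t ht, fun s hs => hlog T z s hs⟩

/-- `Solves` prescribes nothing before time `0`. Clamping the time makes a solution continuous on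
the whole line without changing it where it matters. -/
theorem continuous_comp_max {E : Type*} [TopologicalSpace E] {f : ℝ → E}
    (hf : ContinuousOn f (Ici 0)) : Continuous fun r => f (max r 0) :=
  hf.comp_continuous (by fun_prop) fun r => le_max_right r 0

theorem HasDerivAt.comp_max {E : Type*} [NormedAddCommGroup E] [NormedSpace ℝ E] {f : ℝ → E}
    {f' : E} {s : ℝ} (hs : 0 < s) (hf : HasDerivAt f f' s) :
    HasDerivAt (fun r => f (max r 0)) f' s := by
  refine hf.congr_of_eventuallyEq ?_
  filter_upwards [lt_mem_nhds hs] with r hr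
  rw [max_eq_left (le_of_lt hr)]

/-- The fundamental theorem of calculus tolerates the finitely many hop times as exceptional points.
The integral form makes Gronwall's inequality available for an arbitrary solution, not only for the
constructed one. -/
theorem Data.Solves.integral_eq (hD : D.Admissible CE M₀) {κ : Fin ((ν + 1) / 2) → Fin N}
    {T : Fin ν → ℝ} {X : Trajectory m} (h : D.Solves κ T X) (z : Phase m) {t : ℝ} (ht : 0 ≤ t) :
    IntervalIntegrable (fun r => hamField (D.potential N (surfaceAt κ T r))
      (X.Q (max r 0) z, X.P (max r 0) z)) volume 0 t ∧
    (X.Q (max t 0) z, X.P (max t 0) z) = z + ∫ r in (0 : ℝ)..t,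
      hamField (D.potential N (surfaceAt κ T r)) (X.Q (max r 0) z, X.P (max r 0) z) := by
  have hc : Continuous fun r => (X.Q (max r 0) z, X.P (max r 0) z) :=
    (continuous_comp_max (h.Q_cont z)).prodMk (continuous_comp_max (h.P_cont z))
  have hG : ∀ l : Option (Fin N), Continuous (hamField (D.potential N l)) := fun l =>
    continuous_hamField (hD.contDiff_potential l)
  obtain ⟨K, hK⟩ := exists_bound_of_finite hG (s := t) hc.continuousOn
  have hm : Measurable fun r => hamField (D.potential N (surfaceAt κ T r))
      (X.Q (max r 0) z, X.P (max r 0) z) :=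
    measurable_comp_hopCount (G := fun n => hamField (D.potential N (stateAfter κ n)))
      (fun n => (hG _).measurable) measurable_const measurable_id hc.measurable
  have hi : IntervalIntegrable (fun r => hamField (D.potential N (surfaceAt κ T r))
      (X.Q (max r 0) z, X.P (max r 0) z)) volume 0 t :=
    intervalIntegrable_of_norm_le ht hm.aestronglyMeasurable fun r hr => hK _ r hr
  refine ⟨hi, ?_⟩
  rw [integral_eq_of_hasDerivAt_off_countable_of_le
    (fun r => (X.Q (max r 0) z, X.P (max r 0) z)) _ ht (countable_range T) hc.continuousOn ?_ hi]
  · simp [h.Q_zero, h.P_zero]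
  · intro r hr
    have h1 := HasDerivAt.comp_max hr.1.1 (h.Q_deriv z r hr.1.1 hr.2)
    have h2 := HasDerivAt.comp_max hr.1.1 (h.P_deriv z r hr.1.1 hr.2)
    have h3 := h1.prodMk h2
    refine h3.congr_deriv ?_
    simp [hamField, max_eq_left hr.1.1.le]

/-- Positions and momenta up to time `s₀` depend on the hop history before `s₀` only. -/
theorem Data.Solves.phase_eq (hD : D.Admissible CE M₀) {ν' : ℕ} {κ : Fin ((ν + 1) / 2) → Fin N}
    {T : Fin ν → ℝ} {κ' : Fin ((ν' + 1) / 2) → Fin N} {T' : Fin ν' → ℝ} {X X' : Trajectory m}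
    (h : D.Solves κ T X) (h' : D.Solves κ' T' X') {s₀ : ℝ}
    (heq : ∀ r, 0 < r → r < s₀ → surfaceAt κ T r = surfaceAt κ' T' r) (z : Phase m) {s : ℝ}
    (hs : 0 ≤ s) (hs₀ : s ≤ s₀) : X.Q s z = X'.Q s z ∧ X.P s z = X'.P s z := by
  have hcongr : ∀ r ∈ Icc 0 s, ∫ u in (0 : ℝ)..r, hamField (D.potential N (surfaceAt κ' T' u))
      (X'.Q (max u 0) z, X'.P (max u 0) z) =
      ∫ u in (0 : ℝ)..r, hamField (D.potential N (surfaceAt κ T u))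
      (X'.Q (max u 0) z, X'.P (max u 0) z) := by
    intro r hr
    refine intervalIntegral.integral_congr_ae ?_
    -- The two surfaces may differ at `s₀` itself, for instance when a hop occurs there; a single
    -- point is negligible in the integral.
    filter_upwards [Measure.ae_ne volume s₀] with u hu hur
    rw [uIoc_of_le hr.1] at hur
    rw [heq u hur.1 (lt_of_le_of_ne (hur.2.trans (hr.2.trans hs₀)) hu)]
  have hi : IntervalIntegrable (fun u => hamField (D.potential N (surfaceAt κ T u))
      (X'.Q (max u 0) z, X'.P (max u 0) z)) volume 0 s := by
    refine (h'.integral_eq hD z hs).1.congr_ae ?_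
    rw [Filter.EventuallyEq, ae_restrict_iff' measurableSet_uIoc]
    filter_upwards [Measure.ae_ne volume s₀] with u hu hur
    rw [uIoc_of_le hs] at hur
    rw [heq u hur.1 (lt_of_le_of_ne (hur.2.trans hs₀) hu)]
  have h1 := norm_sub_le_of_integral_eq
    (F := fun r => hamField (D.potential N (surfaceAt κ T r))) (C := lipConst m CE)
    (y₁ := fun r => (X.Q (max r 0) z, X.P (max r 0) z))
    (y₂ := fun r => (X'.Q (max r 0) z, X'.P (max r 0) z)) (x₁ := z) (x₂ := z)
    (fun r => lipschitzWith_hamField (hD.contDiff_potential _) (hD.abs_hessian_potential_le _)) hs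
    ((continuous_comp_max (h.Q_cont z)).prodMk (continuous_comp_max (h.P_cont z))).continuousOn
    ((continuous_comp_max (h'.Q_cont z)).prodMk (continuous_comp_max (h'.P_cont z))).continuousOn
    (h.integral_eq hD z hs).1 hi (fun r hr => (h.integral_eq hD z hr.1).2)
    (fun r hr => (h'.integral_eq hD z hr.1).2.trans (by rw [hcongr r hr])) s ⟨hs, le_rfl⟩
  simp only [sub_self, norm_zero, mul_zero, zero_mul, norm_le_zero_iff, sub_eq_zero,
    max_eq_left hs, Prod.mk.injEq] at h1
  exact h1

/-- Uniqueness of the frozen Gaussian dynamics. -/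
theorem Data.Solves.eq_of_bounded (hD : D.Admissible CE M₀) {κ : Fin ((ν + 1) / 2) → Fin N}
    {T : Fin ν → ℝ} {X X' : Trajectory m} (h : D.Solves κ T X) (h' : D.Solves κ T X')
    (hb : ∀ z t, 0 ≤ t → ∃ (c : ℝ → ℂ) (K : ℝ), Measurable c ∧ (∀ r ∈ Icc 0 t, ‖c r‖ ≤ K) ∧
        ∀ s, 0 ≤ s → c s = D.logDerivAmp κ T X s z) {t : ℝ} (ht : 0 ≤ t) (z : Phase m) :
    X.Q t z = X'.Q t z ∧ X.P t z = X'.P t z ∧ X.S t z = X'.S t z ∧ X.A t z = X'.A t z := by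
  have hQP := fun (z : Phase m) (s : ℝ) (hs : 0 ≤ s) =>
    h.phase_eq hD h' (s₀ := s) (fun _ _ _ => rfl) z hs le_rfl
  refine ⟨(hQP z t ht).1, (hQP z t ht).2, ?_, ?_⟩
  · have h1 := eq_of_hasDerivAt_zero_off_countable (f := fun r => X.S r z - X'.S r z) ht
      (countable_range T)
      (((h.S_cont z).sub (h'.S_cont z)).mono fun r hr => hr.1) fun r hr0 _ hrT => by
        have h2 := (h.S_deriv z r hr0 hrT).sub (h'.S_deriv z r hr0 hrT)
        rw [(hQP z r hr0.le).1, (hQP z r hr0.le).2, sub_self] at h2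
        exact h2
    rw [h.S_zero, h'.S_zero, sub_self, sub_eq_zero] at h1
    exact h1
  · obtain ⟨c, K, hcm, hcK, hc⟩ := hb z t ht
    -- The rate contains derivatives in the initial point, so the rates of the two solutions agree
    -- because positions and momenta agree at every `z`, not just at the given one.
    have hlog : ∀ s, 0 ≤ s → D.logDerivAmp κ T X' s z = c s := by
      intro s hs
      have e1 : X'.Q s = X.Q s := funext fun z => (hQP z s hs).1.symm
      have e2 : X'.P s = X.P s := funext fun z => (hQP z s hs).2.symm
      rw [hc s hs]
      simp only [Data.logDerivAmp, Trajectory.Z, e1, e2]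
    set d : ℝ → ℂ := fun r => X.A (max r 0) z - X'.A (max r 0) z with hd
    have hdc : Continuous d :=
      (continuous_comp_max (h.A_cont z)).sub (continuous_comp_max (h'.A_cont z))
    obtain ⟨B, hB⟩ := (isCompact_Icc (a := (0 : ℝ)) (b := t)).exists_bound_of_continuousOn
      hdc.continuousOn
    have hK0 : 0 ≤ K := (norm_nonneg _).trans (hcK 0 ⟨le_rfl, ht⟩)
    have hci : IntervalIntegrable (fun r => c r * d r) volume 0 t :=
      intervalIntegrable_of_norm_le (K := K * B) ht
        (hcm.mul hdc.measurable).aestronglyMeasurable fun r hr => by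
          rw [norm_mul]
          exact mul_le_mul (hcK r hr) (hB r hr) (norm_nonneg _) hK0
    have hd0 : d 0 = 0 := by simp [hd, h.A_zero, h'.A_zero]
    have hint : ∀ s ∈ Icc 0 t, d s = ∫ r in (0 : ℝ)..s, c r * d r := by
      intro s hs
      rw [integral_eq_of_hasDerivAt_off_countable_of_le d _ hs.1 (countable_range T)
        hdc.continuousOn ?_ (hci.mono_set ?_), hd0, sub_zero]
      · intro r hr
        have h1 := HasDerivAt.comp_max hr.1.1 (h.A_deriv z r hr.1.1 hr.2)
        have h2 := HasDerivAt.comp_max hr.1.1 (h'.A_deriv z r hr.1.1 hr.2)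
        refine (h1.sub h2).congr_deriv ?_
        have e1 := hc r hr.1.1.le
        have e2 := hlog r hr.1.1.le
        simp only [Data.logDerivAmp] at e1 e2
        simp only [hd, max_eq_left hr.1.1.le]
        linear_combination (-(X.A r z)) * e1 - (X'.A r z) * e2
      · rw [uIcc_of_le hs.1, uIcc_of_le ht]; exact Icc_subset_Icc_right hs.2
    -- The difference of the amplitudes solves a homogeneous linear equation with bounded
    -- coefficient and zero initial value.
    have h1 := le_exp_of_le_add_integral (u := fun s => ‖d s‖) (A := 0) (C := K) le_rfl hK0 ht
      hdc.norm.continuousOn (fun s hs => by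
        rw [zero_add, hint s hs, ← intervalIntegral.integral_const_mul]
        refine intervalIntegral.norm_integral_le_of_norm_le hs.1 ?_
          (Continuous.intervalIntegrable (by fun_prop) _ _)
        refine ae_of_all _ fun r hr => ?_
        rw [norm_mul]
        gcongr
        exact hcK r ⟨hr.1.le, hr.2.trans hs.2⟩) t ⟨ht, le_rfl⟩
    simp only [mul_zero, zero_mul, norm_le_zero_iff, hd, sub_eq_zero, max_eq_left ht] at h1
    exact h1

theorem Data.Admissible.solves_traj (hD : D.Admissible CE M₀) (κ : Fin ((ν + 1) / 2) → Fin N)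
    (T : Fin ν → ℝ) : D.Solves κ T (D.traj κ T) := by
  obtain ⟨X, hX, -⟩ := exists_trajectory hD κ
  exact Classical.epsilon_spec ⟨X T, hX T⟩

/-- At nonnegative times, the trajectories depend measurably on time, initial point and hop
times. -/
theorem Data.Admissible.measurable_traj (hD : D.Admissible CE M₀)
    (κ : Fin ((ν + 1) / 2) → Fin N) :
    (Measurable fun w : (Phase m × (Fin ν → ℝ)) × ℝ =>
      (D.traj κ w.1.2).Q (max w.2 0) w.1.1) ∧
    (Measurable fun w : (Phase m × (Fin ν → ℝ)) × ℝ =>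
      (D.traj κ w.1.2).P (max w.2 0) w.1.1) ∧
    (Measurable fun w : (Phase m × (Fin ν → ℝ)) × ℝ =>
      (D.traj κ w.1.2).S (max w.2 0) w.1.1) ∧
    (Measurable fun w : (Phase m × (Fin ν → ℝ)) × ℝ =>
      (D.traj κ w.1.2).A (max w.2 0) w.1.1) ∧
    (∀ T z s, 0 ≤ s → ‖(D.traj κ T).A s z‖ ≤ ‖D.initialAmp z‖ * ampBound m CE s) := by
  obtain ⟨X, hX, hQ, hP, hS, hA, hb, hc⟩ := exists_trajectory hD κ
  -- `traj` is selected separately for each `T`, which says nothing about measurability. Uniqueness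
  -- identifies it, at nonnegative times only, with the jointly measurable family `X`; hence the
  -- truncations `max w.2 0`.
  have heq := fun (T : Fin ν → ℝ) (z : Phase m) (s : ℝ) (hs : 0 ≤ s) =>
    (hX T).eq_of_bounded hD (hD.solves_traj κ T) (hc T) hs z
  have hm : Measurable fun w : (Phase m × (Fin ν → ℝ)) × ℝ => (w.1, max w.2 0) :=
    measurable_fst.prodMk (measurable_snd.max measurable_const)
  refine ⟨?_, ?_, ?_, ?_, fun T z s hs => ?_⟩
  · convert hQ.comp hm using 2 with w
    exact (heq _ _ _ (le_max_right _ _)).1.symm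
  · convert hP.comp hm using 2 with w
    exact (heq _ _ _ (le_max_right _ _)).2.1.symm
  · convert hS.comp hm using 2 with w
    exact (heq _ _ _ (le_max_right _ _)).2.2.1.symm
  · convert hA.comp hm using 2 with w
    exact (heq _ _ _ (le_max_right _ _)).2.2.2.symm
  · rw [← (heq T z s hs).2.2.2]
    exact hb T z s hs

end Trajectories

end FGS
end

noncomputable section

namespace FGS

open Set Filter Topology NNReal

/-! ### The initial amplitude -/

section InitialAmplitude

variable {m : ℕ} {D : Data m} {CE M₀ : ℝ}

theorem integral_pos_eq {F : Type*} [NormedAddCommGroup F] [NormedSpace ℝ F] (f : Pos m → F) :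
    ∫ y, f y = ∫ v : Fin m → ℝ, f (WithLp.toLp 2 v) :=
  ((EuclideanSpace.volume_preserving_symm_measurableEquiv_toLp (Fin m)).symm.integral_comp'
    (g := f)).symm

theorem integrable_pos_iff {F : Type*} [NormedAddCommGroup F] {f : Pos m → F} :
    Integrable f ↔ Integrable fun v : Fin m → ℝ => f (WithLp.toLp 2 v) :=
  ((EuclideanSpace.volume_preserving_symm_measurableEquiv_toLp (Fin m)).symm.integrable_comp_emb
    (MeasurableEquiv.measurableEmbedding _)).symm

theorem integrable_prod_exp {α : Fin m → ℝ} (hα : ∀ j, 0 < α j) (x₀ : Pos m) :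
    Integrable fun x : Pos m => ∏ j, Real.exp (-α j * (x j - x₀ j) ^ 2) := by
  rw [integrable_pos_iff]
  exact Integrable.fintype_prod (f := fun j x => Real.exp (-α j * (x - x₀ j) ^ 2))
    fun j => (integrable_exp_neg_mul_sq (hα j)).comp_sub_right (x₀ j)

theorem integral_prod_exp (α : Fin m → ℝ) (x₀ : Pos m) :
    ∫ x : Pos m, ∏ j, Real.exp (-α j * (x j - x₀ j) ^ 2) = ∏ j, √(Real.pi / α j) := by
  rw [integral_pos_eq]
  simp only
  rw [integral_fintype_prod_volume_eq_prod
    (f := fun j (x : ℝ) => Real.exp (-α j * (x - x₀ j) ^ 2))]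
  refine Finset.prod_congr rfl fun j _ => ?_
  rw [integral_sub_right_eq_self (fun x : ℝ => Real.exp (-α j * x ^ 2)) (x₀ j), integral_gaussian]

/-- The constant in front of the Gaussian `|A₀|`. -/
def Data.ampConst (D : Data m) : ℝ :=
  (2 : ℝ) ^ ((m : ℝ) / 2) * ((∏ j, D.a j) ^ (1 / 4 : ℝ) * (Real.pi * D.ε) ^ (-(m : ℝ) / 4)) *
    ∏ j, √(2 * Real.pi * D.ε / (1 + D.a j))

theorem Data.Admissible.ampConst_pos (hD : D.Admissible CE M₀) : 0 < D.ampConst := by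
  have hε := hD.ε_pos
  have hp : 0 < ∏ j, D.a j := Finset.prod_pos fun j _ => hD.a_pos j
  have hs : 0 < ∏ j, √(2 * Real.pi * D.ε / (1 + D.a j)) := Finset.prod_pos fun j _ => by
    have := hD.a_pos j
    positivity
  unfold Data.ampConst
  positivity

/-- The integral factorizes over the coordinates. In each of them the widths `a` and `1` add up to a
Gaussian of width `1 + a`, and completing the square leaves a Gaussian in `q` about `qt` and one in
`p` about `pt`; the phases have modulus `1`. -/
theorem Data.Admissible.norm_initialAmp (hD : D.Admissible CE M₀) (z : Phase m) :
    ‖D.initialAmp z‖ = D.ampConst *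
      ((∏ j, Real.exp (-(D.a j / (2 * D.ε * (1 + D.a j))) * (z.1 j - D.qt j) ^ 2)) *
        ∏ j, Real.exp (-(1 / (2 * D.ε * (1 + D.a j))) * (z.2 j - D.pt j) ^ 2)) := by
  have hε := hD.ε_pos
  have hεc : (D.ε : ℂ) ≠ 0 := by exact_mod_cast hε.ne'
  -- In the coordinate `j`, with integration variable `v`, the total exponent is `b v² + c v + d`.
  set b : Fin m → ℂ := fun j => ((-((1 + D.a j) / (2 * D.ε)) : ℝ) : ℂ) with hb
  set c : Fin m → ℂ := fun j =>
    (((D.a j * D.qt j + z.1 j) / D.ε : ℝ) : ℂ) + Complex.I * (((D.pt j - z.2 j) / D.ε : ℝ) : ℂ)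
    with hc
  set d : Fin m → ℂ := fun j =>
    ((-(D.a j * D.qt j ^ 2 + z.1 j ^ 2) / (2 * D.ε) : ℝ) : ℂ) +
      Complex.I * (((z.2 j * z.1 j - D.pt j * D.qt j) / D.ε : ℝ) : ℂ) with hd
  have hb0 : ∀ j, (b j).re < 0 := fun j => by
    have := hD.a_pos j
    simp only [hb, Complex.ofReal_re, Left.neg_neg_iff]
    positivity
  have hint : ∀ v : Fin m → ℝ, D.initialWave (WithLp.toLp 2 v) * Complex.exp (Complex.I / D.ε *
        (-((inner ℝ z.2 (WithLp.toLp 2 v - z.1) : ℝ) : ℂ) +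
          Complex.I / 2 * ((‖WithLp.toLp 2 v - z.1‖ ^ 2 : ℝ) : ℂ))) =
      (((∏ j, D.a j) ^ (1 / 4 : ℝ) * (Real.pi * D.ε) ^ (-(m : ℝ) / 4) : ℝ) : ℂ) *
        ∏ j, Complex.exp (b j * (v j : ℂ) ^ 2 + c j * v j + d j) := by
    intro v
    rw [Data.initialWave, ← Complex.exp_sum, mul_assoc, mul_assoc, ← Complex.exp_add,
      ← Complex.exp_add]
    congr 2
    rw [EuclideanSpace.norm_sq_eq]
    simp only [PiLp.inner_apply, RCLike.inner_apply, conj_trivial, Real.norm_eq_abs, sq_abs,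
      PiLp.sub_apply, Complex.ofReal_sum, Finset.mul_sum, ← Finset.sum_neg_distrib]
    rw [← Finset.sum_add_distrib, Finset.mul_sum, ← Finset.sum_add_distrib,
      ← Finset.sum_add_distrib]
    refine Finset.sum_congr rfl fun j _ => ?_
    simp only [hb, hc, hd]
    push_cast
    field_simp
    ring_nf
    simp only [Complex.I_sq]
    ring
  have hval : D.initialAmp z = (((2 : ℝ) ^ ((m : ℝ) / 2) : ℝ) : ℂ) *
      ((((∏ j, D.a j) ^ (1 / 4 : ℝ) * (Real.pi * D.ε) ^ (-(m : ℝ) / 4) : ℝ) : ℂ) *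
        ∏ j, ((Real.pi / -b j) ^ (1 / 2 : ℂ) * Complex.exp (d j - c j ^ 2 / (4 * b j)))) := by
    rw [Data.initialAmp, integral_pos_eq]
    simp_rw [hint]
    rw [integral_const_mul, integral_fintype_prod_volume_eq_prod
      (f := fun j (x : ℝ) => Complex.exp (b j * (x : ℂ) ^ 2 + c j * x + d j))]
    congr 2
    exact Finset.prod_congr rfl fun j _ => integral_cexp_quadratic (hb0 j) _ _
  have hfac : ∀ j, ‖(Real.pi / -b j) ^ (1 / 2 : ℂ) * Complex.exp (d j - c j ^ 2 / (4 * b j))‖ =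
      √(2 * Real.pi * D.ε / (1 + D.a j)) *
        (Real.exp (-(D.a j / (2 * D.ε * (1 + D.a j))) * (z.1 j - D.qt j) ^ 2) *
        Real.exp (-(1 / (2 * D.ε * (1 + D.a j))) * (z.2 j - D.pt j) ^ 2)) := by
    intro j
    have ha := hD.a_pos j
    have h1 : (Real.pi : ℂ) / -b j = ((2 * Real.pi * D.ε / (1 + D.a j) : ℝ) : ℂ) := by
      simp only [hb]
      have : (1 + D.a j : ℂ) ≠ 0 := by exact_mod_cast (by positivity : (1 + D.a j : ℝ) ≠ 0)
      push_cast
      field_simp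
    have h2 : (1 / 2 : ℂ) = (((1 / 2 : ℝ)) : ℂ) := by push_cast; ring
    rw [norm_mul, h1, h2, ← Complex.ofReal_cpow (by positivity), Complex.norm_real,
      Real.norm_of_nonneg (by positivity), ← Real.sqrt_eq_rpow, Complex.norm_exp, ← Real.exp_add]
    congr 2
    have h3 : d j - c j ^ 2 / (4 * b j) = d j + c j ^ 2 * ((D.ε / (2 * (1 + D.a j)) : ℝ) : ℂ) := by
      simp only [hb]
      have : (1 + D.a j : ℂ) ≠ 0 := by exact_mod_cast (by positivity : (1 + D.a j : ℝ) ≠ 0)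
      push_cast
      field_simp
      ring
    rw [h3, Complex.add_re, Complex.re_mul_ofReal, sq]
    simp only [hc, hd, Complex.add_re, Complex.mul_re, Complex.ofReal_re, Complex.I_re,
      Complex.I_im, Complex.ofReal_im, Complex.add_im, Complex.mul_im]
    field_simp
    ring
  rw [hval, norm_mul, norm_mul, Complex.norm_real, Complex.norm_real, norm_prod,
    Finset.prod_congr rfl fun j _ => hfac j, Finset.prod_mul_distrib, Finset.prod_mul_distrib,
    Data.ampConst]
  have hp : 0 < ∏ j, D.a j := Finset.prod_pos fun j _ => hD.a_pos j
  rw [Real.norm_of_nonneg (by positivity), Real.norm_of_nonneg (by positivity)]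
  ring

theorem Data.Admissible.norm_initialAmp_pos (hD : D.Admissible CE M₀) (z : Phase m) :
    0 < ‖D.initialAmp z‖ := by
  rw [hD.norm_initialAmp]
  exact mul_pos hD.ampConst_pos (mul_pos (Finset.prod_pos fun j _ => Real.exp_pos _)
    (Finset.prod_pos fun j _ => Real.exp_pos _))

theorem Data.Admissible.integrable_norm_initialAmp (hD : D.Admissible CE M₀) :
    Integrable fun z : Phase m => ‖D.initialAmp z‖ := by
  simp_rw [hD.norm_initialAmp]
  have hε := hD.ε_pos
  refine Integrable.const_mul ?_ _
  refine Integrable.mul_prod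
    (f := fun q : Pos m => ∏ j, Real.exp (-(D.a j / (2 * D.ε * (1 + D.a j))) * (q j - D.qt j) ^ 2))
    (g := fun p : Pos m => ∏ j, Real.exp (-(1 / (2 * D.ε * (1 + D.a j))) * (p j - D.pt j) ^ 2))
    (integrable_prod_exp (fun j => ?_) _) (integrable_prod_exp (fun j => ?_) _) <;>
  · have := hD.a_pos j
    positivity

/-- In each coordinate the integrals over `q` and `p` give `2πε(1+a)/√a`. Together with `a^{1/4}`
and `√(2πε/(1+a))` from `ampConst` this is `(2πε)^{3/2} ((1+a)/√a)^{1/2}`. -/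
theorem Data.Admissible.integral_norm_initialAmp (hD : D.Admissible CE M₀) :
    ∫ z : Phase m, ‖D.initialAmp z‖ = (2 : ℝ) ^ ((m : ℝ) / 2) * (Real.pi * D.ε) ^ (-(m : ℝ) / 4) *
      (2 * Real.pi * D.ε) ^ (3 * (m : ℝ) / 2) *
      ∏ j, ((1 + D.a j) / √(D.a j)) ^ (1 / 2 : ℝ) := by
  have hε := hD.ε_pos
  simp_rw [hD.norm_initialAmp]
  rw [integral_const_mul]
  have h1 := integral_prod_mul (μ := (volume : Measure (Pos m))) (ν := (volume : Measure (Pos m)))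
    (fun q : Pos m => ∏ j, Real.exp (-(D.a j / (2 * D.ε * (1 + D.a j))) * (q j - D.qt j) ^ 2))
    (fun p : Pos m => ∏ j, Real.exp (-(1 / (2 * D.ε * (1 + D.a j))) * (p j - D.pt j) ^ 2))
  rw [Measure.volume_eq_prod, h1, integral_prod_exp, integral_prod_exp, Data.ampConst,
    ← Real.finsetProd_rpow _ _ (fun j _ => (hD.a_pos j).le)]
  have h2 : (2 * Real.pi * D.ε) ^ (3 * (m : ℝ) / 2) =
      ∏ _j : Fin m, √(2 * Real.pi * D.ε) ^ 3 := by
    rw [Finset.prod_const, Finset.card_univ, Fintype.card_fin, Real.sqrt_eq_rpow,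
      ← Real.rpow_natCast, ← Real.rpow_natCast, ← Real.rpow_mul (by positivity),
      ← Real.rpow_mul (by positivity)]
    congr 1
    push_cast
    ring
  have h3 : (∏ j, D.a j ^ (1 / 4 : ℝ)) * (∏ j, √(2 * Real.pi * D.ε / (1 + D.a j))) *
      ((∏ j, √(Real.pi / (D.a j / (2 * D.ε * (1 + D.a j))))) *
        ∏ j, √(Real.pi / (1 / (2 * D.ε * (1 + D.a j))))) =
      (∏ _j : Fin m, √(2 * Real.pi * D.ε) ^ 3) * ∏ j, ((1 + D.a j) / √(D.a j)) ^ (1 / 2 : ℝ) := by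
    rw [← Finset.prod_mul_distrib, ← Finset.prod_mul_distrib, ← Finset.prod_mul_distrib,
      ← Finset.prod_mul_distrib]
    refine Finset.prod_congr rfl fun j _ => ?_
    have ha := hD.a_pos j
    -- With `w = a^{1/4}`, `s = √(2πε)` and `u = √(1+a)`, every root becomes a rational expression
    -- and the identity is plain algebra.
    obtain ⟨w, hw, hwa⟩ : ∃ w : ℝ, 0 < w ∧ D.a j = w ^ 4 :=
      ⟨D.a j ^ (1 / 4 : ℝ), by positivity, by
        rw [← Real.rpow_natCast, ← Real.rpow_mul ha.le]; norm_num⟩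
    obtain ⟨s, hs, hsa⟩ : ∃ s : ℝ, 0 < s ∧ 2 * Real.pi * D.ε = s ^ 2 :=
      ⟨√(2 * Real.pi * D.ε), by positivity, by rw [Real.sq_sqrt (by positivity)]⟩
    obtain ⟨u, hu, hua⟩ : ∃ u : ℝ, 0 < u ∧ 1 + D.a j = u ^ 2 :=
      ⟨√(1 + D.a j), by positivity, by rw [Real.sq_sqrt (by positivity)]⟩
    have e1 : D.a j ^ (1 / 4 : ℝ) = w := by
      rw [hwa, ← Real.rpow_natCast, ← Real.rpow_mul hw.le]; norm_num
    have e2 : √(D.a j) = w ^ 2 := by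
      rw [hwa, show w ^ 4 = (w ^ 2) ^ 2 by ring, Real.sqrt_sq (by positivity)]
    have e3 : √(2 * Real.pi * D.ε / (1 + D.a j)) = s / u := by
      rw [hsa, hua, ← div_pow, Real.sqrt_sq (by positivity)]
    have e4 : √(Real.pi / (D.a j / (2 * D.ε * (1 + D.a j)))) = s * u / w ^ 2 := by
      rw [show Real.pi / (D.a j / (2 * D.ε * (1 + D.a j))) = (s * u / w ^ 2) ^ 2 by
        rw [div_pow, mul_pow, ← hsa, ← hua, ← pow_mul, ← hwa]; field_simp]
      exact Real.sqrt_sq (by positivity)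
    have e5 : √(Real.pi / (1 / (2 * D.ε * (1 + D.a j)))) = s * u := by
      rw [show Real.pi / (1 / (2 * D.ε * (1 + D.a j))) = (s * u) ^ 2 by
        rw [mul_pow, ← hsa, ← hua]; field_simp]
      exact Real.sqrt_sq (by positivity)
    have e6 : ((1 + D.a j) / √(D.a j)) ^ (1 / 2 : ℝ) = u / w := by
      rw [e2, hua, ← div_pow, ← Real.sqrt_eq_rpow, Real.sqrt_sq (by positivity)]
    have e7 : √(2 * Real.pi * D.ε) = s := by rw [hsa, Real.sqrt_sq hs.le]
    rw [e1, e3, e4, e5, e6, e7]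
    field_simp
  rw [h2]
  linear_combination (2 : ℝ) ^ ((m : ℝ) / 2) * (Real.pi * D.ε) ^ (-(m : ℝ) / 4) * h3

end InitialAmplitude

end FGS
end

noncomputable section

namespace FGS

open Set Filter Topology NNReal ENNReal

/-! ### Appending a hop to a history -/

section Snoc

variable {ν N : ℕ}

/-- The time of the last hop, `0` if there is none. -/
def lastTime : ∀ {ν : ℕ}, (Fin ν → ℝ) → ℝ
  | 0, _ => 0
  | n + 1, T => T (Fin.last n)

theorem measurable_lastTime : Measurable (lastTime (ν := ν)) := by
  cases ν with
  | zero => exact measurable_const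
  | succ n => exact measurable_pi_apply _

theorem measurableSet_hopTimes (ν : ℕ) (t : ℝ) : MeasurableSet (hopTimes ν t) := by
  have h1 : hopTimes ν t = (⋂ i : Fin ν, ⋂ j : Fin ν, ⋂ _ : i < j, {T | T i < T j}) ∩
      ⋂ i : Fin ν, {T | T i ∈ Ioo 0 t} := by
    ext T
    simp [hopTimes, StrictMono]
  rw [h1]
  refine MeasurableSet.inter ?_ ?_
  · exact MeasurableSet.iInter fun i => MeasurableSet.iInter fun j => MeasurableSet.iInter fun _ =>
      measurableSet_lt (measurable_pi_apply i) (measurable_pi_apply j)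
  · exact MeasurableSet.iInter fun i => measurable_pi_apply i measurableSet_Ioo

/-- Slices the simplex by its last time: for given last time `s`, the earlier times fill the simplex
up to `s`. This yields the volume recursion. -/
theorem snoc_mem_hopTimes_iff {T : Fin ν → ℝ} {s t : ℝ} :
    (Fin.snoc T s : Fin (ν + 1) → ℝ) ∈ hopTimes (ν + 1) t ↔ T ∈ hopTimes ν s ∧ s ∈ Ioo 0 t := by
  constructor
  · rintro ⟨hm, ht⟩
    have hlast : s ∈ Ioo 0 t := by simpa using ht (Fin.last ν)
    refine ⟨⟨fun i j hij => ?_, fun i => ⟨?_, ?_⟩⟩, hlast⟩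
    · simpa using hm (Fin.castSucc_lt_castSucc_iff.2 hij)
    · simpa using (ht i.castSucc).1
    · simpa using hm (Fin.castSucc_lt_last i)
  · rintro ⟨⟨hm, ht⟩, hs⟩
    refine ⟨?_, fun i => ?_⟩
    · intro i j
      refine Fin.lastCases ?_ (fun j => ?_) j
      · refine Fin.lastCases (fun h => absurd h (lt_irrefl _)) (fun i _ => ?_) i
        simpa using (ht i).2
      · refine Fin.lastCases (fun h => absurd h (not_lt.2 (Fin.le_last _))) (fun i h => ?_) i
        simpa using hm (Fin.castSucc_lt_castSucc_iff.1 h)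
    · refine Fin.lastCases (by simpa using hs) (fun i => ?_) i
      simpa using ⟨(ht i).1, (ht i).2.trans hs.2⟩

theorem lastTime_nonneg {T : Fin ν → ℝ} {t : ℝ} (hT : T ∈ hopTimes ν t) : 0 ≤ lastTime T := by
  cases ν with
  | zero => exact le_rfl
  | succ n => exact (hT.2 _).1.le

theorem lastTime_le {T : Fin ν → ℝ} {t : ℝ} (ht : 0 ≤ t) (hT : T ∈ hopTimes ν t) :
    lastTime T ≤ t := by
  cases ν with
  | zero => exact ht
  | succ n => exact (hT.2 _).2.le

theorem le_lastTime {T : Fin ν → ℝ} {t : ℝ} (hT : T ∈ hopTimes ν t) (i : Fin ν) :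
    T i ≤ lastTime T := by
  cases ν with
  | zero => exact i.elim0
  | succ n => exact hT.1.monotone (Fin.le_last i)

/-- The opposite slicing: for given earlier times, the new time runs from the last of them to `t`.
This one serves to integrate out the last hop. -/
theorem hopTimes_iff_lastTime {T : Fin ν → ℝ} {s t : ℝ} :
    T ∈ hopTimes ν s ∧ s ∈ Ioo 0 t ↔ T ∈ hopTimes ν t ∧ s ∈ Ioo (lastTime T) t := by
  constructor
  · rintro ⟨hT, hs⟩
    refine ⟨⟨hT.1, fun i => ⟨(hT.2 i).1, (hT.2 i).2.trans hs.2⟩⟩, ?_, hs.2⟩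
    cases ν with
    | zero => exact hs.1
    | succ n => exact (hT.2 _).2
  · rintro ⟨hT, hs⟩
    exact ⟨⟨hT.1, fun i => ⟨(hT.2 i).1, (le_lastTime hT i).trans_lt hs.1⟩⟩,
      (lastTime_nonneg hT).trans_lt hs.1, hs.2⟩

theorem measurable_snoc : Measurable fun w : (Fin ν → ℝ) × ℝ =>
    (Fin.snoc w.1 w.2 : Fin (ν + 1) → ℝ) := by
  refine measurable_pi_iff.2 fun i => ?_
  refine Fin.lastCases ?_ (fun i => ?_) i
  · simpa using measurable_snd
  · simp only [Fin.snoc_castSucc]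
    exact (measurable_pi_apply i).comp measurable_fst

theorem lintegral_snoc (g : (Fin (ν + 1) → ℝ) → ℝ≥0∞) :
    ∫⁻ T', g T' = ∫⁻ w : (Fin ν → ℝ) × ℝ, g (Fin.snoc w.1 w.2) := by
  have h1 := (volume_preserving_piFinSuccAbove (fun _ : Fin (ν + 1) => ℝ) (Fin.last ν)).symm
  rw [← h1.lintegral_comp_emb (MeasurableEquiv.measurableEmbedding _)]
  rw [Measure.volume_eq_prod, ← lintegral_prod_swap]
  refine lintegral_congr fun w => ?_
  congr 1
  exact Fin.insertNth_last' _ _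

theorem setLIntegral_hopTimes_succ {g : (Fin (ν + 1) → ℝ) → ℝ≥0∞} (hg : Measurable g) (t : ℝ) :
    ∫⁻ T' in hopTimes (ν + 1) t, g T' =
      ∫⁻ T in hopTimes ν t, ∫⁻ s in Ioo (lastTime T) t, g (Fin.snoc T s) := by
  have hm : Measurable fun w : (Fin ν → ℝ) × ℝ =>
      (hopTimes (ν + 1) t).indicator g (Fin.snoc w.1 w.2) :=
    (hg.indicator (measurableSet_hopTimes (ν + 1) t)).comp measurable_snoc
  rw [← lintegral_indicator (measurableSet_hopTimes _ _),
    lintegral_snoc, Measure.volume_eq_prod,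
    lintegral_prod _ hm.aemeasurable, ← lintegral_indicator (measurableSet_hopTimes _ _)]
  refine lintegral_congr fun T => ?_
  by_cases hT : T ∈ hopTimes ν t
  · rw [indicator_of_mem hT, ← lintegral_indicator measurableSet_Ioo]
    refine lintegral_congr fun s => ?_
    by_cases hs : s ∈ Ioo (lastTime T) t
    · rw [indicator_of_mem hs, indicator_of_mem
        (snoc_mem_hopTimes_iff.2 (hopTimes_iff_lastTime.2 ⟨hT, hs⟩))]
    · rw [indicator_of_notMem hs, indicator_of_notMem fun h => hs
        (hopTimes_iff_lastTime.1 (snoc_mem_hopTimes_iff.1 h)).2]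
  · rw [indicator_of_notMem hT]
    refine (lintegral_congr fun s => ?_).trans lintegral_zero
    rw [indicator_of_notMem fun h => hT
        (hopTimes_iff_lastTime.1 (snoc_mem_hopTimes_iff.1 h)).1]

/-- Integrating the volume bound for `n` hops before `s` over the last time `s` raises the power and
supplies the next factor of the factorial. -/
theorem volume_hopTimes_le (ν : ℕ) {t : ℝ} (ht : 0 ≤ t) :
    volume (hopTimes ν t) ≤ ENNReal.ofReal (t ^ ν / ν.factorial) := by
  induction ν generalizing t with
  | zero =>
    refine (measure_mono (subset_univ _)).trans ?_
    simp [volume_pi]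
  | succ n ih =>
    have hm : Measurable fun w : (Fin n → ℝ) × ℝ =>
        (hopTimes (n + 1) t).indicator (fun _ => (1 : ℝ≥0∞)) (Fin.snoc w.1 w.2) :=
      (measurable_const.indicator (measurableSet_hopTimes (n + 1) t)).comp measurable_snoc
    calc volume (hopTimes (n + 1) t)
        = ∫⁻ T', (hopTimes (n + 1) t).indicator (fun _ => (1 : ℝ≥0∞)) T' := by
          rw [lintegral_indicator (measurableSet_hopTimes _ _)]; simp
      _ = ∫⁻ s, ∫⁻ T, (hopTimes (n + 1) t).indicator (fun _ => (1 : ℝ≥0∞)) (Fin.snoc T s) := by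
          rw [lintegral_snoc,
            Measure.volume_eq_prod, lintegral_prod_symm _ hm.aemeasurable]
      _ ≤ ∫⁻ s, (Ioc 0 t).indicator (fun s => ENNReal.ofReal (s ^ n / n.factorial)) s := by
          refine lintegral_mono fun s => ?_
          by_cases hs : s ∈ Ioo 0 t
          · rw [indicator_of_mem (Ioo_subset_Ioc_self hs)]
            refine le_trans (le_of_eq ?_) (ih hs.1.le)
            calc ∫⁻ T, (hopTimes (n + 1) t).indicator (fun _ => (1 : ℝ≥0∞)) (Fin.snoc T s)
                = ∫⁻ T, (hopTimes n s).indicator (fun _ => (1 : ℝ≥0∞)) T := by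
                  refine lintegral_congr fun T => ?_
                  by_cases hT : T ∈ hopTimes n s
                  · rw [indicator_of_mem hT, indicator_of_mem (snoc_mem_hopTimes_iff.2 ⟨hT, hs⟩)]
                  · rw [indicator_of_notMem hT, indicator_of_notMem fun h => hT
                      (snoc_mem_hopTimes_iff.1 h).1]
              _ = volume (hopTimes n s) := by
                  rw [lintegral_indicator (measurableSet_hopTimes _ _)]; simp
          · refine le_of_eq_of_le ((lintegral_congr fun T => ?_).trans lintegral_zero) zero_le
            rw [indicator_of_notMem fun h => hs (snoc_mem_hopTimes_iff.1 h).2]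
      _ = ENNReal.ofReal (∫ s in Ioc 0 t, s ^ n / n.factorial) := by
          rw [lintegral_indicator measurableSet_Ioc,
            ofReal_integral_eq_lintegral_ofReal (Continuous.integrableOn_Ioc (by fun_prop))]
          filter_upwards [ae_restrict_mem measurableSet_Ioc] with s hs
          have := hs.1.le
          positivity
      _ = _ := by
          rw [← intervalIntegral.integral_of_le ht, intervalIntegral.integral_div, integral_pow]
          congr 1
          rw [Nat.factorial_succ]
          push_cast
          field_simp
          simp

theorem hopCount_eq_sum (T : Fin ν → ℝ) (s : ℝ) :
    hopCount T s = ∑ i, if T i ≤ s then 1 else 0 := by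
  rw [hopCount, Finset.card_filter]

theorem hopCount_le (T : Fin ν → ℝ) (s : ℝ) : hopCount T s ≤ ν :=
  (Finset.card_filter_le _ _).trans (by simp)

theorem hopCount_snoc {T : Fin ν → ℝ} {s r : ℝ} (hr : r < s) :
    hopCount (Fin.snoc T s : Fin (ν + 1) → ℝ) r = hopCount T r := by
  rw [hopCount_eq_sum, hopCount_eq_sum, Fin.sum_univ_castSucc]
  simp [not_le.2 hr]

theorem hopCount_of_lastTime_le {T : Fin ν → ℝ} {s t : ℝ} (hT : T ∈ hopTimes ν t)
    (hs : lastTime T ≤ s) : hopCount T s = ν := by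
  rw [hopCount, Finset.filter_true_of_mem fun i _ => (le_lastTime hT i).trans hs]
  simp

/-- The orbitals that are visited within the first `ν` of `ν + 1` hops. -/
def initOrbitals (κ : Fin ((ν + 1 + 1) / 2) → Fin N) : Fin ((ν + 1) / 2) → Fin N :=
  fun i => κ ⟨i, by omega⟩

theorem stateAfter_initOrbitals (κ : Fin ((ν + 1 + 1) / 2) → Fin N) {i : ℕ} (hi : i ≤ ν) :
    stateAfter κ i = stateAfter (initOrbitals κ) i := by
  unfold stateAfter
  by_cases h : i % 2 = 1
  · have h1 : i / 2 < (ν + 1) / 2 := by omega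
    have h2 : i / 2 < (ν + 1 + 1) / 2 := by omega
    rw [dif_pos ⟨h, h2⟩, dif_pos ⟨h, h1⟩]
    rfl
  · rw [dif_neg fun h' => h h'.1, dif_neg fun h' => h h'.1]

/-- The inequality must be strict: a hop at time `s` already counts at `s`. -/
theorem surfaceAt_snoc (κ : Fin ((ν + 1 + 1) / 2) → Fin N) {T : Fin ν → ℝ} {s r : ℝ} (hr : r < s) :
    surfaceAt κ (Fin.snoc T s : Fin (ν + 1) → ℝ) r = surfaceAt (initOrbitals κ) T r := by
  rw [surfaceAt_eq, surfaceAt_eq, hopCount_snoc hr, stateAfter_initOrbitals κ (hopCount_le T r)]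

/-- Summation over the orbitals of a history with one more hop. -/
theorem sum_orbitals_succ {β : Type*} [AddCommMonoid β]
    (f : (Fin ((ν + 1) / 2) → Fin N) → Option (Fin N) → β)
    (h0 : ν % 2 = 0 → ∀ κ, f κ none = 0) (h1 : ν % 2 = 1 → ∀ κ k, f κ (some k) = 0) :
    ∑ κ : Fin ((ν + 1 + 1) / 2) → Fin N, f (initOrbitals κ) (stateAfter κ (ν + 1)) =
      ∑ κ, ∑ l, f κ l := by
  rcases Nat.mod_two_eq_zero_or_one ν with hν | hν
  -- For even `ν` the new hop leaves the molecule and visits a new orbital, so `κ` gains one entry,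
  -- which serves as the target.
  · have hst : ∀ κ : Fin ((ν + 1 + 1) / 2) → Fin N,
        stateAfter κ (ν + 1) = some (κ ⟨(ν + 1) / 2, by omega⟩) := fun κ => by
      unfold stateAfter
      rw [dif_pos ⟨by omega, by omega⟩]
    let e : (Fin ((ν + 1 + 1) / 2) → Fin N) ≃ (Fin ((ν + 1) / 2) → Fin N) × Fin N :=
      { toFun := fun κ => (initOrbitals κ, κ ⟨(ν + 1) / 2, by omega⟩)
        invFun := fun w i => if hi : (i : ℕ) < (ν + 1) / 2 then w.1 ⟨i, hi⟩ else w.2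
        left_inv := fun κ => by
          funext i
          by_cases hi : (i : ℕ) < (ν + 1) / 2
          · simp [hi, initOrbitals]
          · have : (ν + 1) / 2 = (i : ℕ) := by have := i.2; omega
            simp [this]
        right_inv := fun w => by
          refine Prod.ext ?_ ?_
          · funext i
            simp [initOrbitals]
          · simp }
    calc ∑ κ : Fin ((ν + 1 + 1) / 2) → Fin N, f (initOrbitals κ) (stateAfter κ (ν + 1))
        = ∑ w : (Fin ((ν + 1) / 2) → Fin N) × Fin N, f w.1 (some w.2) :=
          Fintype.sum_equiv e _ _ fun κ => by rw [hst κ]; rfl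
      _ = ∑ κ, ∑ k, f κ (some k) := Fintype.sum_prod_type _
      _ = _ := by
          refine Finset.sum_congr rfl fun κ _ => ?_
          rw [Fintype.sum_option, h0 hν, zero_add]
  -- For odd `ν` the new hop returns to the molecule; the list of orbitals keeps its length, and
  -- `none` is the only target.
  · have hst : ∀ κ : Fin ((ν + 1 + 1) / 2) → Fin N, stateAfter κ (ν + 1) = none := fun κ => by
      unfold stateAfter
      rw [dif_neg (by omega)]
    let e : (Fin ((ν + 1 + 1) / 2) → Fin N) ≃ (Fin ((ν + 1) / 2) → Fin N) :=
      { toFun := initOrbitals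
        invFun := fun κ i => κ ⟨i, by have := i.2; omega⟩
        left_inv := fun κ => rfl
        right_inv := fun κ => rfl }
    calc ∑ κ : Fin ((ν + 1 + 1) / 2) → Fin N, f (initOrbitals κ) (stateAfter κ (ν + 1))
        = ∑ κ, f κ none := Fintype.sum_equiv e _ _ fun κ => by rw [hst κ]; rfl
      _ = _ := by
          refine Finset.sum_congr rfl fun κ _ => ?_
          rw [Fintype.sum_option, Finset.sum_eq_zero fun k _ => h1 hν κ k, add_zero]

theorem stateAfter_even (κ : Fin ((ν + 1) / 2) → Fin N) {i : ℕ} (hi : i % 2 = 0) :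
    stateAfter κ i = none := by
  unfold stateAfter
  rw [dif_neg (by omega)]

theorem exists_stateAfter_odd (κ : Fin ((ν + 1) / 2) → Fin N) {i : ℕ} (hi : i % 2 = 1)
    (hν : i ≤ ν) : ∃ k, stateAfter κ i = some k := by
  unfold stateAfter
  rw [dif_pos ⟨hi, by omega⟩]
  exact ⟨_, rfl⟩

end Snoc

/-! ### The survival probability of a jump process -/

/-- Formally the integrand is minus the derivative of `e^{-L}`. As `f` is merely measurable, this
holds only almost everywhere, but `e^{-L}` is Lipschitz, hence absolutely continuous, and the
fundamental theorem still applies. -/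
theorem lintegral_rate_mul_exp_neg {f : ℝ → ℝ} {R a t : ℝ} (hf : Measurable f)
    (hf0 : ∀ s, 0 ≤ f s) (hfR : ∀ s, f s ≤ R) (ha : 0 ≤ a) (hat : a ≤ t) :
    ∫⁻ s in Ioo a t, ENNReal.ofReal (Real.exp (-∫ r in (0 : ℝ)..s, f r) * f s) =
      ENNReal.ofReal (Real.exp (-∫ r in (0 : ℝ)..a, f r) - Real.exp (-∫ r in (0 : ℝ)..t, f r)) := by
  have hfi : ∀ u v : ℝ, IntervalIntegrable f volume u v := fun u v => by
    refine intervalIntegrable_iff.2 (Measure.integrableOn_of_bounded (M := R) (by simp)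
      hf.aestronglyMeasurable (ae_of_all _ fun s => ?_))
    rw [Real.norm_of_nonneg (hf0 s)]
    exact hfR s
  set L : ℝ → ℝ := fun s => ∫ r in (0 : ℝ)..s, f r with hL
  have hR : 0 ≤ R := (hf0 0).trans (hfR 0)
  have hLd : ∀ u v, u ≤ v → 0 ≤ L v - L u ∧ L v - L u ≤ R * (v - u) := by
    intro u v huv
    have h1 : L v - L u = ∫ r in u..v, f r :=
      intervalIntegral.integral_interval_sub_left (hfi _ _) (hfi _ _)
    rw [h1]
    refine ⟨intervalIntegral.integral_nonneg huv fun r _ => hf0 r, ?_⟩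
    calc ∫ r in u..v, f r ≤ ∫ _r in u..v, R :=
          intervalIntegral.integral_mono_on huv (hfi _ _) (by simp) fun r _ => hfR r
      _ = R * (v - u) := by simp; ring
  have hL0 : ∀ s, 0 ≤ s → 0 ≤ L s := fun s hs =>
    intervalIntegral.integral_nonneg hs fun r _ => hf0 r
  have hLc : Continuous L := intervalIntegral.continuous_primitive hfi 0
  set g : ℝ → ℝ := fun s => Real.exp (-L s) with hg
  have hlip0 : ∀ u v, 0 ≤ u → u ≤ v → |g u - g v| ≤ R * |u - v| := by
    intro u v hu huv
    obtain ⟨h1, h2⟩ := hLd u v huv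
    have h3 : g u - g v = Real.exp (-L u) * (1 - Real.exp (-(L v - L u))) := by
      rw [mul_sub, ← Real.exp_add, mul_one]
      simp only [hg]
      congr 2
      ring
    have h4 := Real.add_one_le_exp (-(L v - L u))
    have h5 : Real.exp (-(L v - L u)) ≤ 1 := Real.exp_le_one_iff.2 (by linarith)
    have h6 : Real.exp (-L u) ≤ 1 := Real.exp_le_one_iff.2 (by have := hL0 u hu; linarith)
    rw [abs_of_nonpos (sub_nonpos.2 huv), h3, abs_of_nonneg
      (mul_nonneg (Real.exp_pos _).le (by linarith))]
    calc Real.exp (-L u) * (1 - Real.exp (-(L v - L u))) ≤ 1 * (L v - L u) := by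
          exact mul_le_mul h6 (by linarith) (by linarith) zero_le_one
      _ ≤ R * -(u - v) := by linarith
  have hlip : LipschitzOnWith ⟨R, hR⟩ g (uIcc a t) := by
    refine LipschitzOnWith.of_dist_le_mul fun u hu v hv => ?_
    rw [uIcc_of_le hat] at hu hv
    rw [Real.dist_eq, Real.dist_eq]
    change _ ≤ R * _
    rcases le_total u v with huv | huv
    · exact hlip0 u v (ha.trans hu.1) huv
    · rw [abs_sub_comm, abs_sub_comm u v]
      exact hlip0 v u (ha.trans hv.1) huv
  have hac := hlip.absolutelyContinuousOnInterval
  have hder : ∀ᵐ s, s ∈ Ioc a t → deriv g s = -(g s * f s) := by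
    filter_upwards [(hfi 0 t).ae_hasDerivAt_integral] with s hs hst
    have h0t : s ∈ uIcc 0 t := by
      rw [uIcc_of_le (ha.trans hat)]; exact ⟨ha.trans hst.1.le, hst.2⟩
    have h1 : HasDerivAt L (f s) s := hs h0t 0 left_mem_uIcc
    have h2 : HasDerivAt g (Real.exp (-L s) * -f s) s := h1.neg.exp
    rw [h2.deriv]
    simp only [hg]
    ring
  have hint : ∫ s in a..t, g s * f s = g a - g t := by
    have h1 := hac.integral_deriv_eq_sub
    rw [intervalIntegral.integral_congr_ae (g := fun s => -(g s * f s)) (by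
      rw [uIoc_of_le hat]; exact hder), intervalIntegral.integral_neg] at h1
    linarith
  have hgi : IntegrableOn (fun s => g s * f s) (Ioo a t) volume := by
    refine Measure.integrableOn_of_bounded (M := 1 * R) (by simp) ?_ ?_
    · exact ((Real.continuous_exp.comp hLc.neg).measurable.mul hf).aestronglyMeasurable
    · filter_upwards [ae_restrict_mem measurableSet_Ioo] with s hs
      rw [norm_mul, Real.norm_of_nonneg (hf0 s), Real.norm_of_nonneg (Real.exp_pos _).le]
      refine mul_le_mul ?_ (hfR s) (hf0 s) zero_le_one
      exact Real.exp_le_one_iff.2 (by have := hL0 s (ha.trans hs.1.le); linarith)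
  rw [← ofReal_integral_eq_lintegral_ofReal hgi
    (ae_of_all _ fun s => mul_nonneg (Real.exp_pos _).le (hf0 s)), ← integral_Ioc_eq_integral_Ioo,
    ← intervalIntegral.integral_of_le hat, hint]

end FGS
end

noncomputable section

namespace FGS

open Set Filter Topology NNReal ENNReal

/-! ### Hop rates -/

section Rates

variable {m N ν : ℕ} {D : Data m} {CE M₀ : ℝ}

theorem Data.Admissible.h_pos (hD : D.Admissible CE M₀) (hN : 0 < N) : 0 < D.h N :=
  div_pos (sub_pos.2 hD.energy_lt) (by exact_mod_cast hN)

theorem Data.natCast_mul_h (D : Data m) (hN : 0 < N) : (N : ℝ) * D.h N = D.Eb - D.Ea := by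
  have : (N : ℝ) ≠ 0 := by exact_mod_cast hN.ne'
  rw [Data.h]; field_simp

theorem Data.Admissible.level_mem (hD : D.Admissible CE M₀) (hN : 0 < N) (k : Fin N) :
    D.level N k ∈ Icc D.Ea D.Eb := by
  have h1 := hD.h_pos hN
  have h2 : ((k : ℕ) : ℝ) + 1 ≤ N := by exact_mod_cast k.2
  have h3 := D.natCast_mul_h hN
  have h4 : (0 : ℝ) ≤ ((k : ℕ) : ℝ) := Nat.cast_nonneg _
  unfold Data.level
  constructor
  · have : 0 ≤ (((k : ℕ) : ℝ) + 1 / 2) * D.h N := by positivity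
    linarith
  · have : (((k : ℕ) : ℝ) + 1 / 2) * D.h N ≤ N * D.h N := by gcongr; linarith
    linarith

/-- A bound for the exit rates. -/
def rateBound (Ea Eb M₀ : ℝ) : ℝ := |M₀| * (1 + (Eb - Ea))

theorem Data.Admissible.rateBound_nonneg (hD : D.Admissible CE M₀) :
    0 ≤ rateBound D.Ea D.Eb M₀ := by
  have := hD.energy_lt
  exact mul_nonneg (abs_nonneg _) (by linarith)

theorem Data.Admissible.norm_V_le (hD : D.Admissible CE M₀) (hN : 0 < N) (k : Fin N) (q : Pos m) :
    ‖D.V (D.level N k) q‖ ≤ |M₀| :=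
  (hD.bound_V _ (hD.level_mem hN k) q).trans (le_abs_self _)

theorem Data.Admissible.hopRate_nonneg (hD : D.Admissible CE M₀) (hN : 0 < N)
    (l l' : Option (Fin N)) (q : Pos m) : 0 ≤ D.hopRate N l l' q := by
  have := (hD.h_pos hN).le
  unfold Data.hopRate
  split <;> positivity

theorem Data.Admissible.exitRate_nonneg (hD : D.Admissible CE M₀) (hN : 0 < N)
    (l : Option (Fin N)) (q : Pos m) : 0 ≤ D.exitRate N l q :=
  Finset.sum_nonneg fun _ _ => hD.hopRate_nonneg hN _ _ _

/-- Uniformity in `N` starts here: the molecule has `N` exits, but each carries the factor `h`, and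
`N h` is the band width. A metal orbital has a single exit. -/
theorem Data.Admissible.exitRate_le (hD : D.Admissible CE M₀) (hN : 0 < N)
    (l : Option (Fin N)) (q : Pos m) : D.exitRate N l q ≤ rateBound D.Ea D.Eb M₀ := by
  have hE := hD.energy_lt
  have hh := (hD.h_pos hN).le
  have h0 := abs_nonneg M₀
  unfold Data.exitRate rateBound
  rw [Fintype.sum_option]
  cases l with
  | none =>
    simp only [Data.hopRate, zero_add]
    calc ∑ k, D.h N * ‖D.V (D.level N k) q‖ ≤ ∑ _k : Fin N, D.h N * |M₀| :=
          Finset.sum_le_sum fun k _ => by gcongr; exact hD.norm_V_le hN k q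
      _ = (N * D.h N) * |M₀| := by simp; ring
      _ ≤ |M₀| * (1 + (D.Eb - D.Ea)) := by rw [D.natCast_mul_h hN]; nlinarith
  | some k =>
    simp only [Data.hopRate, Finset.sum_const_zero, add_zero]
    have := hD.norm_V_le hN k q
    nlinarith [mul_nonneg h0 (sub_pos.2 hE).le]

theorem Data.Admissible.hopRate_le (hD : D.Admissible CE M₀) (hN : 0 < N)
    (l l' : Option (Fin N)) (q : Pos m) : D.hopRate N l l' q ≤ rateBound D.Ea D.Eb M₀ :=
  (Finset.single_le_sum (f := fun l' => D.hopRate N l l' q)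
    (fun _ _ => hD.hopRate_nonneg hN _ _ _) (Finset.mem_univ l')).trans (hD.exitRate_le hN l q)

theorem Data.Admissible.measurable_hopRate (hD : D.Admissible CE M₀) (hN : 0 < N)
    (l l' : Option (Fin N)) : Measurable (D.hopRate N l l') := by
  match l, l' with
  | none, some k => exact ((hD.meas_V _ (hD.level_mem hN k)).norm).const_mul _
  | some k, none => exact (hD.meas_V _ (hD.level_mem hN k)).norm
  | none, none => exact measurable_const
  | some _, some _ => exact measurable_const

theorem Data.Admissible.measurable_hopCoeff (hD : D.Admissible CE M₀) (hN : 0 < N)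
    (l l' : Option (Fin N)) : Measurable (D.hopCoeff N l l') := by
  match l, l' with
  | none, some k =>
    exact (Complex.continuous_conj.measurable.comp (hD.meas_V _ (hD.level_mem hN k))).const_mul _
  | some k, none => exact (hD.meas_V _ (hD.level_mem hN k)).const_mul _
  | none, none => exact measurable_const
  | some _, some _ => exact measurable_const

theorem Data.Admissible.measurable_exitRate (hD : D.Admissible CE M₀) (hN : 0 < N)
    (l : Option (Fin N)) : Measurable (D.exitRate N l) := by
  unfold Data.exitRate
  exact Finset.measurable_sum _ fun l' _ => hD.measurable_hopRate hN l l'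

/-! ### Rates along trajectories -/

theorem Data.Admissible.measurable_exitRate_traj (hD : D.Admissible CE M₀) (hN : 0 < N)
    (κ : Fin ((ν + 1) / 2) → Fin N) : Measurable fun w : (Phase m × (Fin ν → ℝ)) × ℝ =>
      D.exitRate N (surfaceAt κ w.1.2 w.2) ((D.traj κ w.1.2).Q (max w.2 0) w.1.1) :=
  measurable_comp_hopCount (G := fun n => D.exitRate N (stateAfter κ n))
    (fun _ => hD.measurable_exitRate hN _) (measurable_snd.comp measurable_fst) measurable_snd
    (hD.measurable_traj κ).1

theorem Data.Admissible.measurable_Q_comp (hD : D.Admissible CE M₀)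
    (κ : Fin ((ν + 1) / 2) → Fin N) {α : Type*} [MeasurableSpace α] {g : α → Phase m}
    {f : α → Fin ν → ℝ} {s : α → ℝ} (hg : Measurable g) (hf : Measurable f) (hs : Measurable s) :
    Measurable fun a => (D.traj κ (f a)).Q (max (s a) 0) (g a) :=
  (hD.measurable_traj κ).1.comp ((hg.prodMk hf).prodMk hs)

theorem Data.Admissible.measurable_exitRate_comp (hD : D.Admissible CE M₀) (hN : 0 < N)
    (κ : Fin ((ν + 1) / 2) → Fin N) {α : Type*} [MeasurableSpace α] {g : α → Phase m}
    {f : α → Fin ν → ℝ} {s : α → ℝ} (hg : Measurable g) (hf : Measurable f) (hs : Measurable s) :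
    Measurable fun a => D.exitRate N (surfaceAt κ (f a) (s a))
      ((D.traj κ (f a)).Q (max (s a) 0) (g a)) :=
  measurable_comp_hopCount (G := fun n => D.exitRate N (stateAfter κ n))
    (fun _ => hD.measurable_exitRate hN _) hf hs (hD.measurable_Q_comp κ hg hf hs)

theorem Data.cumulatedRate_eq (D : Data m) (κ : Fin ((ν + 1) / 2) → Fin N) (T : Fin ν → ℝ)
    {t : ℝ} (ht : 0 ≤ t) (z : Phase m) : D.cumulatedRate κ T t z = ∫ s in (0 : ℝ)..t,
      D.exitRate N (surfaceAt κ T s) ((D.traj κ T).Q (max s 0) z) := by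
  refine intervalIntegral.integral_congr fun s hs => ?_
  rw [uIcc_of_le ht] at hs
  simp only [max_eq_left hs.1]

theorem Data.Admissible.measurable_cumulatedRate (hD : D.Admissible CE M₀) (hN : 0 < N)
    (κ : Fin ((ν + 1) / 2) → Fin N) : Measurable fun w : (Phase m × (Fin ν → ℝ)) × ℝ =>
      D.cumulatedRate κ w.1.2 (max w.2 0) w.1.1 := by
  have h1 := measurable_integral_Ioc (g := fun (a : Phase m × (Fin ν → ℝ)) s =>
    D.exitRate N (surfaceAt κ a.2 s) ((D.traj κ a.2).Q (max s 0) a.1))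
    (hD.measurable_exitRate_traj hN κ)
  have h2 : Measurable fun w : (Phase m × (Fin ν → ℝ)) × ℝ => (w.1, max w.2 0) :=
    measurable_fst.prodMk (measurable_snd.max measurable_const)
  convert h1.comp h2 using 2 with w
  rw [D.cumulatedRate_eq κ _ (le_max_right _ _),
    intervalIntegral.integral_of_le (le_max_right _ _)]
  rfl

theorem Data.Admissible.measurable_cumulatedRate_comp (hD : D.Admissible CE M₀) (hN : 0 < N)
    (κ : Fin ((ν + 1) / 2) → Fin N) {α : Type*} [MeasurableSpace α] {g : α → Phase m}
    {f : α → Fin ν → ℝ} {s : α → ℝ} (hg : Measurable g) (hf : Measurable f) (hs : Measurable s) :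
    Measurable fun a => D.cumulatedRate κ (f a) (max (s a) 0) (g a) := by
  have h1 : Measurable fun a => ((g a, f a), s a) := (hg.prodMk hf).prodMk hs
  have h2 := (hD.measurable_cumulatedRate hN κ).comp h1
  simp only [Function.comp_def] at h2
  exact h2

theorem Data.Admissible.intervalIntegrable_exitRate_traj (hD : D.Admissible CE M₀) (hN : 0 < N)
    (κ : Fin ((ν + 1) / 2) → Fin N) (T : Fin ν → ℝ) (z : Phase m) (u v : ℝ) :
    IntervalIntegrable (fun s => D.exitRate N (surfaceAt κ T s) ((D.traj κ T).Q (max s 0) z))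
      volume u v := by
  refine intervalIntegrable_iff.2 (Measure.integrableOn_of_bounded (M := rateBound D.Ea D.Eb M₀)
    (by simp) ?_ (ae_of_all _ fun s => ?_))
  · exact (hD.measurable_exitRate_comp hN κ (g := fun _ : ℝ => z) (f := fun _ => T)
      (s := fun s => s) measurable_const measurable_const measurable_id').aestronglyMeasurable
  · rw [Real.norm_of_nonneg (hD.exitRate_nonneg hN _ _)]
    exact hD.exitRate_le hN _ _

theorem Data.Admissible.cumulatedRate_nonneg (hD : D.Admissible CE M₀) (hN : 0 < N)
    (κ : Fin ((ν + 1) / 2) → Fin N) (T : Fin ν → ℝ) {t : ℝ} (ht : 0 ≤ t) (z : Phase m) :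
    0 ≤ D.cumulatedRate κ T t z :=
  intervalIntegral.integral_nonneg ht fun _ _ => hD.exitRate_nonneg hN _ _

theorem Data.Admissible.cumulatedRate_le (hD : D.Admissible CE M₀) (hN : 0 < N)
    (κ : Fin ((ν + 1) / 2) → Fin N) (T : Fin ν → ℝ) {t : ℝ} (ht : 0 ≤ t) (z : Phase m) :
    D.cumulatedRate κ T t z ≤ rateBound D.Ea D.Eb M₀ * t := by
  rw [D.cumulatedRate_eq κ T ht]
  calc _ ≤ ∫ _s in (0 : ℝ)..t, rateBound D.Ea D.Eb M₀ :=
        intervalIntegral.integral_mono_on ht (hD.intervalIntegrable_exitRate_traj hN κ T z 0 t)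
          (by simp) fun s _ => hD.exitRate_le hN _ _
    _ = _ := by simp; ring

/-- The product of the rates of all hops, with hop times truncated to be nonnegative. -/
def Data.rateProd (D : Data m) (κ : Fin ((ν + 1) / 2) → Fin N) (T : Fin ν → ℝ) (z : Phase m) : ℝ :=
  ∏ i : Fin ν, D.hopRate N (stateAfter κ i) (stateAfter κ (i + 1))
    ((D.traj κ T).Q (max (T i) 0) z)

theorem Data.hopDensity_eq (D : Data m) (κ : Fin ((ν + 1) / 2) → Fin N) {T : Fin ν → ℝ} {t : ℝ}
    (hT : T ∈ hopTimes ν t) (z : Phase m) :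
    D.hopDensity κ T t z = Real.exp (-D.cumulatedRate κ T t z) * D.rateProd κ T z := by
  unfold Data.hopDensity Data.rateProd
  congr 1
  refine Finset.prod_congr rfl fun i _ => ?_
  rw [max_eq_left (hT.2 i).1.le]

theorem Data.Admissible.measurable_rateProd (hD : D.Admissible CE M₀) (hN : 0 < N)
    (κ : Fin ((ν + 1) / 2) → Fin N) :
    Measurable fun w : Phase m × (Fin ν → ℝ) => D.rateProd κ w.2 w.1 := by
  unfold Data.rateProd
  refine Finset.measurable_prod _ fun i _ => (hD.measurable_hopRate hN _ _).comp ?_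
  exact (hD.measurable_traj κ).1.comp
    (measurable_id.prodMk ((measurable_pi_apply i).comp measurable_snd))

theorem Data.Admissible.measurable_rateProd_comp (hD : D.Admissible CE M₀) (hN : 0 < N)
    (κ : Fin ((ν + 1) / 2) → Fin N) {α : Type*} [MeasurableSpace α] {g : α → Phase m}
    {f : α → Fin ν → ℝ} (hg : Measurable g) (hf : Measurable f) :
    Measurable fun a => D.rateProd κ (f a) (g a) :=
  (hD.measurable_rateProd hN κ).comp (hg.prodMk hf)

theorem Data.Admissible.rateProd_nonneg (hD : D.Admissible CE M₀) (hN : 0 < N)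
    (κ : Fin ((ν + 1) / 2) → Fin N) (T : Fin ν → ℝ) (z : Phase m) : 0 ≤ D.rateProd κ T z :=
  Finset.prod_nonneg fun _ _ => hD.hopRate_nonneg hN _ _ _

theorem Data.Admissible.rateProd_le (hD : D.Admissible CE M₀) (hN : 0 < N)
    (κ : Fin ((ν + 1) / 2) → Fin N) (T : Fin ν → ℝ) (z : Phase m) :
    D.rateProd κ T z ≤ rateBound D.Ea D.Eb M₀ ^ ν := by
  refine (Finset.prod_le_prod (fun _ _ => hD.hopRate_nonneg hN _ _ _)
    fun _ _ => hD.hopRate_le hN _ _ _).trans ?_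
  simp

/-- The dynamics does not anticipate: up to its own time, an appended hop has no influence on the
positions. -/
theorem Data.Admissible.traj_snoc (hD : D.Admissible CE M₀)
    (κ : Fin ((ν + 1 + 1) / 2) → Fin N) (T : Fin ν → ℝ) {s r : ℝ} (hs : 0 ≤ s) (hr : r ≤ s)
    (z : Phase m) : (D.traj κ (Fin.snoc T s : Fin (ν + 1) → ℝ)).Q (max r 0) z =
      (D.traj (initOrbitals κ) T).Q (max r 0) z :=
  ((hD.solves_traj κ _).phase_eq hD (hD.solves_traj (initOrbitals κ) T) (s₀ := s)
    (fun _ _ hu => surfaceAt_snoc κ hu) z (le_max_right _ _) (max_le hr hs)).1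

theorem Data.Admissible.cumulatedRate_snoc (hD : D.Admissible CE M₀)
    (κ : Fin ((ν + 1 + 1) / 2) → Fin N) (T : Fin ν → ℝ) {s : ℝ} (hs : 0 ≤ s) (z : Phase m) :
    D.cumulatedRate κ (Fin.snoc T s : Fin (ν + 1) → ℝ) s z =
      D.cumulatedRate (initOrbitals κ) T s z := by
  rw [D.cumulatedRate_eq _ _ hs, D.cumulatedRate_eq _ _ hs]
  refine intervalIntegral.integral_congr_ae ?_
  filter_upwards [Measure.ae_ne volume s] with r hrs hr
  rw [uIoc_of_le hs] at hr
  rw [hD.traj_snoc κ T hs hr.2, surfaceAt_snoc κ (lt_of_le_of_ne hr.2 hrs)]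

/-- By non-anticipation the rates of the earlier hops are unchanged, and the new hop contributes one
factor. -/
theorem Data.Admissible.rateProd_snoc (hD : D.Admissible CE M₀)
    (κ : Fin ((ν + 1 + 1) / 2) → Fin N) {T : Fin ν → ℝ} {s : ℝ} (hs : 0 ≤ s)
    (hT : ∀ i, T i ≤ s) (z : Phase m) :
    D.rateProd κ (Fin.snoc T s : Fin (ν + 1) → ℝ) z = D.rateProd (initOrbitals κ) T z *
      D.hopRate N (stateAfter (initOrbitals κ) ν) (stateAfter κ (ν + 1))
        ((D.traj (initOrbitals κ) T).Q (max s 0) z) := by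
  unfold Data.rateProd
  rw [Fin.prod_univ_castSucc]
  congr 1
  · refine Finset.prod_congr rfl fun i _ => ?_
    rw [Fin.snoc_castSucc, hD.traj_snoc κ T hs (hT i), Fin.val_castSucc,
      stateAfter_initOrbitals κ i.2.le, stateAfter_initOrbitals κ i.2]
  · rw [Fin.snoc_last, hD.traj_snoc κ T hs le_rfl, Fin.val_last,
      stateAfter_initOrbitals κ le_rfl]

/-! ### Normalization of the jump process -/

/-- The probability of at least `ν` hops in `[0, t]`. -/
def Data.probGe (D : Data m) (N : ℕ) (t : ℝ) (z : Phase m) (ν : ℕ) : ℝ≥0∞ :=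
  ∑ κ : Fin ((ν + 1) / 2) → Fin N, ∫⁻ T in hopTimes ν t,
    ENNReal.ofReal (Real.exp (-D.cumulatedRate κ T (lastTime T) z) * D.rateProd κ T z)

/-- The probability of exactly `ν` hops in `[0, t]`. -/
def Data.probEq (D : Data m) (N : ℕ) (t : ℝ) (z : Phase m) (ν : ℕ) : ℝ≥0∞ :=
  ∑ κ : Fin ((ν + 1) / 2) → Fin N, ∫⁻ T in hopTimes ν t,
    ENNReal.ofReal (Real.exp (-D.cumulatedRate κ T t z) * D.rateProd κ T z)

theorem Data.Admissible.measurable_lastDensity (hD : D.Admissible CE M₀) (hN : 0 < N)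
    (κ : Fin ((ν + 1) / 2) → Fin N) (z : Phase m) : Measurable fun T : Fin ν → ℝ =>
      ENNReal.ofReal (Real.exp (-D.cumulatedRate κ T (max (lastTime T) 0) z) *
        D.rateProd κ T z) := by
  refine ENNReal.measurable_ofReal.comp (Measurable.mul ?_ ?_)
  · refine Real.measurable_exp.comp (Measurable.neg ?_)
    exact hD.measurable_cumulatedRate_comp hN κ (g := fun _ => z) (f := fun T => T) (s := lastTime)
      measurable_const measurable_id' measurable_lastTime
  · exact hD.measurable_rateProd_comp hN κ (g := fun _ => z) (f := fun T => T)
      measurable_const measurable_id'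

/-- After the last hop the surface stays fixed, and the rates to all targets add up to its exit
rate. The integrand is then the rate times the survival factor, which `lintegral_rate_mul_exp_neg`
integrates. -/
theorem Data.Admissible.lintegral_lastHop (hD : D.Admissible CE M₀) (hN : 0 < N)
    (κ : Fin ((ν + 1) / 2) → Fin N) {t : ℝ} (ht : 0 ≤ t) {T : Fin ν → ℝ}
    (hT : T ∈ hopTimes ν t) (z : Phase m) :
    ∑ l, ∫⁻ s in Ioo (lastTime T) t, ENNReal.ofReal (Real.exp (-D.cumulatedRate κ T s z) *
      (D.rateProd κ T z * D.hopRate N (stateAfter κ ν) l ((D.traj κ T).Q (max s 0) z))) =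
    ENNReal.ofReal ((Real.exp (-D.cumulatedRate κ T (lastTime T) z) -
      Real.exp (-D.cumulatedRate κ T t z)) * D.rateProd κ T z) := by
  have hlt := lastTime_nonneg hT
  have hle := lastTime_le ht hT
  have hfm : Measurable fun s => D.exitRate N (surfaceAt κ T s) ((D.traj κ T).Q (max s 0) z) :=
    hD.measurable_exitRate_comp hN κ (g := fun _ : ℝ => z) (f := fun _ => T)
      (s := fun s => s) measurable_const measurable_const measurable_id'
  have h1 := lintegral_rate_mul_exp_neg hfm (fun s => hD.exitRate_nonneg hN _ _)
    (fun s => hD.exitRate_le hN _ _) hlt hle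
  have hcm : Measurable fun s => D.cumulatedRate κ T (max s 0) z :=
    hD.measurable_cumulatedRate_comp hN κ (g := fun _ : ℝ => z) (f := fun _ => T)
      (s := fun s => s) measurable_const measurable_const measurable_id'
  have hQm : Measurable fun s => (D.traj κ T).Q (max s 0) z :=
    hD.measurable_Q_comp κ (g := fun _ : ℝ => z) (f := fun _ => T)
      (s := fun s => s) measurable_const measurable_const measurable_id'
  have hP := hD.rateProd_nonneg hN κ T z
  rw [D.cumulatedRate_eq κ T hlt, D.cumulatedRate_eq κ T ht, ENNReal.ofReal_mul' hP, ← h1,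
    ← lintegral_mul_const _ (by
      refine ENNReal.measurable_ofReal.comp (Measurable.mul ?_ hfm)
      refine Real.measurable_exp.comp (Measurable.neg ?_)
      exact (intervalIntegral.continuous_primitive
        (hD.intervalIntegrable_exitRate_traj hN κ T z) 0).measurable)]
  have h2 : ∀ l : Option (Fin N), ∫⁻ s in Ioo (lastTime T) t,
      ENNReal.ofReal (Real.exp (-D.cumulatedRate κ T s z) *
        (D.rateProd κ T z * D.hopRate N (stateAfter κ ν) l ((D.traj κ T).Q (max s 0) z))) =
      ∫⁻ s in Ioo (lastTime T) t,
      ENNReal.ofReal (Real.exp (-D.cumulatedRate κ T (max s 0) z) *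
        (D.rateProd κ T z * D.hopRate N (stateAfter κ ν) l ((D.traj κ T).Q (max s 0) z))) :=
    fun l => setLIntegral_congr_fun measurableSet_Ioo fun s hs => by
      simp only [max_eq_left (hlt.trans hs.1.le)]
  rw [Finset.sum_congr rfl fun l _ => h2 l, ← lintegral_finsetSum _ fun l _ => by
    refine ENNReal.measurable_ofReal.comp (Measurable.mul ?_ ?_)
    · exact Real.measurable_exp.comp hcm.neg
    · exact ((hD.measurable_hopRate hN _ _).comp hQm).const_mul _]
  refine setLIntegral_congr_fun measurableSet_Ioo fun s hs => ?_
  have hs0 : 0 ≤ s := hlt.trans hs.1.le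
  rw [← ENNReal.ofReal_sum_of_nonneg fun l _ => mul_nonneg (Real.exp_pos _).le
      (mul_nonneg hP (hD.hopRate_nonneg hN _ _ _)), ← ENNReal.ofReal_mul' hP,
    ← Finset.mul_sum, ← Finset.mul_sum, max_eq_left hs0, D.cumulatedRate_eq κ T hs0]
  congr 1
  have h3 : surfaceAt κ T s = stateAfter κ ν := by
    rw [surfaceAt_eq, hopCount_of_lastTime_le hT hs.1.le]
  simp only [h3, Data.exitRate]
  ring

/-- The first `ν` hops have density `e^{-L}` up to the last hop, times the rates. This splits into
survival until `t` and the occurrence of one more hop, whose time and target `lintegral_lastHop`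
integrates out. -/
theorem Data.Admissible.probEq_add_probGe_succ (hD : D.Admissible CE M₀) (hN : 0 < N) {t : ℝ}
    (ht : 0 ≤ t) (z : Phase m) (ν : ℕ) :
    D.probEq N t z ν + D.probGe N t z (ν + 1) = D.probGe N t z ν := by
  have h1 : D.probGe N t z (ν + 1) = ∑ κ : Fin ((ν + 1) / 2) → Fin N, ∫⁻ T in hopTimes ν t,
      ENNReal.ofReal ((Real.exp (-D.cumulatedRate κ T (lastTime T) z) -
        Real.exp (-D.cumulatedRate κ T t z)) * D.rateProd κ T z) := by
    set f : (Fin ((ν + 1) / 2) → Fin N) → Option (Fin N) → ℝ≥0∞ := fun κ l =>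
      ∫⁻ T in hopTimes ν t, ∫⁻ s in Ioo (lastTime T) t,
        ENNReal.ofReal (Real.exp (-D.cumulatedRate κ T s z) *
          (D.rateProd κ T z * D.hopRate N (stateAfter κ ν) l ((D.traj κ T).Q (max s 0) z)))
      with hf
    have h2 : ∀ κ : Fin ((ν + 1 + 1) / 2) → Fin N, ∫⁻ T in hopTimes (ν + 1) t,
        ENNReal.ofReal (Real.exp (-D.cumulatedRate κ T (lastTime T) z) * D.rateProd κ T z) =
        f (initOrbitals κ) (stateAfter κ (ν + 1)) := by
      intro κ
      have h3 : ∫⁻ T in hopTimes (ν + 1) t,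
          ENNReal.ofReal (Real.exp (-D.cumulatedRate κ T (lastTime T) z) * D.rateProd κ T z) =
          ∫⁻ T in hopTimes (ν + 1) t,
          ENNReal.ofReal (Real.exp (-D.cumulatedRate κ T (max (lastTime T) 0) z) *
            D.rateProd κ T z) :=
        setLIntegral_congr_fun (measurableSet_hopTimes _ _) fun T hT => by
          simp only [max_eq_left (lastTime_nonneg hT)]
      rw [h3, setLIntegral_hopTimes_succ (hD.measurable_lastDensity hN κ z)]
      refine setLIntegral_congr_fun (measurableSet_hopTimes _ _) fun T hT => ?_
      refine setLIntegral_congr_fun measurableSet_Ioo fun s hs => ?_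
      have hs0 : 0 ≤ s := (lastTime_nonneg hT).trans hs.1.le
      have h4 : lastTime (Fin.snoc T s : Fin (ν + 1) → ℝ) = s := by simp [lastTime]
      rw [h4, max_eq_left hs0, hD.cumulatedRate_snoc κ T hs0,
        hD.rateProd_snoc κ hs0 (fun i => (le_lastTime hT i).trans hs.1.le), max_eq_left hs0]
    unfold Data.probGe
    -- The parity of `ν` determines which kind of target is admissible. The sum may run over all
    -- surfaces, since the rates from molecule to molecule and from metal to metal vanish.
    rw [Finset.sum_congr rfl fun κ _ => h2 κ, sum_orbitals_succ f ?_ ?_]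
    · refine Finset.sum_congr rfl fun κ _ => ?_
      simp only [hf]
      rw [← lintegral_finsetSum' (μ := volume.restrict (hopTimes ν t))]
      · refine setLIntegral_congr_fun (measurableSet_hopTimes _ _) fun T hT => ?_
        exact hD.lintegral_lastHop hN κ ht hT z
      · intro l _
        have h5 : Measurable fun w : (Fin ν → ℝ) × ℝ => ENNReal.ofReal
            (Real.exp (-D.cumulatedRate κ w.1 (max w.2 0) z) * (D.rateProd κ w.1 z *
              D.hopRate N (stateAfter κ ν) l ((D.traj κ w.1).Q (max w.2 0) z))) := by
          refine ENNReal.measurable_ofReal.comp (Measurable.mul ?_ (Measurable.mul ?_ ?_))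
          · refine Real.measurable_exp.comp (Measurable.neg ?_)
            exact hD.measurable_cumulatedRate_comp hN κ (g := fun _ => z)
              measurable_const measurable_fst measurable_snd
          · exact hD.measurable_rateProd_comp hN κ (g := fun _ => z) measurable_const measurable_fst
          · exact (hD.measurable_hopRate hN _ _).comp (hD.measurable_Q_comp κ (g := fun _ => z)
              measurable_const measurable_fst measurable_snd)
        have h7 : Measurable fun w : (Fin ν → ℝ) × ℝ =>
            (Ioo (lastTime w.1) t).indicator (fun s => ENNReal.ofReal
            (Real.exp (-D.cumulatedRate κ w.1 (max s 0) z) * (D.rateProd κ w.1 z *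
              D.hopRate N (stateAfter κ ν) l ((D.traj κ w.1).Q (max s 0) z)))) w.2 :=
          h5.indicator (s := {w : (Fin ν → ℝ) × ℝ | w.2 ∈ Ioo (lastTime w.1) t})
            ((measurableSet_lt (measurable_lastTime.comp measurable_fst) measurable_snd).inter
              (measurableSet_lt measurable_snd measurable_const))
        refine AEMeasurable.congr (h7.lintegral_prod_right' (ν := volume)).aemeasurable ?_
        filter_upwards [ae_restrict_mem (measurableSet_hopTimes ν t)] with T hT
        rw [lintegral_indicator measurableSet_Ioo]
        refine setLIntegral_congr_fun measurableSet_Ioo fun s hs => ?_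
        simp only [max_eq_left ((lastTime_nonneg hT).trans hs.1.le)]
    · intro hν κ
      simp [hf, stateAfter_even κ hν, Data.hopRate]
    · intro hν κ k
      obtain ⟨k', hk'⟩ := exists_stateAfter_odd κ hν le_rfl
      simp [hf, hk', Data.hopRate]
  rw [h1, Data.probEq, Data.probGe, ← Finset.sum_add_distrib]
  refine Finset.sum_congr rfl fun κ _ => ?_
  have hm : Measurable fun T : Fin ν → ℝ =>
      ENNReal.ofReal (Real.exp (-D.cumulatedRate κ T t z) * D.rateProd κ T z) := by
    refine ENNReal.measurable_ofReal.comp (Measurable.mul ?_ ?_)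
    · have := hD.measurable_cumulatedRate_comp hN κ (g := fun _ => z) (f := fun T => T)
        (s := fun _ => t) measurable_const measurable_id' measurable_const
      simp only [max_eq_left ht] at this
      exact Real.measurable_exp.comp this.neg
    · exact hD.measurable_rateProd_comp hN κ (g := fun _ => z) (f := fun T => T)
        measurable_const measurable_id'
  rw [← lintegral_add_left hm]
  refine setLIntegral_congr_fun (measurableSet_hopTimes _ _) fun T hT => ?_
  have hP := hD.rateProd_nonneg hN κ T z
  have hmono : Real.exp (-D.cumulatedRate κ T t z) ≤
      Real.exp (-D.cumulatedRate κ T (lastTime T) z) := by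
    rw [Real.exp_le_exp, neg_le_neg_iff, D.cumulatedRate_eq κ T ht,
      D.cumulatedRate_eq κ T (lastTime_nonneg hT)]
    exact intervalIntegral.integral_mono_interval le_rfl (lastTime_nonneg hT) (lastTime_le ht hT)
      (ae_of_all _ fun s => hD.exitRate_nonneg hN _ _)
      (hD.intervalIntegrable_exitRate_traj hN κ T z 0 t)
  rw [← ENNReal.ofReal_add (mul_nonneg (Real.exp_pos _).le hP)
    (mul_nonneg (sub_nonneg.2 hmono) hP)]
  congr 1
  ring

theorem Data.probGe_zero (D : Data m) (N : ℕ) (t : ℝ) (z : Phase m) : D.probGe N t z 0 = 1 := by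
  have : IsEmpty (Fin ((0 + 1) / 2)) := inferInstanceAs (IsEmpty (Fin 0))
  have h1 : hopTimes 0 t = univ := by
    ext T
    simp [hopTimes, StrictMono]
  unfold Data.probGe
  rw [Fintype.sum_unique, h1]
  simp [lastTime, Data.cumulatedRate, Data.rateProd, volume_pi]

/-- The factorial in the volume of the simplex beats the powers of the rate and the at most `N^ν`
choices of orbitals. Dependence on `N` is harmless, since only the limit is used. -/
theorem Data.Admissible.tendsto_probGe (hD : D.Admissible CE M₀) (hN : 0 < N) {t : ℝ}
    (ht : 0 ≤ t) (z : Phase m) : Tendsto (D.probGe N t z) atTop (𝓝 0) := by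
  set R := rateBound D.Ea D.Eb M₀ with hR
  have hR0 : 0 ≤ R := hD.rateBound_nonneg
  have hle : ∀ ν, D.probGe N t z ν ≤
      ENNReal.ofReal ((N * (R * t)) ^ ν / ν.factorial) := by
    intro ν
    calc D.probGe N t z ν ≤ ∑ _κ : Fin ((ν + 1) / 2) → Fin N,
          ENNReal.ofReal (R ^ ν) * ENNReal.ofReal (t ^ ν / ν.factorial) := by
          refine Finset.sum_le_sum fun κ _ => ?_
          calc _ ≤ ∫⁻ _T in hopTimes ν t, ENNReal.ofReal (R ^ ν) := by
                refine setLIntegral_mono' (measurableSet_hopTimes _ _) fun T hT => ?_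
                refine ENNReal.ofReal_le_ofReal ?_
                refine (mul_le_of_le_one_left (hD.rateProd_nonneg hN κ T z) ?_).trans
                  (hD.rateProd_le hN κ T z)
                rw [Real.exp_le_one_iff, Left.neg_nonpos_iff]
                exact hD.cumulatedRate_nonneg hN κ T (lastTime_nonneg hT) z
            _ = ENNReal.ofReal (R ^ ν) * volume (hopTimes ν t) := by
                rw [setLIntegral_const]
            _ ≤ _ := by gcongr; exact volume_hopTimes_le ν ht
      _ = ENNReal.ofReal ((N : ℝ) ^ ((ν + 1) / 2) * (R ^ ν * (t ^ ν / ν.factorial))) := by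
          rw [Finset.sum_const, Finset.card_univ, Fintype.card_fun, Fintype.card_fin,
            Fintype.card_fin, nsmul_eq_mul, ENNReal.ofReal_mul (p := (N : ℝ) ^ ((ν + 1) / 2)) (by positivity),
            ENNReal.ofReal_mul (p := R ^ ν) (by positivity), ← Nat.cast_pow (α := ℝ),
            ENNReal.ofReal_natCast]
      _ ≤ ENNReal.ofReal ((N : ℝ) ^ ν * (R ^ ν * (t ^ ν / ν.factorial))) := by
          refine ENNReal.ofReal_le_ofReal ?_
          have : (1 : ℝ) ≤ N := by exact_mod_cast hN
          gcongr ?_ * _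
          refine pow_le_pow_right₀ this ?_
          omega
      _ = _ := by
          congr 1
          rw [mul_pow, mul_pow]; ring
  have h1 := (FloorSemiring.tendsto_pow_div_factorial_atTop ((N : ℝ) * (R * t)))
  have h2 := (ENNReal.continuous_ofReal.tendsto 0).comp h1
  rw [ENNReal.ofReal_zero] at h2
  exact tendsto_of_tendsto_of_tendsto_of_le_of_le tendsto_const_nhds h2 (fun _ => zero_le) hle

/-- The jump process has some number of hops almost surely. -/
theorem Data.Admissible.tsum_probEq (hD : D.Admissible CE M₀) (hN : 0 < N) {t : ℝ}
    (ht : 0 ≤ t) (z : Phase m) : ∑' ν, D.probEq N t z ν = 1 := by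
  have h1 : ∀ n, ∑ ν ∈ Finset.range n, D.probEq N t z ν + D.probGe N t z n = 1 := by
    intro n
    induction n with
    | zero => simp [D.probGe_zero]
    | succ n ih =>
      rw [Finset.sum_range_succ, add_assoc, hD.probEq_add_probGe_succ hN ht, ih]
  have h2 : ∀ n, ∑ ν ∈ Finset.range n, D.probEq N t z ν = 1 - D.probGe N t z n := fun n => by
    refine ENNReal.eq_sub_of_add_eq ?_ (h1 n)
    exact ne_top_of_le_ne_top one_ne_top (le_of_le_of_eq le_add_self (h1 n))
  refine tendsto_nhds_unique (ENNReal.tendsto_nat_tsum _) ?_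
  simp_rw [h2]
  have h3 := ENNReal.Tendsto.sub (tendsto_const_nhds (x := (1 : ℝ≥0∞)) (f := atTop))
    (hD.tendsto_probGe hN ht z) (Or.inl one_ne_top)
  simpa using h3

end Rates

end FGS
end

noncomputable section

namespace FGS

open Set Filter Topology NNReal ENNReal ProbabilityTheory

/-! ### Mean square error of an average of independent samples -/

section Average

variable {Ω : Type*} [MeasurableSpace Ω] {μ : Measure Ω} [IsProbabilityMeasure μ] {M : ℕ}

/-- The variance of a sum of independent copies is additive, so the average has variance `Var / M`,
and a variance is at most the second moment. -/
theorem lintegral_average_sub_sq_le {X : Ω → ℝ} (hX : MemLp X 2 μ) (hM : 0 < M) :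
    ∫⁻ ω : Fin M → Ω, ENNReal.ofReal (((1 / (M : ℝ)) * ∑ j, X (ω j) - ∫ a, X a ∂μ) ^ 2)
        ∂(Measure.pi fun _ => μ) ≤
      ENNReal.ofReal (1 / M) * ∫⁻ a, ENNReal.ofReal (X a ^ 2) ∂μ := by
  have hM0 : (M : ℝ) ≠ 0 := by exact_mod_cast hM.ne'
  have hj : ∀ j : Fin M, MemLp (fun ω : Fin M → Ω => X (ω j)) 2 (Measure.pi fun _ => μ) :=
    fun j => hX.comp_measurePreserving (measurePreserving_eval (fun _ => μ) j)
  have hmean : ∫ ω : Fin M → Ω, (1 / (M : ℝ)) * ∑ j, X (ω j) ∂(Measure.pi fun _ => μ) =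
      ∫ a, X a ∂μ := by
    rw [integral_const_mul, integral_finsetSum _ fun j _ => (hj j).integrable one_le_two]
    have h1 : ∀ j : Fin M, ∫ ω : Fin M → Ω, X (ω j) ∂(Measure.pi fun _ => μ) = ∫ a, X a ∂μ := by
      intro j
      exact integral_comp_eval (μ := fun _ : Fin M => μ) hX.1
    simp only [h1, Finset.sum_const, Finset.card_univ, Fintype.card_fin, nsmul_eq_mul]
    field_simp
  have hsum : MemLp (fun ω : Fin M → Ω => (1 / (M : ℝ)) * ∑ j, X (ω j)) 2
      (Measure.pi fun _ => μ) := (memLp_finsetSum _ fun j _ => hj j).const_mul _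
  have h1 := evariance_eq_lintegral_ofReal (fun ω : Fin M → Ω => (1 / (M : ℝ)) * ∑ j, X (ω j))
    (Measure.pi fun _ => μ)
  rw [hmean] at h1
  rw [← h1, ← ofReal_variance hsum, variance_const_mul]
  have h2 := variance_sum_pi (ι := Fin M) (μ := fun _ => μ) (X := fun _ => X) fun _ => hX
  have h3 : (∑ i : Fin M, fun ω : Fin M → Ω => X (ω i)) = fun ω => ∑ j, X (ω j) := by
    ext ω; simp
  rw [h3] at h2
  have h4 : ∫⁻ a, ENNReal.ofReal (X a ^ 2) ∂μ = ENNReal.ofReal (∫ a, X a ^ 2 ∂μ) :=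
    (ofReal_integral_eq_lintegral_ofReal hX.integrable_sq (ae_of_all _ fun _ => sq_nonneg _)).symm
  rw [h2, h4, ← ENNReal.ofReal_mul (by positivity)]
  refine ENNReal.ofReal_le_ofReal ?_
  have h5 : Var[X; μ] ≤ ∫ a, X a ^ 2 ∂μ := variance_le_expectation_sq hX.1
  simp only [Finset.sum_const, Finset.card_univ, Fintype.card_fin, nsmul_eq_mul]
  calc (1 / (M : ℝ)) ^ 2 * (M * Var[X; μ]) = 1 / M * Var[X; μ] := by field_simp
    _ ≤ _ := by gcongr

theorem enorm_sq_eq_re_im (z : ℂ) :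
    ‖z‖ₑ ^ 2 = ENNReal.ofReal (z.re ^ 2) + ENNReal.ofReal (z.im ^ 2) := by
  rw [← ENNReal.ofReal_add (sq_nonneg _) (sq_nonneg _), ← ofReal_norm,
    ← ENNReal.ofReal_pow (norm_nonneg _), Complex.sq_norm, Complex.normSq_apply]
  congr 1; ring

/-- Real and imaginary parts are treated separately; their squares add up to the squared modulus, so
no constant is lost. -/
theorem lintegral_enorm_average_sub_sq_le {X : Ω → ℂ} (hX : MemLp X 2 μ) (hM : 0 < M) :
    ∫⁻ ω : Fin M → Ω, ‖(1 / (M : ℂ)) * ∑ j, X (ω j) - ∫ a, X a ∂μ‖ₑ ^ 2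
        ∂(Measure.pi fun _ => μ) ≤
      ENNReal.ofReal (1 / M) * ∫⁻ a, ‖X a‖ₑ ^ 2 ∂μ := by
  have hint := hX.integrable one_le_two
  have hre : MemLp (fun a => (X a).re) 2 μ := hX.re
  have him : MemLp (fun a => (X a).im) 2 μ := hX.im
  have h1 : (∫ a, X a ∂μ).re = ∫ a, (X a).re ∂μ := (integral_re hint).symm
  have h2 : (∫ a, X a ∂μ).im = ∫ a, (X a).im ∂μ := (integral_im hint).symm
  have hM1 : (1 / (M : ℂ)) = ((1 / (M : ℝ) : ℝ) : ℂ) := by push_cast; rfl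
  have hj : ∀ j : Fin M, AEMeasurable (fun ω : Fin M → Ω => (X (ω j)).re)
      (Measure.pi fun _ => μ) := fun j =>
    (hre.comp_measurePreserving (measurePreserving_eval (fun _ => μ) j)).1.aemeasurable
  have h3 : AEMeasurable (fun ω : Fin M → Ω => ENNReal.ofReal
      (((1 / (M : ℝ)) * ∑ j, (X (ω j)).re - ∫ a, (X a).re ∂μ) ^ 2)) (Measure.pi fun _ => μ) := by
    refine AEMeasurable.ennreal_ofReal (AEMeasurable.pow_const ?_ 2)
    exact ((Finset.aemeasurable_fun_sum _ fun j _ => hj j).const_mul _).sub_const _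
  have h4 : AEMeasurable (fun a => ENNReal.ofReal ((X a).re ^ 2)) μ :=
    (hre.1.aemeasurable.pow_const 2).ennreal_ofReal
  have h5 : ∀ ω : Fin M → Ω, ‖(1 / (M : ℂ)) * ∑ j, X (ω j) - ∫ a, X a ∂μ‖ₑ ^ 2 =
      ENNReal.ofReal (((1 / (M : ℝ)) * ∑ j, (X (ω j)).re - ∫ a, (X a).re ∂μ) ^ 2) +
      ENNReal.ofReal (((1 / (M : ℝ)) * ∑ j, (X (ω j)).im - ∫ a, (X a).im ∂μ) ^ 2) := fun ω => by
    rw [enorm_sq_eq_re_im, Complex.sub_re, Complex.sub_im, h1, h2, hM1, Complex.re_ofReal_mul,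
      Complex.im_ofReal_mul, Complex.re_sum, Complex.im_sum]
  calc ∫⁻ ω : Fin M → Ω, ‖(1 / (M : ℂ)) * ∑ j, X (ω j) - ∫ a, X a ∂μ‖ₑ ^ 2
        ∂(Measure.pi fun _ => μ)
      = _ := by rw [lintegral_congr h5, lintegral_add_left' h3]
    _ ≤ _ := add_le_add (lintegral_average_sub_sq_le hre hM) (lintegral_average_sub_sq_le him hM)
    _ = _ := by
      rw [← mul_add, ← lintegral_add_left' h4]
      exact congrArg _ (lintegral_congr fun a => (enorm_sq_eq_re_im _).symm)

end Average

/-! ### Hop histories as a measurable space -/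

section Histories

variable {m N : ℕ}

theorem measurable_sigmaMk {ι : Type*} {β : ι → Type*} [∀ i, MeasurableSpace (β i)] (i : ι) :
    Measurable (Sigma.mk i : β i → Σ i, β i) := fun _ hs =>
  MeasurableSpace.measurableSet_iInf.1 hs i

theorem measurableSet_sigma_iff {ι : Type*} {β : ι → Type*} [∀ i, MeasurableSpace (β i)]
    {s : Set (Σ i, β i)} : MeasurableSet s ↔ ∀ i, MeasurableSet (Sigma.mk i ⁻¹' s) :=
  MeasurableSpace.measurableSet_iInf

/-- The paths with `ν` hops that visit the orbitals `κ`. -/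
def sheetMk {ν : ℕ} (κ : Fin ((ν + 1) / 2) → Fin N) (w : Phase m × (Fin ν → ℝ)) : Path m N :=
  (w.1, ⟨ν, (κ, w.2)⟩)

/-- The hop times of a history with `ν` hops, and `0` for other histories. -/
def History.times (ν : ℕ) (η : History N) : Fin ν → ℝ :=
  if e : η.1 = ν then e ▸ η.2.2 else 0

theorem History.measurable_times (ν : ℕ) : Measurable (History.times ν : History N → _) := by
  intro s hs
  refine measurableSet_sigma_iff.2 fun ν' => ?_
  by_cases e : ν' = ν
  · subst e
    have : ((fun p : (Fin ((ν' + 1) / 2) → Fin N) × (Fin ν' → ℝ) => (⟨ν', p⟩ : History N)) ⁻¹'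
      (History.times ν' ⁻¹' s) :
        Set ((Fin ((ν' + 1) / 2) → Fin N) × (Fin ν' → ℝ))) = Prod.snd ⁻¹' s := by
      ext p; simp [History.times]
    change MeasurableSet ((fun p : (Fin ((ν' + 1) / 2) → Fin N) × (Fin ν' → ℝ) => (⟨ν', p⟩ : History N)) ⁻¹' _)
    rw [this]
    exact measurable_snd hs
  · have : ((fun p : (Fin ((ν' + 1) / 2) → Fin N) × (Fin ν' → ℝ) => (⟨ν', p⟩ : History N)) ⁻¹'
      (History.times ν ⁻¹' s) :
        Set ((Fin ((ν' + 1) / 2) → Fin N) × (Fin ν' → ℝ))) = {_p | (0 : Fin ν → ℝ) ∈ s} := by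
      ext p; simp [History.times, e]
    change MeasurableSet ((fun p : (Fin ((ν' + 1) / 2) → Fin N) × (Fin ν' → ℝ) => (⟨ν', p⟩ : History N)) ⁻¹' _)
    rw [this]
    exact MeasurableSet.const _

theorem measurableSet_sheet {ν : ℕ} (κ : Fin ((ν + 1) / 2) → Fin N) :
    MeasurableSet {η : History N | ∃ T, η = ⟨ν, (κ, T)⟩} := by
  refine measurableSet_sigma_iff.2 fun ν' => ?_
  by_cases e : ν' = ν
  · subst e
    have : ((fun p : (Fin ((ν' + 1) / 2) → Fin N) × (Fin ν' → ℝ) => (⟨ν', p⟩ : History N)) ⁻¹'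
      {η : History N | ∃ T, η = ⟨ν', (κ, T)⟩} :
        Set ((Fin ((ν' + 1) / 2) → Fin N) × (Fin ν' → ℝ))) = Prod.fst ⁻¹' {κ} := by
      ext ⟨κ', T'⟩; simp
    change MeasurableSet ((fun p : (Fin ((ν' + 1) / 2) → Fin N) × (Fin ν' → ℝ) => (⟨ν', p⟩ : History N)) ⁻¹' _)
    rw [this]
    exact measurable_fst (measurableSet_singleton κ)
  · have : ((fun p : (Fin ((ν' + 1) / 2) → Fin N) × (Fin ν' → ℝ) => (⟨ν', p⟩ : History N)) ⁻¹'
      {η : History N | ∃ T, η = ⟨ν, (κ, T)⟩} :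
        Set ((Fin ((ν' + 1) / 2) → Fin N) × (Fin ν' → ℝ))) = ∅ := by
      ext ⟨κ', T'⟩
      simp only [mem_preimage, mem_ofPred_eq, mem_empty_iff_false, iff_false, not_exists]
      intro T h
      exact e (congrArg Sigma.fst h)
    change MeasurableSet ((fun p : (Fin ((ν' + 1) / 2) → Fin N) × (Fin ν' → ℝ) => (⟨ν', p⟩ : History N)) ⁻¹' _)
    rw [this]
    exact MeasurableSet.empty

theorem times_mk {ν : ℕ} (κ : Fin ((ν + 1) / 2) → Fin N) (T : Fin ν → ℝ) :
    History.times ν (⟨ν, (κ, T)⟩ : History N) = T := by simp [History.times]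

theorem measurable_sheetMk {ν : ℕ} (κ : Fin ((ν + 1) / 2) → Fin N) :
    Measurable (sheetMk κ : Phase m × (Fin ν → ℝ) → Path m N) := by
  have h1 : Measurable fun w : Phase m × (Fin ν → ℝ) => (κ, w.2) :=
    measurable_const.prodMk measurable_snd
  exact measurable_fst.prodMk ((measurable_sigmaMk ν).comp h1)

/-- The sheets are measurable and carry the measurable inverse `History.times`. As an embedding,
`sheetMk` transports integrals and almost-everywhere statements to the sheets without measurability
of the integrand or the predicate. -/
theorem measurableEmbedding_sheetMk {ν : ℕ} (κ : Fin ((ν + 1) / 2) → Fin N) :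
    MeasurableEmbedding (sheetMk κ : Phase m × (Fin ν → ℝ) → Path m N) where
  injective := by
    rintro ⟨z, T⟩ ⟨z', T'⟩ h
    have h1 := congrArg Prod.fst h
    have h2 := congrArg (fun ω : Path m N => History.times ν ω.2) h
    simp only [sheetMk, times_mk] at h1 h2
    rw [h1, h2]
  measurable := measurable_sheetMk κ
  measurableSet_image' := by
    intro s hs
    have h1 : Measurable fun ω : Path m N => (ω.1, History.times ν ω.2) :=
      measurable_fst.prodMk ((History.measurable_times ν).comp measurable_snd)
    have h2 : (sheetMk κ '' s : Set (Path m N)) =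
        Prod.snd ⁻¹' {η : History N | ∃ T, η = ⟨ν, (κ, T)⟩} ∩
          (fun ω : Path m N => (ω.1, History.times ν ω.2)) ⁻¹' s := by
      ext ⟨z, η⟩
      constructor
      · rintro ⟨⟨z', T⟩, hw, h⟩
        obtain ⟨rfl, rfl⟩ := Prod.mk.inj h
        exact ⟨⟨T, rfl⟩, by simpa [times_mk] using hw⟩
      · rintro ⟨⟨T, rfl⟩, h⟩
        refine ⟨(z, T), by simpa [times_mk] using h, rfl⟩
    rw [h2]
    exact (measurable_snd (measurableSet_sheet κ)).inter (h1 hs)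

/-- A function of a path and a parameter is measurable if it is so on every sheet. -/
theorem measurable_of_sheets {X β : Type*} [MeasurableSpace X] [MeasurableSpace β]
    {G : Path m N × X → β}
    (h : ∀ (ν : ℕ) (κ : Fin ((ν + 1) / 2) → Fin N),
      Measurable fun w : (Phase m × (Fin ν → ℝ)) × X => G (sheetMk κ w.1, w.2)) :
    Measurable G := by
  intro s hs
  have h1 : ∀ ν : ℕ, Measurable fun w : Path m N × X => ((w.1.1, History.times ν w.1.2), w.2) :=
    fun ν => ((measurable_fst.comp measurable_fst).prodMk ((History.measurable_times ν).comp
      (measurable_snd.comp measurable_fst))).prodMk measurable_snd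
  have h2 : G ⁻¹' s = ⋃ ν : ℕ, ⋃ κ : Fin ((ν + 1) / 2) → Fin N,
      ((fun w : Path m N × X => w.1.2) ⁻¹' {η : History N | ∃ T, η = ⟨ν, (κ, T)⟩}) ∩
        (fun w : Path m N × X => ((w.1.1, History.times ν w.1.2), w.2)) ⁻¹'
          ((fun w : (Phase m × (Fin ν → ℝ)) × X => G (sheetMk κ w.1, w.2)) ⁻¹' s) := by
    ext ⟨⟨z, η⟩, x⟩
    simp only [mem_iUnion]
    constructor
    · intro hw
      obtain ⟨ν, κ, T⟩ := η
      refine ⟨ν, κ, ⟨T, rfl⟩, ?_⟩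
      simpa [sheetMk, times_mk] using hw
    · rintro ⟨ν, κ, ⟨T, hT⟩, hw⟩
      simp only at hT
      subst hT
      simpa [sheetMk, times_mk] using hw
  rw [h2]
  exact MeasurableSet.iUnion fun ν => MeasurableSet.iUnion fun κ =>
    ((measurable_snd.comp measurable_fst) (measurableSet_sheet κ)).inter
      (h1 ν (h ν κ hs))

end Histories

end FGS
end

noncomputable section

namespace FGS

open Set Filter Topology NNReal ENNReal

/-! ### The wave packets -/

section Packets

variable {m N ν : ℕ} {D : Data m} {CE M₀ : ℝ}

/-- Hop times truncated to be nonnegative. -/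
def posTimes (T : Fin ν → ℝ) : Fin ν → ℝ := fun i => max (T i) 0

theorem measurable_posTimes : Measurable (posTimes : (Fin ν → ℝ) → Fin ν → ℝ) :=
  measurable_pi_lambda _ fun i => (measurable_pi_apply i).max measurable_const

theorem posTimes_eq {T : Fin ν → ℝ} (hT : ∀ i, 0 ≤ T i) : posTimes T = T :=
  funext fun i => max_eq_left (hT i)

theorem ae_mem_hopTimes (ν : ℕ) (t : ℝ) :
    ∀ᵐ w : Phase m × (Fin ν → ℝ) ∂((volume : Measure (Phase m)).prod
      (volume.restrict (hopTimes ν t))), w.2 ∈ hopTimes ν t :=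
  Measure.quasiMeasurePreserving_snd.ae (ae_restrict_mem (measurableSet_hopTimes ν t))

theorem isFiniteMeasure_restrict_hopTimes (ν : ℕ) {t : ℝ} (ht : 0 ≤ t) :
    IsFiniteMeasure (volume.restrict (hopTimes ν t)) := by
  refine ⟨?_⟩
  rw [Measure.restrict_apply_univ]
  exact (volume_hopTimes_le ν ht).trans_lt ENNReal.ofReal_lt_top

/-! ### Measurability of the packets and integrands, with the hop times truncated. -/

section Measurability

variable {α : Type*} [MeasurableSpace α] {g : α → Phase m} {f : α → Fin ν → ℝ} {x : α → Pos m}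

/-- The trajectory is uncontrolled at negative times, so the coefficient is measurable only after
truncation. Almost every path has nonnegative hop times, where the truncation is invisible. -/
theorem Data.Admissible.measurable_tau (hD : D.Admissible CE M₀) (hN : 0 < N)
    (κ : Fin ((ν + 1) / 2) → Fin N) (hg : Measurable g) (hf : Measurable f) (i : Fin ν) :
    Measurable fun a => D.tau κ (posTimes (f a)) (g a) i :=
  (hD.measurable_hopCoeff hN (stateAfter κ i) (stateAfter κ (i + 1))).comp
    (hD.measurable_Q_comp κ (s := fun a => f a i) hg (measurable_posTimes.comp hf)
      ((measurable_pi_apply i).comp hf))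

theorem Data.Admissible.measurable_amp (hD : D.Admissible CE M₀) (κ : Fin ((ν + 1) / 2) → Fin N)
    {t : ℝ} (ht : 0 ≤ t) (hg : Measurable g) (hf : Measurable f) :
    Measurable fun a => (D.traj κ (f a)).A t (g a) := by
  have h1 : Measurable fun a => ((g a, f a), t) := (hg.prodMk hf).prodMk measurable_const
  have h2 := (hD.measurable_traj κ).2.2.2.1.comp h1
  simp only [Function.comp_def, max_eq_left ht] at h2
  exact h2

theorem Data.Admissible.measurable_phaseFn (hD : D.Admissible CE M₀)
    (κ : Fin ((ν + 1) / 2) → Fin N) {t : ℝ} (ht : 0 ≤ t) (hg : Measurable g) (hf : Measurable f)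
    (hx : Measurable x) : Measurable fun a => D.phaseFn κ (f a) t (g a) (x a) := by
  have h1 : Measurable fun a => ((g a, f a), t) := (hg.prodMk hf).prodMk measurable_const
  have hQ := (hD.measurable_traj κ).1.comp h1
  have hP := (hD.measurable_traj κ).2.1.comp h1
  have hS := (hD.measurable_traj κ).2.2.1.comp h1
  simp only [Function.comp_def, max_eq_left ht] at hQ hP hS
  unfold Data.phaseFn
  refine ((Complex.measurable_ofReal.comp hS).add (Complex.measurable_ofReal.comp
    (hP.inner (hx.sub hQ)))).add ?_
  exact (Complex.measurable_ofReal.comp ((hx.sub hQ).norm.pow_const 2)).const_mul _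

theorem Data.Admissible.measurable_weight (hD : D.Admissible CE M₀) (hN : 0 < N)
    (κ : Fin ((ν + 1) / 2) → Fin N) {t : ℝ} (ht : 0 ≤ t) (hg : Measurable g) (hf : Measurable f) :
    Measurable fun a => D.weight κ (posTimes (f a)) t (g a) := by
  have h1 := hD.measurable_cumulatedRate_comp hN κ (s := fun _ => t) hg
    (measurable_posTimes.comp hf) measurable_const
  simp only [Function.comp_def, max_eq_left ht] at h1
  unfold Data.weight
  refine (Complex.measurable_ofReal.comp (Real.measurable_exp.comp h1)).mul ?_
  refine Finset.measurable_prod _ fun i _ => ?_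
  have h2 := hD.measurable_tau hN κ hg hf i
  exact h2.div (Complex.measurable_ofReal.comp h2.norm)

theorem Data.measurable_initialDensity (D : Data m) : Measurable D.initialDensity :=
  D.measurable_initialAmp.norm.div_const _

theorem Data.Admissible.measurable_packet (hD : D.Admissible CE M₀) (hN : 0 < N)
    (κ : Fin ((ν + 1) / 2) → Fin N) {t : ℝ} (ht : 0 ≤ t) (hg : Measurable g) (hf : Measurable f)
    (hx : Measurable x) :
    Measurable fun a => D.packet t (sheetMk κ (g a, posTimes (f a))) (x a) := by
  unfold Data.packet sheetMk
  have h1 : Measurable fun a => posTimes (f a) := measurable_posTimes.comp hf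
  refine (((Complex.measurable_ofReal.comp ((D.measurable_initialDensity.comp hg).const_div _)).mul
    (hD.measurable_amp κ ht hg h1)).mul (Complex.measurable_exp.comp
    ((hD.measurable_phaseFn κ ht hg h1 hx).const_mul _))).mul (hD.measurable_weight hN κ ht hg hf)

theorem Data.Admissible.measurable_termIntegrand (hD : D.Admissible CE M₀) (hN : 0 < N)
    (κ : Fin ((ν + 1) / 2) → Fin N) {t : ℝ} (ht : 0 ≤ t) (x : Pos m) :
    Measurable fun w : Phase m × (Fin ν → ℝ) => D.termIntegrand κ t x (w.1, posTimes w.2) := by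
  unfold Data.termIntegrand
  have h1 : Measurable fun w : Phase m × (Fin ν → ℝ) => posTimes w.2 :=
    measurable_posTimes.comp measurable_snd
  refine (((Finset.measurable_prod _ fun i _ => hD.measurable_tau hN κ measurable_fst
    measurable_snd i).const_mul _).mul (hD.measurable_amp κ ht measurable_fst h1)).mul
    (Complex.measurable_exp.comp
    ((hD.measurable_phaseFn κ ht measurable_fst h1 measurable_const).const_mul _))

end Measurability

/-! ### Bounds -/

/-- `S` and `P·(x - Q)` are real and produce phases only; the modulus comes from the term `(i/2)|x -
Q|²`. -/
theorem Data.Admissible.norm_exp_phaseFn (hD : D.Admissible CE M₀)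
    (κ : Fin ((ν + 1) / 2) → Fin N) (T : Fin ν → ℝ) (t : ℝ) (z : Phase m) (x : Pos m) :
    ‖Complex.exp (Complex.I / D.ε * D.phaseFn κ T t z x)‖ =
      Real.exp (-(‖x - (D.traj κ T).Q t z‖ ^ 2 / (2 * D.ε))) := by
  have hε := hD.ε_pos.ne'
  rw [Complex.norm_exp]
  congr 1
  have h1 : Complex.I / D.ε * D.phaseFn κ T t z x =
      ((-(‖x - (D.traj κ T).Q t z‖ ^ 2 / (2 * D.ε)) : ℝ) : ℂ) +
      (((((D.traj κ T).S t z + inner ℝ ((D.traj κ T).P t z) (x - (D.traj κ T).Q t z)) / D.ε : ℝ))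
        : ℂ) * Complex.I := by
    have : (D.ε : ℂ) ≠ 0 := by exact_mod_cast hε
    simp only [Data.phaseFn]
    push_cast
    field_simp
    ring_nf
    rw [Complex.I_sq]
    ring
  rw [h1, Complex.add_re, Complex.re_ofReal_mul, Complex.I_re, mul_zero, add_zero,
    Complex.ofReal_re]

theorem Data.Admissible.norm_exp_phaseFn_le_one (hD : D.Admissible CE M₀)
    (κ : Fin ((ν + 1) / 2) → Fin N) (T : Fin ν → ℝ) (t : ℝ) (z : Phase m) (x : Pos m) :
    ‖Complex.exp (Complex.I / D.ε * D.phaseFn κ T t z x)‖ ≤ 1 := by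
  have hε := hD.ε_pos
  rw [hD.norm_exp_phaseFn, Real.exp_le_one_iff, Left.neg_nonpos_iff]
  positivity

theorem Data.Admissible.norm_hopCoeff_le (hD : D.Admissible CE M₀) (hN : 0 < N)
    (l l' : Option (Fin N)) (q : Pos m) : ‖D.hopCoeff N l l' q‖ ≤ |M₀| := by
  match l, l' with
  | none, some k => simpa [Data.hopCoeff] using hD.norm_V_le hN k q
  | some k, none => simpa [Data.hopCoeff] using hD.norm_V_le hN k q
  | none, none => simp [Data.hopCoeff]
  | some _, some _ => simp [Data.hopCoeff]

/-- The factors `τ/|τ|` have modulus `1`, or `0` if `τ` vanishes, so only `e^L` counts. -/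
theorem Data.Admissible.norm_weight_le (hD : D.Admissible CE M₀) (hN : 0 < N)
    (κ : Fin ((ν + 1) / 2) → Fin N) (T : Fin ν → ℝ) {t : ℝ} (ht : 0 ≤ t) (z : Phase m) :
    ‖D.weight κ T t z‖ ≤ Real.exp (rateBound D.Ea D.Eb M₀ * t) := by
  unfold Data.weight
  rw [norm_mul, Complex.norm_real, Real.norm_of_nonneg (Real.exp_pos _).le]
  refine (mul_le_of_le_one_right (Real.exp_pos _).le ?_).trans
    (Real.exp_le_exp.2 (hD.cumulatedRate_le hN κ T ht z))
  rw [norm_prod]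
  refine Finset.prod_le_one (fun _ _ => norm_nonneg _) fun i _ => ?_
  rw [norm_div, Complex.norm_real, norm_norm]
  exact div_self_le_one _

/-- A bound for the wave packets. -/
def Data.packetBound (D : Data m) (CE M₀ t : ℝ) : ℝ :=
  (2 * Real.pi * D.ε) ^ (-(3 * (m : ℝ) / 2)) * (∫ z : Phase m, ‖D.initialAmp z‖) *
    ampBound m CE t * Real.exp (rateBound D.Ea D.Eb M₀ * t)

theorem Data.Admissible.integral_norm_initialAmp_pos (hD : D.Admissible CE M₀) :
    0 < ∫ z : Phase m, ‖D.initialAmp z‖ := by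
  rw [hD.integral_norm_initialAmp]
  have hε := hD.ε_pos
  have : 0 < ∏ j, ((1 + D.a j) / √(D.a j)) ^ (1 / 2 : ℝ) := by
    refine Finset.prod_pos fun j _ => ?_
    have := hD.a_pos j
    positivity
  positivity

theorem ampBound_pos (m : ℕ) (CE s : ℝ) : 0 < ampBound m CE s := by
  unfold ampBound; positivity

theorem Data.Admissible.packetBound_nonneg (hD : D.Admissible CE M₀) (t : ℝ) :
    0 ≤ D.packetBound CE M₀ t := by
  have hε := hD.ε_pos
  have h1 := hD.integral_norm_initialAmp_pos
  have h2 := ampBound_pos m CE t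
  unfold Data.packetBound
  positivity

theorem Data.Admissible.initialDensity_pos (hD : D.Admissible CE M₀) (z : Phase m) :
    0 < D.initialDensity z :=
  div_pos (hD.norm_initialAmp_pos z) hD.integral_norm_initialAmp_pos

/-- This is the purpose of sampling from `π`: dividing by it cancels `|A₀(z₀)|` and leaves the
integral of `|A₀|`, the same for all initial points. -/
theorem Data.Admissible.norm_packet_le (hD : D.Admissible CE M₀) (hN : 0 < N) {t : ℝ}
    (ht : 0 ≤ t) (ω : Path m N) (x : Pos m) : ‖D.packet t ω x‖ ≤ D.packetBound CE M₀ t *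
      Real.exp (-(‖x - (D.traj ω.2.2.1 ω.2.2.2).Q t ω.1‖ ^ 2 / (2 * D.ε))) := by
  obtain ⟨z, ν, κ, T⟩ := ω
  have hε := hD.ε_pos
  have h1 := hD.norm_initialAmp_pos z
  have h2 := hD.integral_norm_initialAmp_pos
  have h3 := (hD.measurable_traj κ).2.2.2.2 T z t ht
  have h4 := hD.norm_weight_le hN κ T ht z
  have h5 := hD.initialDensity_pos z
  have h6 := ampBound_pos m CE t
  simp only [Data.packet]
  rw [norm_mul, norm_mul, norm_mul, hD.norm_exp_phaseFn, Complex.norm_real,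
    Real.norm_of_nonneg (by positivity)]
  set e := Real.exp (-(‖x - (D.traj κ T).Q t z‖ ^ 2 / (2 * D.ε)))
  set c := (2 * Real.pi * D.ε) ^ (-(3 * (m : ℝ) / 2)) with hc
  calc c / D.initialDensity z * ‖(D.traj κ T).A t z‖ * e * ‖D.weight κ T t z‖
      ≤ c / D.initialDensity z * (‖D.initialAmp z‖ * ampBound m CE t) * e *
        Real.exp (rateBound D.Ea D.Eb M₀ * t) := by gcongr
    _ = _ := by
      unfold Data.initialDensity Data.packetBound
      rw [← hc]
      field_simp

/-- A constant multiple of the integrable function `|A₀|` dominates, because the simplex of hop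
times has finite volume and all other factors are bounded. -/
theorem Data.Admissible.integrable_termIntegrand (hD : D.Admissible CE M₀) (hN : 0 < N)
    (κ : Fin ((ν + 1) / 2) → Fin N) {t : ℝ} (ht : 0 ≤ t) (x : Pos m) :
    Integrable (D.termIntegrand κ t x)
      ((volume : Measure (Phase m)).prod (volume.restrict (hopTimes ν t))) := by
  have := isFiniteMeasure_restrict_hopTimes ν ht
  have h1 : AEStronglyMeasurable (D.termIntegrand κ t x)
      ((volume : Measure (Phase m)).prod (volume.restrict (hopTimes ν t))) := by
    refine (hD.measurable_termIntegrand hN κ ht x).aestronglyMeasurable.congr ?_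
    filter_upwards [ae_mem_hopTimes ν t] with w hw
    rw [posTimes_eq fun i => (hw.2 i).1.le]
  have h2 : Integrable (fun w : Phase m × (Fin ν → ℝ) => ‖D.initialAmp w.1‖)
      ((volume : Measure (Phase m)).prod (volume.restrict (hopTimes ν t))) :=
    hD.integrable_norm_initialAmp.comp_fst _
  refine (h2.const_mul (D.h N ^ (ν / 2) * |M₀| ^ ν * ampBound m CE t)).mono' h1
    (ae_of_all _ fun w => ?_)
  have hh := (hD.h_pos hN).le
  have h3 : ‖∏ i : Fin ν, D.tau κ w.2 w.1 i‖ ≤ |M₀| ^ ν := by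
    rw [norm_prod]
    refine (Finset.prod_le_prod (fun _ _ => norm_nonneg _)
      fun i _ => hD.norm_hopCoeff_le hN _ _ _).trans ?_
    simp
  have h4 := (hD.measurable_traj κ).2.2.2.2 w.2 w.1 t ht
  have h5 := hD.norm_exp_phaseFn_le_one κ w.2 t w.1 x
  have h6 := ampBound_pos m CE t
  unfold Data.termIntegrand
  rw [norm_mul, norm_mul, norm_mul, norm_pow, Complex.norm_real, Real.norm_of_nonneg hh]
  calc _ ≤ D.h N ^ (ν / 2) * |M₀| ^ ν * (‖D.initialAmp w.1‖ * ampBound m CE t) * 1 := by gcongr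
    _ = _ := by ring

/-! ### The law of the paths -/

theorem Data.Admissible.ofReal_density_ae (hD : D.Admissible CE M₀) (κ : Fin ((ν + 1) / 2) → Fin N)
    (t : ℝ) : (fun w : Phase m × (Fin ν → ℝ) =>
        ENNReal.ofReal (D.initialDensity w.1 * D.hopDensity κ w.2 t w.1)) =ᵐ[
        (volume : Measure (Phase m)).prod (volume.restrict (hopTimes ν t))]
      fun w => ENNReal.ofReal (D.initialDensity w.1) *
        ENNReal.ofReal (Real.exp (-D.cumulatedRate κ w.2 t w.1) * D.rateProd κ w.2 w.1) := by
  filter_upwards [ae_mem_hopTimes ν t] with w hw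
  rw [D.hopDensity_eq κ hw, ENNReal.ofReal_mul (hD.initialDensity_pos _).le]

theorem Data.Admissible.measurable_density (hD : D.Admissible CE M₀) (hN : 0 < N)
    (κ : Fin ((ν + 1) / 2) → Fin N) {t : ℝ} (ht : 0 ≤ t) {α : Type*} [MeasurableSpace α]
    {g : α → Phase m} {f : α → Fin ν → ℝ} (hg : Measurable g) (hf : Measurable f) :
    Measurable fun a =>
      ENNReal.ofReal (Real.exp (-D.cumulatedRate κ (f a) t (g a)) * D.rateProd κ (f a) (g a)) := by
  have h1 := hD.measurable_cumulatedRate_comp hN κ (s := fun _ => t) hg hf measurable_const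
  simp only [max_eq_left ht] at h1
  exact ((Real.measurable_exp.comp h1.neg).mul
    (hD.measurable_rateProd_comp hN κ hg hf)).ennreal_ofReal

theorem Data.Admissible.aemeasurable_density (hD : D.Admissible CE M₀) (hN : 0 < N)
    (κ : Fin ((ν + 1) / 2) → Fin N) {t : ℝ} (ht : 0 ≤ t) :
    AEMeasurable (fun w : Phase m × (Fin ν → ℝ) =>
        ENNReal.ofReal (D.initialDensity w.1 * D.hopDensity κ w.2 t w.1))
      ((volume : Measure (Phase m)).prod (volume.restrict (hopTimes ν t))) :=
  AEMeasurable.congr (((D.measurable_initialDensity.comp measurable_fst).ennreal_ofReal.mul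
    (hD.measurable_density hN κ ht measurable_fst measurable_snd)).aemeasurable) (hD.ofReal_density_ae κ t).symm

theorem Data.Admissible.lintegral_initialDensity (hD : D.Admissible CE M₀) :
    ∫⁻ z, ENNReal.ofReal (D.initialDensity z) = 1 := by
  have h1 : Integrable D.initialDensity := hD.integrable_norm_initialAmp.div_const _
  rw [← ofReal_integral_eq_lintegral_ofReal h1 (ae_of_all _ fun z => (hD.initialDensity_pos z).le)]
  unfold Data.initialDensity
  rw [integral_div, div_self hD.integral_norm_initialAmp_pos.ne', ENNReal.ofReal_one]

/-- By Tonelli's theorem the masses of the sheets are summed for fixed initial point, where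
`tsum_probEq` gives `1`; then `π` integrates to `1`. -/
theorem Data.Admissible.isProbabilityMeasure_pathLaw (hD : D.Admissible CE M₀) (hN : 0 < N) {t : ℝ}
    (ht : 0 ≤ t) : IsProbabilityMeasure (D.pathLaw N t) := by
  refine ⟨?_⟩
  have h1 : ∀ i : Σ ν : ℕ, (Fin ((ν + 1) / 2) → Fin N),
      ((((volume : Measure (Phase m)).prod (volume.restrict (hopTimes i.1 t))).withDensity fun w =>
        ENNReal.ofReal (D.initialDensity w.1 * D.hopDensity i.2 w.2 t w.1)).map
          (sheetMk i.2)) univ = ∫⁻ z, ENNReal.ofReal (D.initialDensity z) *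
        ∫⁻ T in hopTimes i.1 t,
          ENNReal.ofReal (Real.exp (-D.cumulatedRate i.2 T t z) * D.rateProd i.2 T z) := by
    intro i
    have := isFiniteMeasure_restrict_hopTimes i.1 ht
    have hm : Measurable fun w : Phase m × (Fin i.1 → ℝ) => ENNReal.ofReal (D.initialDensity w.1) *
        ENNReal.ofReal (Real.exp (-D.cumulatedRate i.2 w.2 t w.1) * D.rateProd i.2 w.2 w.1) :=
      (D.measurable_initialDensity.comp measurable_fst).ennreal_ofReal.mul
        (hD.measurable_density hN i.2 ht measurable_fst measurable_snd)
    rw [Measure.map_apply (measurable_sheetMk i.2) MeasurableSet.univ, preimage_univ,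
      withDensity_apply _ MeasurableSet.univ, Measure.restrict_univ,
      lintegral_congr_ae (hD.ofReal_density_ae i.2 t), lintegral_prod _
        hm.aemeasurable]
    refine lintegral_congr fun z => ?_
    have hz : Measurable fun T : Fin i.1 → ℝ =>
        ENNReal.ofReal (Real.exp (-D.cumulatedRate i.2 T t z) * D.rateProd i.2 T z) :=
      hD.measurable_density hN i.2 ht (g := fun _ => z) (f := fun T => T) measurable_const
        measurable_id'
    dsimp only
    exact lintegral_const_mul _ hz
  have h2 : ∀ i : Σ ν : ℕ, (Fin ((ν + 1) / 2) → Fin N), Measurable fun z : Phase m =>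
      ENNReal.ofReal (D.initialDensity z) * ∫⁻ T in hopTimes i.1 t,
          ENNReal.ofReal (Real.exp (-D.cumulatedRate i.2 T t z) * D.rateProd i.2 T z) := by
    intro i
    have := isFiniteMeasure_restrict_hopTimes i.1 ht
    have hm := (hD.measurable_density hN i.2 ht (measurable_fst (α := Phase m) (β := Fin i.1 → ℝ))
      measurable_snd).lintegral_prod_right' (ν := volume.restrict (hopTimes i.1 t))
    exact D.measurable_initialDensity.ennreal_ofReal.mul hm
  unfold Data.pathLaw
  rw [Measure.sum_apply _ MeasurableSet.univ]
  calc _ = ∑' i : Σ ν : ℕ, (Fin ((ν + 1) / 2) → Fin N), ∫⁻ z,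
        ENNReal.ofReal (D.initialDensity z) * ∫⁻ T in hopTimes i.1 t,
          ENNReal.ofReal (Real.exp (-D.cumulatedRate i.2 T t z) * D.rateProd i.2 T z) :=
        tsum_congr h1
    _ = ∫⁻ z, ENNReal.ofReal (D.initialDensity z) * ∑' ν, D.probEq N t z ν := by
        rw [← lintegral_tsum fun i => (h2 i).aemeasurable]
        refine lintegral_congr fun z => ?_
        rw [ENNReal.tsum_mul_left, ENNReal.tsum_sigma']
        simp only [tsum_fintype]
        rfl
    _ = 1 := by
        simp_rw [hD.tsum_probEq hN ht, mul_one]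
        exact hD.lintegral_initialDensity

theorem Data.ae_pathLaw_times_nonneg (D : Data m) (N : ℕ) (t : ℝ) :
    ∀ᵐ ω ∂(D.pathLaw N t), ∀ i, 0 ≤ ω.2.2.2 i := by
  unfold Data.pathLaw
  rw [Measure.ae_sum_iff]
  intro i
  refine (measurableEmbedding_sheetMk i.2).ae_map_iff.2 ?_
  refine (withDensity_absolutelyContinuous _ _).ae_le ?_
  filter_upwards [ae_mem_hopTimes i.1 t] with w hw j
  exact (hw.2 j).1.le

end Packets

end FGS
end

noncomputable section

namespace FGS

open Set Filter Topology NNReal ENNReal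

/-! ### Unbiasedness of the wave packets -/

section Unbiased

variable {m N ν : ℕ} {D : Data m} {CE M₀ : ℝ}

/-- A rate is the modulus of the hopping coefficient, with an extra `h` when the molecule is left,
so multiplication by the phase restores the coefficient. If it vanishes, `0 / 0 = 0` keeps the
identity true. -/
theorem Data.hopRate_mul_hopCoeff (D : Data m) (l l' : Option (Fin N)) (q : Pos m) :
    (D.hopRate N l l' q : ℂ) * (D.hopCoeff N l l' q / (‖D.hopCoeff N l l' q‖ : ℂ)) =
      (if l = none then (D.h N : ℂ) else 1) * D.hopCoeff N l l' q := by
  have key : ∀ w : ℂ, (‖w‖ : ℂ) * (w / (‖w‖ : ℂ)) = w := fun w => by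
    by_cases hw : w = 0
    · simp [hw]
    · have : (‖w‖ : ℂ) ≠ 0 := by exact_mod_cast norm_ne_zero_iff.2 hw
      field_simp
  match l, l' with
  | none, some k =>
    have h1 : D.hopRate N none (some k) q = D.h N * ‖D.hopCoeff N none (some k) q‖ := by
      simp [Data.hopRate, Data.hopCoeff]
    rw [h1, Complex.ofReal_mul, mul_assoc, key, if_pos rfl]
  | some k, none =>
    have h1 : D.hopRate N (some k) none q = ‖D.hopCoeff N (some k) none q‖ := by
      simp [Data.hopRate, Data.hopCoeff]
    rw [h1, key, if_neg (by simp), one_mul]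
  | none, none => simp [Data.hopCoeff]
  | some _, some _ => simp [Data.hopCoeff]

theorem stateAfter_eq_none_iff (κ : Fin ((ν + 1) / 2) → Fin N) {i : ℕ} (hi : i ≤ ν) :
    stateAfter κ i = none ↔ i % 2 = 0 := by
  constructor
  · intro h
    by_contra h1
    obtain ⟨k, hk⟩ := exists_stateAfter_odd κ (i := i) (by omega) hi
    rw [hk] at h
    cases h
  · exact stateAfter_even κ

/-- Counts the hops that leave the molecule, those of even index: `⌈ν/2⌉` among `ν`. -/
theorem prod_ite_even (c : ℂ) (ν : ℕ) :
    ∏ i : Fin ν, (if (i : ℕ) % 2 = 0 then c else 1) = c ^ ((ν + 1) / 2) := by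
  induction ν with
  | zero => simp
  | succ n ih =>
    rw [Fin.prod_univ_castSucc]
    simp only [Fin.val_castSucc, Fin.val_last, ih]
    by_cases h : n % 2 = 0
    · rw [if_pos h, ← pow_succ]; congr 1; omega
    · rw [if_neg h, mul_one]; congr 1; omega

theorem Data.prod_hopRate_mul_tau (D : Data m) (κ : Fin ((ν + 1) / 2) → Fin N) (T : Fin ν → ℝ) (z : Phase m) :
    ((∏ i : Fin ν, D.hopRate N (stateAfter κ i) (stateAfter κ (i + 1))
      ((D.traj κ T).Q (T i) z) : ℝ) : ℂ) * ∏ i : Fin ν, D.tau κ T z i / (‖D.tau κ T z i‖ : ℂ) =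
    (D.h N : ℂ) ^ ((ν + 1) / 2) * ∏ i : Fin ν, D.tau κ T z i := by
  rw [Complex.ofReal_prod, ← Finset.prod_mul_distrib, ← prod_ite_even, ← Finset.prod_mul_distrib]
  refine Finset.prod_congr rfl fun i _ => ?_
  unfold Data.tau
  rw [D.hopRate_mul_hopCoeff]
  congr 1
  exact if_congr (stateAfter_eq_none_iff κ i.2.le) rfl rfl

/-- The factor between the wave packet and its component on a surface. -/
def Data.surfaceScale (D : Data m) (N : ℕ) : Option (Fin N) → ℂ
  | none => 1
  | some _ => 1 / (D.h N : ℂ)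

theorem Data.packetVec_eq (D : Data m) (t : ℝ) (ω : Path m N) (l : Option (Fin N)) (x : Pos m) :
    D.packetVec t ω l x =
      if stateAfter ω.2.2.1 ω.2.1 = l then D.surfaceScale N l * D.packet t ω x else 0 := by
  cases l <;> rfl

/-- A history that ends on a metal orbital has left the molecule once more than it has returned. The
factor `1/h` of the packet removes this surplus power. -/
theorem Data.Admissible.surfaceScale_mul (hD : D.Admissible CE M₀) (hN : 0 < N)
    (κ : Fin ((ν + 1) / 2) → Fin N) :
    D.surfaceScale N (stateAfter κ ν) * (D.h N : ℂ) ^ ((ν + 1) / 2) = (D.h N : ℂ) ^ (ν / 2) := by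
  have hh : (D.h N : ℂ) ≠ 0 := by exact_mod_cast (hD.h_pos hN).ne'
  rcases Nat.mod_two_eq_zero_or_one ν with hν | hν
  · have : (ν + 1) / 2 = ν / 2 := by omega
    rw [stateAfter_even κ hν, this, Data.surfaceScale, one_mul]
  · obtain ⟨k, hk⟩ := exists_stateAfter_odd κ hν le_rfl
    have : (ν + 1) / 2 = ν / 2 + 1 := by omega
    rw [hk, this, Data.surfaceScale, pow_succ]
    field_simp

/-- Unbiasedness before integration: `π` cancels `1/π`, `e^{-L}` cancels `e^L`, and rates times
phases give the hopping coefficients with the correct power of `h`. -/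
theorem Data.Admissible.density_mul_packetVec (hD : D.Admissible CE M₀) (hN : 0 < N)
    (κ : Fin ((ν + 1) / 2) → Fin N) (t : ℝ) (l : Option (Fin N)) (x : Pos m)
    (w : Phase m × (Fin ν → ℝ)) :
    ((D.initialDensity w.1 * D.hopDensity κ w.2 t w.1 : ℝ) : ℂ) *
      D.packetVec t (sheetMk κ w) l x =
    if stateAfter κ ν = l then
      (((2 * Real.pi * D.ε) ^ (-(3 * (m : ℝ) / 2)) : ℝ) : ℂ) * D.termIntegrand κ t x w else 0 := by
  obtain ⟨z, T⟩ := w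
  have hπ : (D.initialDensity z : ℂ) ≠ 0 := by exact_mod_cast (hD.initialDensity_pos z).ne'
  have h0 : D.packetVec t (sheetMk κ (z, T)) l x =
      if stateAfter κ ν = l then D.surfaceScale N l * D.packet t (sheetMk κ (z, T)) x else 0 :=
    D.packetVec_eq t (sheetMk κ (z, T)) l x
  rw [h0]
  split_ifs with hl
  swap
  · rw [mul_zero]
  subst hl
  have h1 := D.prod_hopRate_mul_tau κ T z
  have h4 : (Real.exp (-D.cumulatedRate κ T t z) : ℂ) *
      (Real.exp (D.cumulatedRate κ T t z) : ℂ) = 1 := by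
    rw [← Complex.ofReal_mul, ← Real.exp_add, neg_add_cancel, Real.exp_zero, Complex.ofReal_one]
  have h5 := hD.surfaceScale_mul hN κ
  have h6 : D.packet t (sheetMk κ (z, T)) x =
      (((2 * Real.pi * D.ε) ^ (-(3 * (m : ℝ) / 2)) / D.initialDensity z : ℝ) : ℂ)
      * (D.traj κ T).A t z * Complex.exp (Complex.I / D.ε * D.phaseFn κ T t z x)
      * ((Real.exp (D.cumulatedRate κ T t z) : ℂ) *
        ∏ i : Fin ν, D.tau κ T z i / (‖D.tau κ T z i‖ : ℂ)) := rfl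
  have h7 : D.termIntegrand κ t x (z, T) = (D.h N : ℂ) ^ (ν / 2) * (∏ i : Fin ν, D.tau κ T z i)
    * (D.traj κ T).A t z * Complex.exp (Complex.I / D.ε * D.phaseFn κ T t z x) := rfl
  rw [h6, h7, ← h5, Data.hopDensity, Complex.ofReal_mul, Complex.ofReal_mul, Complex.ofReal_div]
  -- What remains is commutative algebra in opaque factors, given `h1`, `h4` and `π₀ ≠ 0`.
  generalize D.surfaceScale N (stateAfter κ ν) = σ
  generalize Complex.exp (Complex.I / D.ε * D.phaseFn κ T t z x) = e
  generalize (D.traj κ T).A t z = A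
  generalize (D.h N : ℂ) ^ ((ν + 1) / 2) = h' at *
  generalize (∏ i : Fin ν, D.tau κ T z i / (‖D.tau κ T z i‖ : ℂ)) = p at *
  generalize (∏ i : Fin ν, D.tau κ T z i) = p' at *
  generalize (((∏ i : Fin ν, D.hopRate N (stateAfter κ i) (stateAfter κ (i + 1))
      ((D.traj κ T).Q (T i) z) : ℝ)) : ℂ) = r at *
  generalize (Real.exp (-D.cumulatedRate κ T t z) : ℂ) = e₁ at *
  generalize (Real.exp (D.cumulatedRate κ T t z) : ℂ) = e₂ at *
  generalize (((2 * Real.pi * D.ε) ^ (-(3 * (m : ℝ) / 2)) : ℝ) : ℂ) = c at *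
  generalize (D.initialDensity z : ℂ) = π₀ at *
  calc π₀ * (e₁ * r) * (σ * (c / π₀ * A * e * (e₂ * p)))
      = c * (σ * ((e₁ * e₂) * (r * p))) * A * e := by field_simp
    _ = _ := by rw [h4, h1]; ring

/-- A path with its hop times truncated to be nonnegative. -/
def posPath (ω : Path m N) : Path m N := (ω.1, ⟨ω.2.1, (ω.2.2.1, posTimes ω.2.2.2)⟩)

theorem posPath_eq {ω : Path m N} (h : ∀ i, 0 ≤ ω.2.2.2 i) : posPath ω = ω := by
  obtain ⟨z, ν, κ, T⟩ := ω
  rw [posPath, posTimes_eq h]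

theorem Data.ae_posPath_eq (D : Data m) (N : ℕ) (t : ℝ) :
    ∀ᵐ ω ∂(D.pathLaw N t), posPath ω = ω :=
  (D.ae_pathLaw_times_nonneg N t).mono fun _ => posPath_eq

theorem Data.Admissible.measurable_packetVec (hD : D.Admissible CE M₀) (hN : 0 < N) {t : ℝ}
    (ht : 0 ≤ t) (l : Option (Fin N)) :
    Measurable fun w : Path m N × Pos m => D.packetVec t (posPath w.1) l w.2 := by
  refine measurable_of_sheets fun ν κ => ?_
  have h1 := hD.measurable_packet hN κ ht (α := (Phase m × (Fin ν → ℝ)) × Pos m)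
    (measurable_fst.comp measurable_fst) (measurable_snd.comp measurable_fst) measurable_snd
  by_cases hl : stateAfter κ ν = l
  · have h2 : (fun w : (Phase m × (Fin ν → ℝ)) × Pos m =>
        D.packetVec t (posPath (sheetMk κ w.1)) l w.2) = fun w =>
        D.surfaceScale N l * D.packet t (sheetMk κ (w.1.1, posTimes w.1.2)) w.2 := by
      funext w
      rw [D.packetVec_eq]
      exact if_pos hl
    rw [h2]
    exact h1.const_mul _
  · have h2 : (fun w : (Phase m × (Fin ν → ℝ)) × Pos m =>
        D.packetVec t (posPath (sheetMk κ w.1)) l w.2) = fun w => 0 := by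
      funext w
      rw [D.packetVec_eq]
      exact if_neg hl
    rw [h2]
    exact measurable_const

theorem Data.Admissible.norm_packet_le_packetBound (hD : D.Admissible CE M₀) (hN : 0 < N) {t : ℝ}
    (ht : 0 ≤ t) (ω : Path m N) (x : Pos m) : ‖D.packet t ω x‖ ≤ D.packetBound CE M₀ t := by
  have hε := hD.ε_pos
  refine (hD.norm_packet_le hN ht ω x).trans
    (mul_le_of_le_one_right (hD.packetBound_nonneg t) ?_)
  rw [Real.exp_le_one_iff, Left.neg_nonpos_iff]
  positivity

theorem Data.Admissible.memLp_packetVec (hD : D.Admissible CE M₀) (hN : 0 < N) {t : ℝ}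
    (ht : 0 ≤ t) (l : Option (Fin N)) (x : Pos m) :
    MemLp (fun ω => D.packetVec t ω l x) 2 (D.pathLaw N t) := by
  have := hD.isProbabilityMeasure_pathLaw hN ht
  have h1 : AEStronglyMeasurable (fun ω => D.packetVec t ω l x) (D.pathLaw N t) := by
    have h2 : Measurable fun ω : Path m N => D.packetVec t (posPath ω) l x :=
      (hD.measurable_packetVec hN ht l).comp (measurable_id.prodMk measurable_const)
    refine h2.aestronglyMeasurable.congr ?_
    filter_upwards [D.ae_posPath_eq N t] with ω hω
    rw [hω]
  refine MemLp.of_bound h1 (‖D.surfaceScale N l‖ * D.packetBound CE M₀ t) (ae_of_all _ fun ω => ?_)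
  rw [D.packetVec_eq]
  split_ifs
  · rw [norm_mul]
    gcongr
    exact hD.norm_packet_le_packetBound hN ht ω x
  · rw [norm_zero]
    exact mul_nonneg (norm_nonneg _) (hD.packetBound_nonneg t)

theorem Data.Admissible.integral_sheet_packetVec (hD : D.Admissible CE M₀) (hN : 0 < N) {t : ℝ}
    (ht : 0 ≤ t) (κ : Fin ((ν + 1) / 2) → Fin N) (l : Option (Fin N)) (x : Pos m) :
    ∫ ω, D.packetVec t ω l x ∂((((volume : Measure (Phase m)).prod
      (volume.restrict (hopTimes ν t))).withDensity fun w =>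
        ENNReal.ofReal (D.initialDensity w.1 * D.hopDensity κ w.2 t w.1)).map (sheetMk κ)) =
    if stateAfter κ ν = l then D.term κ t x else 0 := by
  have h0 : ∀ w : Phase m × (Fin ν → ℝ), (ENNReal.ofReal
      (D.initialDensity w.1 * D.hopDensity κ w.2 t w.1)).toReal =
      D.initialDensity w.1 * D.hopDensity κ w.2 t w.1 := fun w =>
    ENNReal.toReal_ofReal (mul_nonneg (hD.initialDensity_pos _).le (mul_nonneg (Real.exp_pos _).le
      (Finset.prod_nonneg fun _ _ => hD.hopRate_nonneg hN _ _ _)))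
  rw [(measurableEmbedding_sheetMk κ).integral_map,
    integral_withDensity_eq_integral_toReal_smul₀ (hD.aemeasurable_density hN κ ht)
      (ae_of_all _ fun _ => ENNReal.ofReal_lt_top)]
  simp_rw [h0, Complex.real_smul, hD.density_mul_packetVec hN]
  split_ifs with hl
  · rw [integral_const_mul]; rfl
  · simp

/-- The law is a sum of measures over the sheets, so an integrable function has an expectation that
is the convergent sum of the sheet integrals. Grouping by the number of hops gives the series of
`U_FG`, and its convergence at the same time. -/
theorem Data.Admissible.hasSum_term (hD : D.Admissible CE M₀) (hN : 0 < N) {t : ℝ}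
    (ht : 0 ≤ t) (l : Option (Fin N)) (x : Pos m) :
    HasSum (D.termSum N t l x) (∫ ω, D.packetVec t ω l x ∂(D.pathLaw N t)) := by
  have := hD.isProbabilityMeasure_pathLaw hN ht
  have h1 := hasSum_integral_measure ((hD.memLp_packetVec hN ht l x).integrable one_le_two)
  have h2 := h1.congr_fun fun i => (hD.integral_sheet_packetVec hN ht i.2 l x).symm
  exact h2.sigma fun ν => hasSum_fintype _

theorem Data.Admissible.UFG_eq (hD : D.Admissible CE M₀) (hN : 0 < N) {t : ℝ}
    (ht : 0 ≤ t) (l : Option (Fin N)) (x : Pos m) :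
    D.UFG N t l x = ∫ ω, D.packetVec t ω l x ∂(D.pathLaw N t) :=
  (hD.hasSum_term hN ht l x).tsum_eq

theorem Data.Admissible.measurable_UFG (hD : D.Admissible CE M₀) (hN : 0 < N) {t : ℝ}
    (ht : 0 ≤ t) (l : Option (Fin N)) : Measurable (D.UFG N t l) := by
  have := hD.isProbabilityMeasure_pathLaw hN ht
  have h1 : D.UFG N t l = fun x => ∫ ω, D.packetVec t (posPath ω) l x ∂(D.pathLaw N t) := by
    funext x
    rw [hD.UFG_eq hN ht]
    refine integral_congr_ae ?_
    filter_upwards [D.ae_posPath_eq N t] with ω hω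
    rw [hω]
  rw [h1]
  exact ((hD.measurable_packetVec hN ht l).stronglyMeasurable.integral_prod_left').measurable

end Unbiased

end FGS
end

noncomputable section

namespace FGS

open Set Filter Topology NNReal ENNReal

/-! ### The mean square error -/

section MeanSquareError

variable {m N M : ℕ} {D : Data m} {CE M₀ : ℝ}

theorem lintegral_exp_neg_sq {ε : ℝ} (hε : 0 < ε) (y : Pos m) :
    ∫⁻ x : Pos m, ENNReal.ofReal (Real.exp (-(‖x - y‖ ^ 2 / (2 * ε))) ^ 2) =
      ENNReal.ofReal ((Real.pi * ε) ^ ((m : ℝ) / 2)) := by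
  have h1 : ∀ x : Pos m, Real.exp (-(‖x - y‖ ^ 2 / (2 * ε))) ^ 2 =
      ∏ j, Real.exp (-(1 / ε) * (x j - y j) ^ 2) := fun x => by
    rw [← Real.exp_nat_mul, ← Real.exp_sum, EuclideanSpace.norm_sq_eq, ← Finset.mul_sum]
    congr 1
    simp only [PiLp.sub_apply, Real.norm_eq_abs, sq_abs]
    push_cast
    field_simp
  simp_rw [h1]
  rw [← ofReal_integral_eq_lintegral_ofReal (integrable_prod_exp (fun _ => by positivity) y)
    (ae_of_all _ fun x => Finset.prod_nonneg fun _ _ => (Real.exp_pos _).le),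
    integral_prod_exp (fun _ => 1 / ε) y]
  congr 1
  rw [Finset.prod_const, Finset.card_univ, Fintype.card_fin, div_div_eq_mul_div, div_one,
    Real.sqrt_eq_rpow, ← Real.rpow_natCast, ← Real.rpow_mul (by positivity)]
  congr 1
  ring

theorem enorm_toLp_sq {ι : Type*} [Fintype ι] (v : ι → ℂ) :
    ‖(WithLp.toLp 2 v : EuclideanSpace ℂ ι)‖ₑ ^ 2 = ∑ i, ‖v i‖ₑ ^ 2 := by
  rw [← ofReal_norm, ← ENNReal.ofReal_pow (norm_nonneg _), EuclideanSpace.norm_sq_eq,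
    ENNReal.ofReal_sum_of_nonneg fun _ _ => sq_nonneg _]
  refine Finset.sum_congr rfl fun i _ => ?_
  rw [ENNReal.ofReal_pow (norm_nonneg _), ofReal_norm]

theorem eLpNorm_two_sq {α E : Type*} [MeasurableSpace α] [NormedAddCommGroup E] (μ : Measure α)
    (f : α → E) : eLpNorm f 2 μ ^ 2 = ∫⁻ a, ‖f a‖ₑ ^ 2 ∂μ := by
  have := eLpNorm_nnreal_pow_eq_lintegral (p := 2) (f := f) (μ := μ) two_ne_zero
  simpa using this

/-- The squared `l`-th component of the deviation of the sample average at a point. -/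
def Data.deviation (D : Data m) (t : ℝ) (l : Option (Fin N)) (ω : Fin M → Path m N) (x : Pos m) :
    ℝ≥0∞ :=
  ‖(D.diagR N l : ℂ) * ((1 / (M : ℂ)) * (∑ j, D.packetVec t (ω j) l x) - D.UFG N t l x)‖ₑ ^ 2

theorem Data.sampleError_sq (D : Data m) (t : ℝ) (ω : Fin M → Path m N) :
    D.sampleError t ω ^ 2 = ∫⁻ x, ∑ l, D.deviation t l ω x := by
  rw [Data.sampleError, eLpNorm_two_sq]
  simp_rw [enorm_toLp_sq]
  rfl

theorem Data.Admissible.measurable_packetVec_comp (hD : D.Admissible CE M₀) (hN : 0 < N) {t : ℝ}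
    (ht : 0 ≤ t) (l : Option (Fin N)) {α : Type*} [MeasurableSpace α] {f : α → Path m N}
    {x : α → Pos m} (hf : Measurable f) (hx : Measurable x) :
    Measurable fun a => D.packetVec t (posPath (f a)) l (x a) := by
  have h1 : Measurable fun a => (f a, x a) := hf.prodMk hx
  have h2 := (hD.measurable_packetVec hN ht l).comp h1
  simp only [Function.comp_def] at h2
  exact h2

theorem Data.Admissible.measurable_deviation (hD : D.Admissible CE M₀) (hN : 0 < N) {t : ℝ}
    (ht : 0 ≤ t) (l : Option (Fin N)) {α : Type*} [MeasurableSpace α] {f : α → Fin M → Path m N}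
    {x : α → Pos m} (hf : Measurable f) (hx : Measurable x) :
    Measurable fun a => D.deviation t l (fun j => posPath (f a j)) (x a) := by
  unfold Data.deviation
  have h1 : Measurable fun a => ∑ j, D.packetVec t (posPath (f a j)) l (x a) :=
    Finset.measurable_sum _ fun j _ =>
      hD.measurable_packetVec_comp hN ht l ((measurable_pi_apply j).comp hf) hx
  have h3 : Measurable fun a => D.UFG N t l (x a) := (hD.measurable_UFG hN ht l).comp hx
  exact ((((h1.const_mul _).sub h3).const_mul _).enorm).pow_const 2

theorem Data.Admissible.ae_posPath_pi_eq (hD : D.Admissible CE M₀) (hN : 0 < N) {t : ℝ}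
    (ht : 0 ≤ t) : ∀ᵐ ω : Fin M → Path m N ∂(Measure.pi fun _ => D.pathLaw N t),
      (fun j => posPath (ω j)) = ω := by
  have := hD.isProbabilityMeasure_pathLaw hN ht
  have h1 : ∀ᵐ ω : Fin M → Path m N ∂(Measure.pi fun _ => D.pathLaw N t),
      ∀ j, posPath (ω j) = ω j :=
    ae_all_iff.2 fun j => (Measure.quasiMeasurePreserving_eval (fun _ : Fin M => D.pathLaw N t)
      j).ae (D.ae_posPath_eq N t)
  filter_upwards [h1] with ω hω
  exact funext hω

theorem Data.Admissible.measurable_sampleError (hD : D.Admissible CE M₀) (hN : 0 < N) {t : ℝ}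
    (ht : 0 ≤ t) : Measurable fun ω : Fin M → Path m N =>
      D.sampleError t fun j => posPath (ω j) := by
  have h1 : Measurable fun ω : Fin M → Path m N =>
      ∫⁻ x, ∑ l, D.deviation t l (fun j => posPath (ω j)) x := by
    have h2 : Measurable fun w : (Fin M → Path m N) × Pos m =>
        ∑ l, D.deviation t l (fun j => posPath (w.1 j)) w.2 :=
      Finset.measurable_sum _ fun l _ =>
        hD.measurable_deviation hN ht l measurable_fst measurable_snd
    exact h2.lintegral_prod_right' (ν := volume)
  have h3 : (fun ω : Fin M → Path m N => D.sampleError t fun j => posPath (ω j)) = fun ω =>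
      (∫⁻ x, ∑ l, D.deviation t l (fun j => posPath (ω j)) x) ^ (1 / 2 : ℝ) := by
    funext ω
    rw [← D.sampleError_sq, ← ENNReal.rpow_natCast, ← ENNReal.rpow_mul]
    norm_num
  rw [h3]
  exact h1.pow_const _

/-- At fixed `x`, `U_FG` is the expectation of the packet, so the bound for averages of independent
samples applies; the weight of the surface is a common factor. -/
theorem Data.Admissible.lintegral_deviation_le (hD : D.Admissible CE M₀) (hN : 0 < N)
    (hM : 0 < M) {t : ℝ} (ht : 0 ≤ t) (l : Option (Fin N)) (x : Pos m) :
    ∫⁻ ω : Fin M → Path m N, D.deviation t l ω x ∂(Measure.pi fun _ => D.pathLaw N t) ≤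
      ENNReal.ofReal (1 / M) *
        ∫⁻ ω, ‖(D.diagR N l : ℂ) * D.packetVec t ω l x‖ₑ ^ 2 ∂(D.pathLaw N t) := by
  have := hD.isProbabilityMeasure_pathLaw hN ht
  have h1 : ∫⁻ ω : Fin M → Path m N,
      ‖(1 / (M : ℂ)) * (∑ j, D.packetVec t (ω j) l x) - D.UFG N t l x‖ₑ ^ 2
        ∂(Measure.pi fun _ => D.pathLaw N t) ≤
      ENNReal.ofReal (1 / M) * ∫⁻ ω, ‖D.packetVec t ω l x‖ₑ ^ 2 ∂(D.pathLaw N t) := by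
    rw [hD.UFG_eq hN ht]
    have h0 := hD.memLp_packetVec hN ht l x
    have h4 := lintegral_enorm_average_sub_sq_le h0 hM
    beta_reduce at h4
    exact h4
  have htop : ‖(D.diagR N l : ℂ)‖ₑ ^ 2 ≠ ∞ := ENNReal.pow_ne_top enorm_ne_top
  have h2 : ∀ ω : Fin M → Path m N, D.deviation t l ω x = ‖(D.diagR N l : ℂ)‖ₑ ^ 2 *
      ‖(1 / (M : ℂ)) * (∑ j, D.packetVec t (ω j) l x) - D.UFG N t l x‖ₑ ^ 2 := fun ω => by
    rw [Data.deviation, enorm_mul, mul_pow]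
  have h3 : ∀ ω : Path m N, ‖(D.diagR N l : ℂ) * D.packetVec t ω l x‖ₑ ^ 2 =
      ‖(D.diagR N l : ℂ)‖ₑ ^ 2 * ‖D.packetVec t ω l x‖ₑ ^ 2 := fun ω => by
    rw [enorm_mul, mul_pow]
  rw [lintegral_congr h2, lintegral_congr h3, lintegral_const_mul' _ _ htop,
    lintegral_const_mul' _ _ htop, mul_left_comm]
  exact mul_le_mul_right h1 _

theorem Data.Admissible.diagR_mul_surfaceScale (hD : D.Admissible CE M₀) (hN : 0 < N)
    (l : Option (Fin N)) : (D.diagR N l : ℂ) * D.surfaceScale N l = 1 := by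
  have hh : (D.h N : ℂ) ≠ 0 := by exact_mod_cast (hD.h_pos hN).ne'
  cases l with
  | none => simp [Data.diagR, Data.surfaceScale]
  | some k => simp only [Data.diagR, Data.surfaceScale]; field_simp

/-- Only the occupied surface contributes, and there `R_N` undoes the factor `1/h`. The weighted
norm thus contains no negative power of `h`, which would grow with `N`. -/
theorem Data.Admissible.sum_enorm_packetVec (hD : D.Admissible CE M₀) (hN : 0 < N) (t : ℝ)
    (ω : Path m N) (x : Pos m) :
    ∑ l, ‖(D.diagR N l : ℂ) * D.packetVec t ω l x‖ₑ ^ 2 = ‖D.packet t ω x‖ₑ ^ 2 := by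
  rw [Finset.sum_eq_single (stateAfter ω.2.2.1 ω.2.1)]
  · rw [D.packetVec_eq, if_pos rfl, ← mul_assoc, hD.diagR_mul_surfaceScale hN, one_mul]
  · intro l _ hl
    rw [D.packetVec_eq, if_neg hl.symm]
    simp
  · simp

theorem Data.Admissible.lintegral_packet_sq_le (hD : D.Admissible CE M₀) (hN : 0 < N) {t : ℝ}
    (ht : 0 ≤ t) (ω : Path m N) : ∫⁻ x, ‖D.packet t ω x‖ₑ ^ 2 ≤
      ENNReal.ofReal (D.packetBound CE M₀ t ^ 2 * (Real.pi * D.ε) ^ ((m : ℝ) / 2)) := by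
  have hB := hD.packetBound_nonneg t
  rw [ENNReal.ofReal_mul (sq_nonneg _),
    ← lintegral_exp_neg_sq hD.ε_pos ((D.traj ω.2.2.1 ω.2.2.2).Q t ω.1),
    ← lintegral_const_mul' _ _ ENNReal.ofReal_ne_top]
  refine lintegral_mono fun x => ?_
  rw [← ENNReal.ofReal_mul (sq_nonneg _), ← mul_pow, ← ofReal_norm,
    ← ENNReal.ofReal_pow (norm_nonneg _)]
  refine ENNReal.ofReal_le_ofReal (pow_le_pow_left₀ (norm_nonneg _) ?_ 2)
  exact hD.norm_packet_le hN ht ω x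

/-- The integrals over `x` and over the samples are exchanged twice: first to use the variance bound
at fixed `x`, then to integrate the Gaussian in `x` at a fixed path, with a bound that is the same
for all paths. -/
theorem Data.Admissible.lintegral_sampleError_sq_le (hD : D.Admissible CE M₀) (hN : 0 < N)
    (hM : 0 < M) {t : ℝ} (ht : 0 ≤ t) :
    ∫⁻ ω : Fin M → Path m N, D.sampleError t ω ^ 2 ∂(Measure.pi fun _ => D.pathLaw N t) ≤
      ENNReal.ofReal (1 / M *
        (D.packetBound CE M₀ t ^ 2 * (Real.pi * D.ε) ^ ((m : ℝ) / 2))) := by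
  have := hD.isProbabilityMeasure_pathLaw hN ht
  have hms : Measurable fun w : (Fin M → Path m N) × Pos m =>
      ∑ l, D.deviation t l (fun j => posPath (w.1 j)) w.2 :=
    Finset.measurable_sum _ fun l _ => hD.measurable_deviation hN ht l measurable_fst measurable_snd
  have hpms : Measurable fun w : Path m N × Pos m =>
      ∑ l, ‖(D.diagR N l : ℂ) * D.packetVec t (posPath w.1) l w.2‖ₑ ^ 2 :=
    Finset.measurable_sum _ fun l _ => (((hD.measurable_packetVec_comp hN ht l measurable_fst
      measurable_snd).const_mul _).enorm).pow_const 2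
  have hpoint : ∀ x, ∫⁻ ω : Fin M → Path m N, ∑ l, D.deviation t l (fun j => posPath (ω j)) x
      ∂(Measure.pi fun _ => D.pathLaw N t) ≤ ENNReal.ofReal (1 / M) *
        ∫⁻ ω, ∑ l, ‖(D.diagR N l : ℂ) * D.packetVec t (posPath ω) l x‖ₑ ^ 2
          ∂(D.pathLaw N t) := by
    intro x
    have hmx : ∀ l : Option (Fin N), Measurable fun ω : Fin M → Path m N =>
        D.deviation t l (fun j => posPath (ω j)) x := fun l =>
      hD.measurable_deviation hN ht l measurable_id' measurable_const
    have hpmx : ∀ l : Option (Fin N), Measurable fun ω : Path m N =>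
        ‖(D.diagR N l : ℂ) * D.packetVec t (posPath ω) l x‖ₑ ^ 2 := fun l =>
      (((hD.measurable_packetVec_comp hN ht l measurable_id'
        measurable_const).const_mul _).enorm).pow_const 2
    rw [lintegral_finsetSum _ fun l _ => hmx l, lintegral_finsetSum _ fun l _ => hpmx l,
      Finset.mul_sum]
    refine Finset.sum_le_sum fun l _ => ?_
    have h1 : ∫⁻ ω : Fin M → Path m N, D.deviation t l (fun j => posPath (ω j)) x
        ∂(Measure.pi fun _ => D.pathLaw N t) = ∫⁻ ω : Fin M → Path m N, D.deviation t l ω x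
        ∂(Measure.pi fun _ => D.pathLaw N t) := by
      refine lintegral_congr_ae ?_
      filter_upwards [hD.ae_posPath_pi_eq hN ht] with ω hω
      rw [hω]
    have h2 : ∫⁻ ω, ‖(D.diagR N l : ℂ) * D.packetVec t (posPath ω) l x‖ₑ ^ 2 ∂(D.pathLaw N t) =
        ∫⁻ ω, ‖(D.diagR N l : ℂ) * D.packetVec t ω l x‖ₑ ^ 2 ∂(D.pathLaw N t) := by
      refine lintegral_congr_ae ?_
      filter_upwards [D.ae_posPath_eq N t] with ω hω
      rw [hω]
    rw [h1, h2]
    exact hD.lintegral_deviation_le hN hM ht l x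
  calc ∫⁻ ω : Fin M → Path m N, D.sampleError t ω ^ 2 ∂(Measure.pi fun _ => D.pathLaw N t)
      = ∫⁻ ω : Fin M → Path m N, (∫⁻ x, ∑ l, D.deviation t l (fun j => posPath (ω j)) x)
          ∂(Measure.pi fun _ => D.pathLaw N t) := by
        refine lintegral_congr_ae ?_
        filter_upwards [hD.ae_posPath_pi_eq hN ht] with ω hω
        rw [hω, D.sampleError_sq]
    _ = ∫⁻ x, ∫⁻ ω : Fin M → Path m N, ∑ l, D.deviation t l (fun j => posPath (ω j)) x
          ∂(Measure.pi fun _ => D.pathLaw N t) := lintegral_lintegral_swap hms.aemeasurable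
    _ ≤ ∫⁻ x, ENNReal.ofReal (1 / M) *
        ∫⁻ ω, ∑ l, ‖(D.diagR N l : ℂ) * D.packetVec t (posPath ω) l x‖ₑ ^ 2
          ∂(D.pathLaw N t) := lintegral_mono hpoint
    _ = ENNReal.ofReal (1 / M) * ∫⁻ ω, (∫⁻ x,
          ∑ l, ‖(D.diagR N l : ℂ) * D.packetVec t (posPath ω) l x‖ₑ ^ 2) ∂(D.pathLaw N t) := by
        rw [lintegral_const_mul' _ _ ENNReal.ofReal_ne_top,
          ← lintegral_lintegral_swap hpms.aemeasurable]
    _ ≤ ENNReal.ofReal (1 / M) * ∫⁻ _ω : Path m N, ENNReal.ofReal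
          (D.packetBound CE M₀ t ^ 2 * (Real.pi * D.ε) ^ ((m : ℝ) / 2)) ∂(D.pathLaw N t) := by
        gcongr with ω
        simp_rw [hD.sum_enorm_packetVec hN]
        exact hD.lintegral_packet_sq_le hN ht _
    _ = _ := by
        rw [lintegral_const, measure_univ, mul_one,
          ENNReal.ofReal_mul (p := 1 / (M : ℝ)) (by positivity)]

/-- All powers of `ε` cancel: the prefactor `(2πε)^{-3m/2}` against the one in `∫|A₀|`, and the
square of `(πε)^{-m/4}` against the Gaussian integral in `x`. -/
theorem Data.Admissible.packetBound_sq (hD : D.Admissible CE M₀) (t : ℝ) :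
    D.packetBound CE M₀ t ^ 2 * (Real.pi * D.ε) ^ ((m : ℝ) / 2) =
      ((2 : ℝ) ^ ((m : ℝ) / 2) * ampBound m CE t * Real.exp (rateBound D.Ea D.Eb M₀ * t) *
        ∏ j, ((1 + D.a j) / √(D.a j)) ^ (1 / 2 : ℝ)) ^ 2 := by
  have hε := hD.ε_pos
  have h1 : (2 * Real.pi * D.ε) ^ (-(3 * (m : ℝ) / 2)) * (2 * Real.pi * D.ε) ^ (3 * (m : ℝ) / 2) =
      1 := by
    rw [← Real.rpow_add (by positivity), neg_add_cancel, Real.rpow_zero]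
  have h2 : ((Real.pi * D.ε) ^ (-(m : ℝ) / 4)) ^ 2 * (Real.pi * D.ε) ^ ((m : ℝ) / 2) = 1 := by
    rw [← Real.rpow_natCast, ← Real.rpow_mul (by positivity), ← Real.rpow_add (by positivity),
      show -(m : ℝ) / 4 * (2 : ℕ) + m / 2 = 0 by push_cast; ring, Real.rpow_zero]
  rw [Data.packetBound, hD.integral_norm_initialAmp]
  generalize (2 * Real.pi * D.ε) ^ (-(3 * (m : ℝ) / 2)) = c at *
  generalize (2 * Real.pi * D.ε) ^ (3 * (m : ℝ) / 2) = c' at *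
  generalize (Real.pi * D.ε) ^ (-(m : ℝ) / 4) = d at *
  generalize (Real.pi * D.ε) ^ ((m : ℝ) / 2) = d' at *
  generalize (2 : ℝ) ^ ((m : ℝ) / 2) = e
  generalize ∏ j, ((1 + D.a j) / √(D.a j)) ^ (1 / 2 : ℝ) = G
  generalize ampBound m CE t = B
  generalize Real.exp (rateBound D.Ea D.Eb M₀ * t) = r
  calc (c * (e * d * c' * G) * B * r) ^ 2 * d'
      = (c * c') ^ 2 * (d ^ 2 * d') * (e * B * r * G) ^ 2 := by ring
    _ = _ := by rw [h1, h2]; ring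

theorem Data.Admissible.Err_le (hD : D.Admissible CE M₀) (hN : 0 < N) (hM : 0 < M) {t : ℝ}
    (ht : 0 ≤ t) : D.Err M t N ≤ ENNReal.ofReal (1 / √(M : ℝ) *
      ((2 : ℝ) ^ ((m : ℝ) / 2) * ampBound m CE t * Real.exp (rateBound D.Ea D.Eb M₀ * t)) *
        ∏ j, ((1 + D.a j) / √(D.a j)) ^ (1 / 2 : ℝ)) := by
  have h1 := hD.lintegral_sampleError_sq_le hN hM ht
  rw [hD.packetBound_sq] at h1
  have hM0 : (0 : ℝ) < M := by exact_mod_cast hM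
  have hG : 0 ≤ ∏ j, ((1 + D.a j) / √(D.a j)) ^ (1 / 2 : ℝ) := Finset.prod_nonneg fun j _ => by
    have := hD.a_pos j
    positivity
  have hB := ampBound_pos m CE t
  have h2 : 1 / (M : ℝ) * ((2 : ℝ) ^ ((m : ℝ) / 2) * ampBound m CE t *
      Real.exp (rateBound D.Ea D.Eb M₀ * t) * ∏ j, ((1 + D.a j) / √(D.a j)) ^ (1 / 2 : ℝ)) ^ 2 =
      (1 / √(M : ℝ) * ((2 : ℝ) ^ ((m : ℝ) / 2) * ampBound m CE t *
        Real.exp (rateBound D.Ea D.Eb M₀ * t)) *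
        ∏ j, ((1 + D.a j) / √(D.a j)) ^ (1 / 2 : ℝ)) ^ 2 := by
    rw [mul_assoc (1 / √(M : ℝ)), mul_pow (1 / √(M : ℝ)), div_pow, Real.sq_sqrt hM0.le, one_pow]
  rw [h2, ENNReal.ofReal_pow (by positivity)] at h1
  calc D.Err M t N ≤ (ENNReal.ofReal (1 / √(M : ℝ) * ((2 : ℝ) ^ ((m : ℝ) / 2) * ampBound m CE t *
        Real.exp (rateBound D.Ea D.Eb M₀ * t)) *
        ∏ j, ((1 + D.a j) / √(D.a j)) ^ (1 / 2 : ℝ)) ^ 2) ^ (1 / 2 : ℝ) :=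
        ENNReal.rpow_le_rpow h1 (by norm_num)
    _ = _ := by
        rw [← ENNReal.rpow_natCast, ← ENNReal.rpow_mul]
        norm_num

theorem Data.Admissible.wellDefined (hD : D.Admissible CE M₀) (hN : 0 < N) {t : ℝ}
    (ht : 0 ≤ t) : D.WellDefined M t N where
  solves _ κ T _ := hD.solves_traj κ T
  prob := hD.isProbabilityMeasure_pathLaw hN ht
  integrable _ κ x := hD.integrable_termIntegrand hN κ ht x
  summable l x := (hD.hasSum_term hN ht l x).summable
  measurable := by
    refine (hD.measurable_sampleError hN ht).aemeasurable.congr ?_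
    filter_upwards [hD.ae_posPath_pi_eq hN ht] with ω hω
    rw [hω]

end MeanSquareError

end FGS
end

/-! ### Conclusion, with an explicit `K`. -/

open scoped ContDiff in
theorem theorem4p1 (m : ℕ) (Ea Eb : ℝ) (hE : Ea < Eb) (CE M₀ : ℝ) :
    ∃ K : ℝ → ℝ, ∀ D : FGS.Data m,
      D.Ea = Ea → D.Eb = Eb → 0 < D.ε → (∀ j, 0 < D.a j) →
      ContDiff ℝ ∞ D.U₀ → ContDiff ℝ ∞ D.U₁ →
      (∀ q j k, |FGS.hessian D.U₀ q j k| ≤ CE) →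
      (∀ q j k, |FGS.hessian D.U₁ q j k| ≤ CE) →
      (∀ e ∈ Set.Icc Ea Eb, Measurable (D.V e)) →
      (∀ e ∈ Set.Icc Ea Eb, ∀ x, ‖D.V e x‖ ≤ M₀) →
      ∀ N M : ℕ, 0 < N → 0 < M → ∀ t : ℝ, 0 ≤ t →
        D.WellDefined M t N ∧
        D.Err M t N ≤ ENNReal.ofReal
          (1 / √(M : ℝ) * K t * ∏ j, ((1 + D.a j) / √(D.a j)) ^ (1 / 2 : ℝ)) := by
  -- The factors are the constant left over from `∫|A₀|`, the growth of the amplitude, and the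
  -- largest possible `e^L`.
  refine ⟨fun t => (2 : ℝ) ^ ((m : ℝ) / 2) * FGS.ampBound m CE t *
    Real.exp (FGS.rateBound Ea Eb M₀ * t), ?_⟩
  rintro D rfl rfl hε ha hU₀ hU₁ hH₀ hH₁ hVm hVb N M hN hM t ht
  have hD : D.Admissible CE M₀ := ⟨hE, hε, ha, hU₀, hU₁, hH₀, hH₁, hVm, hVb⟩
  exact ⟨hD.wellDefined hN ht, hD.Err_le hN hM ht⟩
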